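/- Let $\mathfrak g=\mathfrak e_7$ be the compact simple Lie algebra of type $E_7$, of dimension $133$, with Killing form $B$. Let $\beta_1,\dots,\beta_7$ be the seven pairwise orthogonal roots $$\varepsilon_2-\varepsilon_1,\quad \varepsilon_1+\varepsilon_2,\quad \varepsilon_4-\varepsilon_3,\quad \varepsilon_3+\varepsilon_4,\quad \varepsilon_6-\varepsilon_5,\quad \varepsilon_5+\varepsilon_6,\quad \varepsilon_8-\varepsilon_7$$ of the root system $\{\pm\varepsilon_i\pm\varepsilon_j:1\le i<j\le 6\}\cup\{\pm(\varepsilon_7-\varepsilon_8)\}\cup\{\tfrac12(\sum_{i=1}^6\pm\varepsilon_i\pm(\varepsilon_7-\varepsilon_8)): \text{an odd number of minus signs among the first six}\}$. Let $\mathfrak k\cong\mathfrak{su}(2)^7$ be the subalgebra of maximal rank with root system $\{\pm\beta_1,\dots,\pm\beta_7\}$, let $\mathfrak p$ be its $B$-orthogonal complement, and let $M=G/K=E_7/SU(2)^7$ be the corresponding homogeneous space, with $K$ connected. A $G$-invariant Riemannian metric on $M$ is the same as an $\mathrm{Ad}(K)$-invariant inner product on $\mathfrak p$; the standard metric $g_B$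 is the one given by $-B|_{\mathfrak p\times\mathfrak p}$. Let $\mathrm{sym}(\mathfrak p)^K$ be the space of $g_B$-self-adjoint operators on $\mathfrak p$ that commute with $\mathrm{Ad}(K)$; through $T=g_B(A\,\cdot,\cdot)$ it is the space of $G$-invariant symmetric $2$-tensors. For $X\in\mathfrak p$ let $\mathrm{ad}_{\mathfrak p}X:Y\mapsto[X,Y]_{\mathfrak p}$, and let $$\mathrm L_{\mathfrak p}A=-\tfrac12\sum_i[\mathrm{ad}_{\mathfrak p}X_i,[\mathrm{ad}_{\mathfrak p}X_i,A]],\qquad A\in\mathrm{sym}(\mathfrak p)^K,$$ with $\{X_i\}$ any $g_B$-orthonormal basis of $\mathfrak p$. Let $I_1,\dots,I_7$ be the sets $\{1,2,3,4\}$, $\{1,2,5,6\}$, $\{3,4,5,6\}$, $\{1,3,5,7\}$, $\{2,4,5,7\}$, $\{1,4,6,7\}$, $\{2,3,6,7\}$, and let $\mathfrak p_k\subset\mathfrak p$ be the real subspace whose complexification is the sum of the root spaces of the roots that are non-orthogonal to $\beta_j$ exactly for $j\in I_k$. For $g_B$-orthonormal bases $\{X^i_\alpha\}$ of the $\mathfrak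 p_i$, let $[ijk]=\sum_{\alpha,\beta,\gamma}g_B([X^i_\alpha,X^j_\beta],X^k_\gamma)^2$. Then the following hold. 1. $\mathfrak p=\mathfrak p_1\oplus\dots\oplus\mathfrak p_7$ is an orthogonal decomposition into $16$-dimensional, $\mathrm{Ad}(K)$-irreducible and pairwise inequivalent subspaces. 2. The non-zero structural constants are all equal: $[ijk]=\tfrac{16}{9}$ if $I_k$ is the symmetric difference of $I_i$ and $I_j$, and $[ijk]=0$ otherwise. 3. $g_B$ is a $G$-invariant Einstein metric, $\mathrm{Rc}(g_B)=\tfrac13 g_B$; that is, $\rho=\tfrac13$. 4. $\mathrm L_{\mathfrak p}$ maps $\mathrm{sym}(\mathfrak p)^K$ to itself and is the Lichnerowicz Laplacian of $g_B$ on $G$-invariant symmetric $2$-tensors; and $A\in\mathrm{sym}(\mathfrak p)^K$ gives a TT-tensor (traceless and divergence free) if and only if $\operatorname{tr}A=0$. Moreover $\dim\mathrm{sym}(\mathfrak p)^K=7$, and $\mathrm L_{\mathfrak p}$ has exactly the eigenvalues $0$, with multiplicity $1$, and $\tfrac79$, with multiplicity $6$. 5. The least eigenvalue of the Lichnerowicz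 Laplacian of $g_B$ on $G$-invariant TT-tensors is $\tfrac79>\tfrac23=2\rho$. Hence $g_B$ is $G$-stable (it is Einstein with constant $\rho$ and this least eigenvalue is larger than $2\rho$), and $g_B$ is a local maximum of the scalar curvature on the space of $G$-invariant metrics on $M$ of the same volume as $g_B$. -/

import Mathlib

/-!
The homogeneous space `E₇/SU(2)⁷`: the compact Lie algebra `e₇`, the subalgebra `𝔰𝔲(2)⁷`, the
isotropy representation, and the Riemannian geometry of the invariant metrics.
-/

namespace E7SU2

open Module

/-! ### The root system -/

/-- The root lattice of type `E₇`, in coordinates with respect to the simple roots `α₁, …, α₇`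
(standard numbering: `α₂` is joined to `α₄`, and `α₁, α₃, α₄, α₅, α₆, α₇` is a chain). -/
abbrev Lat : Type := Fin 7 → ℤ

/-- The upper triangular half of the Cartan matrix `C`: ones on the diagonal, `C i j` above it.
Thus `C = half + halfᵀ`. -/
def half : Matrix (Fin 7) (Fin 7) ℤ :=
  Matrix.of fun i j => if i = j then 1 else if i < j then CartanMatrix.E₇ i j else 0

/-- The integral bilinear form with matrix `half`; it satisfies `bil v w + bil w v = ip v w`. -/
def bil (v w : Lat) : ℤ := v ⬝ᵥ half.mulVec w

/-- The inner product of the root lattice, with Gram matrix the Cartan matrix (long roots have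
squared length `2`). -/
def ip (v w : Lat) : ℤ := v ⬝ᵥ CartanMatrix.E₇.mulVec w

/-- The bimultiplicative sign cocycle `ε(v, w) = (-1) ^ bil v w`. -/
def eps (v w : Lat) : ℤ := ((bil v w).negOnePow : ℤ)

/-- The `126` roots of `E₇`: the vectors of squared length `2` in the root lattice. -/
abbrev Root : Type := {v : Lat // ip v v = 2}

theorem cartan_eq : CartanMatrix.E₇ = half + half.transpose := by decide

theorem bil_add_left (u v w : Lat) : bil (u + v) w = bil u w + bil v w := by
  simp [bil, add_dotProduct]

theorem bil_add_right (u v w : Lat) : bil u (v + w) = bil u v + bil u w := by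
  simp [bil, Matrix.mulVec_add, dotProduct_add]

theorem bil_neg_left (v w : Lat) : bil (-v) w = -bil v w := by simp [bil]

theorem bil_neg_right (v w : Lat) : bil v (-w) = -bil v w := by
  simp [bil, Matrix.mulVec_neg]

theorem ip_eq (v w : Lat) : ip v w = bil v w + bil w v := by
  rw [ip, cartan_eq, Matrix.add_mulVec, dotProduct_add, bil, bil, Matrix.mulVec_transpose,
    dotProduct_comm v (Matrix.vecMul _ _), ← Matrix.dotProduct_mulVec]

theorem ip_comm (v w : Lat) : ip v w = ip w v := by rw [ip_eq, ip_eq, add_comm]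

theorem ip_add_left (u v w : Lat) : ip (u + v) w = ip u w + ip v w := by
  simp only [ip_eq, bil_add_left, bil_add_right]; ring

theorem ip_add_right (u v w : Lat) : ip u (v + w) = ip u v + ip u w := by
  simp only [ip_eq, bil_add_left, bil_add_right]; ring

theorem ip_neg_left (v w : Lat) : ip (-v) w = -ip v w := by
  simp only [ip_eq, bil_neg_left, bil_neg_right]; ring

theorem ip_neg_right (v w : Lat) : ip v (-w) = -ip v w := by
  simp only [ip_eq, bil_neg_left, bil_neg_right]; ring

theorem quad_real (x : Fin 7 → ℝ) :
    x ⬝ᵥ (CartanMatrix.E₇.map (Int.cast : ℤ → ℝ)).mulVec x =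
      2 * (x 0 - x 2 / 2) ^ 2 + 2 * (x 1 - x 3 / 2) ^ 2 + 3 / 2 * (x 2 - 2 / 3 * x 3) ^ 2
        + 5 / 6 * (x 3 - 6 / 5 * x 4) ^ 2 + 4 / 5 * (x 4 - 5 / 4 * x 5) ^ 2
        + 3 / 4 * (x 5 - 4 / 3 * x 6) ^ 2 + 2 / 3 * (x 6) ^ 2 := by
  simp [CartanMatrix.E₇, dotProduct, Matrix.mulVec, Fin.sum_univ_succ]
  ring


theorem ip_real (v : Lat) :
    (ip v v : ℝ) = (fun i => (v i : ℝ)) ⬝ᵥ (CartanMatrix.E₇.map (Int.cast : ℤ → ℝ)).mulVec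
      (fun i => (v i : ℝ)) := by
  simp [ip, dotProduct, Matrix.mulVec]

theorem real_pos {x : Fin 7 → ℝ} (hx : x ≠ 0) :
    0 < x ⬝ᵥ (CartanMatrix.E₇.map (Int.cast : ℤ → ℝ)).mulVec x := by
  rw [quad_real]
  by_contra hcon
  apply hx
  have s0 := sq_nonneg (x 0 - x 2 / 2)
  have s1 := sq_nonneg (x 1 - x 3 / 2)
  have s2 := sq_nonneg (x 2 - 2 / 3 * x 3)
  have s3 := sq_nonneg (x 3 - 6 / 5 * x 4)
  have s4 := sq_nonneg (x 4 - 5 / 4 * x 5)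
  have s5 := sq_nonneg (x 5 - 4 / 3 * x 6)
  have s6 := sq_nonneg (x 6)
  have e6 : x 6 = 0 := pow_eq_zero_iff (two_ne_zero) |>.1 (by linarith)
  have e5 : x 5 - 4 / 3 * x 6 = 0 := pow_eq_zero_iff (two_ne_zero) |>.1 (by linarith)
  have e4 : x 4 - 5 / 4 * x 5 = 0 := pow_eq_zero_iff (two_ne_zero) |>.1 (by linarith)
  have e3 : x 3 - 6 / 5 * x 4 = 0 := pow_eq_zero_iff (two_ne_zero) |>.1 (by linarith)
  have e2 : x 2 - 2 / 3 * x 3 = 0 := pow_eq_zero_iff (two_ne_zero) |>.1 (by linarith)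
  have e1 : x 1 - x 3 / 2 = 0 := pow_eq_zero_iff (two_ne_zero) |>.1 (by linarith)
  have e0 : x 0 - x 2 / 2 = 0 := pow_eq_zero_iff (two_ne_zero) |>.1 (by linarith)
  funext i
  fin_cases i <;> simp <;> linarith

theorem ip_pos {v : Lat} (hv : v ≠ 0) : 0 < ip v v := by
  have : (fun i => (v i : ℝ)) ≠ 0 := by
    intro h; apply hv; funext i; simpa using congrFun h i
  have := real_pos this
  rw [← ip_real] at this
  exact_mod_cast this

instance : Finite Root := by
  refine Set.Finite.subset (s := Set.Icc (fun _ => -13 : Lat) (fun _ => 13))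
    (Set.finite_Icc _ _) ?_
  intro v hv
  have hv' : (ip v v : ℝ) = 2 := by exact_mod_cast hv
  rw [ip_real, quad_real] at hv'
  have s0 := sq_nonneg ((v 0 : ℝ) - v 2 / 2)
  have s1 := sq_nonneg ((v 1 : ℝ) - v 3 / 2)
  have s2 := sq_nonneg ((v 2 : ℝ) - 2 / 3 * v 3)
  have s3 := sq_nonneg ((v 3 : ℝ) - 6 / 5 * v 4)
  have s4 := sq_nonneg ((v 4 : ℝ) - 5 / 4 * v 5)
  have s5 := sq_nonneg ((v 5 : ℝ) - 4 / 3 * v 6)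
  have s6 := sq_nonneg (v 6 : ℝ)
  have key : ∀ t : ℝ, t ^ 2 ≤ 4 → -2 ≤ t ∧ t ≤ 2 := fun t ht => by
    constructor <;> nlinarith
  have e6 := key (v 6) (by linarith)
  have e5 := key _ (by linarith : ((v 5 : ℝ) - 4 / 3 * v 6) ^ 2 ≤ 4)
  have e4 := key _ (by linarith : ((v 4 : ℝ) - 5 / 4 * v 5) ^ 2 ≤ 4)
  have e3 := key _ (by linarith : ((v 3 : ℝ) - 6 / 5 * v 4) ^ 2 ≤ 4)
  have e2 := key _ (by linarith : ((v 2 : ℝ) - 2 / 3 * v 3) ^ 2 ≤ 4)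
  have e1 := key _ (by linarith : ((v 1 : ℝ) - v 3 / 2) ^ 2 ≤ 4)
  have e0 := key _ (by linarith : ((v 0 : ℝ) - v 2 / 2) ^ 2 ≤ 4)
  have goal : ∀ i, (-13 : ℝ) ≤ v i ∧ (v i : ℝ) ≤ 13 := by
    intro i
    fin_cases i <;> constructor <;> simp <;> linarith
  constructor <;> intro i
  · exact_mod_cast (goal i).1
  · exact_mod_cast (goal i).2

noncomputable instance : Fintype Root := Fintype.ofFinite _

namespace Root

instance : Neg Root := ⟨fun a => ⟨-a.1, by rw [ip_neg_left, ip_neg_right, neg_neg]; exact a.2⟩⟩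

theorem neg_val (a : Root) : (-a).1 = -a.1 := rfl

instance : InvolutiveNeg Root where
  neg_neg a := Subtype.ext (neg_neg a.1)

end Root

theorem ip_zero_left (v : Lat) : ip 0 v = 0 := by simp [ip]

theorem ip_le (a b : Root) (h : a ≠ b) : ip a.1 b.1 ≤ 1 := by
  have h1 : a.1 - b.1 ≠ 0 := fun h' => h (Subtype.ext (sub_eq_zero.1 h'))
  have := ip_pos h1
  rw [sub_eq_add_neg, ip_add_left, ip_add_right, ip_add_right, ip_neg_left, ip_neg_right,
    ip_neg_left, ip_neg_right, a.2, b.2, ip_comm b.1 a.1] at this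
  omega

theorem le_ip (a b : Root) (h : a.1 + b.1 ≠ 0) : -1 ≤ ip a.1 b.1 := by
  have := ip_pos h
  rw [ip_add_left, ip_add_right, ip_add_right, a.2, b.2, ip_comm b.1 a.1] at this
  omega

theorem ip_add_self (a b : Root) : ip (a.1 + b.1) (a.1 + b.1) = 4 + 2 * ip a.1 b.1 := by
  rw [ip_add_left, ip_add_right, ip_add_right, a.2, b.2, ip_comm b.1 a.1]; ring

theorem eps_add_left (u v w : Lat) : eps (u + v) w = eps u w * eps v w := by
  simp [eps, bil_add_left, Int.negOnePow_add]

theorem eps_add_right (u v w : Lat) : eps u (v + w) = eps u v * eps u w := by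
  simp [eps, bil_add_right, Int.negOnePow_add]

theorem eps_neg_left (v w : Lat) : eps (-v) w = eps v w := by
  simp [eps, bil_neg_left, Int.negOnePow_neg]

theorem eps_neg_right (v w : Lat) : eps v (-w) = eps v w := by
  simp [eps, bil_neg_right, Int.negOnePow_neg]

theorem eps_mul_self (v w : Lat) : eps v w * eps v w = 1 := by
  simp [eps, ← Units.val_mul]

theorem eps_swap (v w : Lat) : eps w v = ((ip v w).negOnePow : ℤ) * eps v w := by
  rw [ip_eq, Int.negOnePow_add, Units.val_mul]
  change _ = eps v w * eps w v * eps v w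
  rw [mul_right_comm, eps_mul_self, one_mul]

theorem eps_swap_of (v w : Lat) (h : ip v w = -1) : eps w v = -eps v w := by
  rw [eps_swap, h]; simp

theorem eps_root (a : Root) : eps a.1 a.1 = -1 := by
  have h : bil a.1 a.1 = 1 := by have := a.2; rw [ip_eq] at this; omega
  simp [eps, h]

/-! ### The complex Lie algebra -/

/-- The underlying vector space of the complex simple Lie algebra of type `E₇`:
`(⨁ᵢ ℂ αᵢ) ⊕ (⨁ₐ ℂ eₐ)`, the second sum over the roots. The first component lists the coordinates
in the Cartan subalgebra with respect to the (co)roots `α₁, …, α₇`, the second one the coefficients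
of the root vectors `eₐ`. It is given the sup norm, which plays no role except to provide the
(unique) vector space topology. -/
def E7C : Type := (Fin 7 → ℂ) × (Root → ℂ)

namespace E7C

noncomputable instance : NormedAddCommGroup E7C :=
  inferInstanceAs (NormedAddCommGroup ((Fin 7 → ℂ) × (Root → ℂ)))

noncomputable instance : NormedSpace ℂ E7C :=
  inferInstanceAs (NormedSpace ℂ ((Fin 7 → ℂ) × (Root → ℂ)))

noncomputable instance : NormedSpace ℝ E7C :=
  inferInstanceAs (NormedSpace ℝ ((Fin 7 → ℂ) × (Root → ℂ)))

instance : FiniteDimensional ℝ E7C :=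
  inferInstanceAs (FiniteDimensional ℝ ((Fin 7 → ℂ) × (Root → ℂ)))

instance : IsScalarTower ℝ ℂ E7C :=
  inferInstanceAs (IsScalarTower ℝ ℂ ((Fin 7 → ℂ) × (Root → ℂ)))

/-- The coordinates of the Cartan component. -/
def cart (x : E7C) : Fin 7 → ℂ := Prod.fst x

/-- The coefficients of the root vectors. -/
def coef (x : E7C) : Root → ℂ := Prod.snd x

/-- The element with given Cartan coordinates and root coefficients. -/
def mk (h : Fin 7 → ℂ) (z : Root → ℂ) : E7C := Prod.mk h z

@[simp] theorem mk_cart (h z) : (mk h z).cart = h := rfl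
@[simp] theorem mk_coef (h z) : (mk h z).coef = z := rfl

@[ext] theorem ext {x y : E7C} (h1 : ∀ i, x.cart i = y.cart i) (h2 : ∀ a, x.coef a = y.coef a) : x = y :=
  Prod.ext (funext h1) (funext h2)

@[simp] theorem add_fst (x y : E7C) (i) : (x + y).cart i = x.cart i + y.cart i := rfl
@[simp] theorem add_snd (x y : E7C) (i) : (x + y).coef i = x.coef i + y.coef i := rfl
@[simp] theorem neg_fst (x : E7C) (i) : (-x).cart i = -x.cart i := rfl
@[simp] theorem neg_snd (x : E7C) (i) : (-x).coef i = -x.coef i := rfl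
@[simp] theorem sub_fst (x y : E7C) (i) : (x - y).cart i = x.cart i - y.cart i := rfl
@[simp] theorem sub_snd (x y : E7C) (i) : (x - y).coef i = x.coef i - y.coef i := rfl
@[simp] theorem zero_fst (i) : (0 : E7C).cart i = 0 := rfl
@[simp] theorem zero_snd (i) : (0 : E7C).coef i = 0 := rfl
@[simp] theorem smul_fst (c : ℂ) (x : E7C) (i) : (c • x).cart i = c * x.cart i := rfl
@[simp] theorem smul_snd (c : ℂ) (x : E7C) (i) : (c • x).coef i = c * x.coef i := rfl
@[simp] theorem rsmul_fst (c : ℝ) (x : E7C) (i) : (c • x).cart i = c * x.cart i := rfl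
@[simp] theorem rsmul_snd (c : ℝ) (x : E7C) (i) : (c • x).coef i = c * x.coef i := rfl

/-- The value `a(h)` of the lattice vector `a` on the element `h` of the Cartan subalgebra, the
Cartan subalgebra being identified with its dual through `ip`. -/
def pair (a : Lat) (h : Fin 7 → ℂ) : ℂ := ∑ i, (ip a (Pi.single i 1) : ℂ) * h i

/-- The Lie bracket, in the standard presentation of a simply laced Lie algebra:
`[h, h'] = 0`, `[h, eₐ] = a(h) eₐ`, `[eₐ, e₋ₐ] = -a`, `[eₐ, e_b] = ε(a, b) eₐ₊ᵦ` if `a + b` is a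
root, and `[eₐ, e_b] = 0` otherwise. -/
noncomputable def bracket (x y : E7C) : E7C :=
  mk (fun i => -∑ a : Root, (a.1 i : ℂ) * (x.coef a * y.coef (-a)))
   (fun c => pair c.1 x.cart * y.coef c - pair c.1 y.cart * x.coef c
    + ∑ a : Root, ∑ b : Root, if a.1 + b.1 = c.1 then (eps a.1 b.1 : ℂ) * (x.coef a * y.coef b) else 0)

theorem bracket_fst (x y : E7C) (i : Fin 7) :
    (bracket x y).cart i = -∑ a : Root, (a.1 i : ℂ) * (x.coef a * y.coef (-a)) := rfl

theorem bracket_snd (x y : E7C) (c : Root) :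
    (bracket x y).coef c = pair c.1 x.cart * y.coef c - pair c.1 y.cart * x.coef c
    + ∑ a : Root, ∑ b : Root, if a.1 + b.1 = c.1 then (eps a.1 b.1 : ℂ) * (x.coef a * y.coef b) else 0 :=
  rfl

theorem pair_add (a : Lat) (x y : E7C) : pair a (x + y).cart = pair a x.cart + pair a y.cart := by
  simp [pair, mul_add, Finset.sum_add_distrib]

theorem pair_smul (a : Lat) (r : ℂ) (x : E7C) : pair a (r • x).cart = r * pair a x.cart := by
  simp [pair, Finset.mul_sum, mul_left_comm]

theorem bracket_add_left (x y z : E7C) : bracket (x + y) z = bracket x z + bracket y z := by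
  ext i
  · simp only [bracket_fst, add_fst, add_snd, add_mul, mul_add, Finset.sum_add_distrib]; ring
  · simp only [bracket_snd, add_snd, pair_add, add_mul, mul_add, ite_add_zero,
      Finset.sum_add_distrib]; ring

theorem bracket_add_right (x y z : E7C) : bracket x (y + z) = bracket x y + bracket x z := by
  ext i
  · simp only [bracket_fst, add_fst, add_snd, mul_add, Finset.sum_add_distrib]; ring
  · simp only [bracket_snd, add_snd, pair_add, add_mul, mul_add, ite_add_zero,
      Finset.sum_add_distrib]; ring

theorem bracket_smul_left (r : ℂ) (x y : E7C) : bracket (r • x) y = r • bracket x y := by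
  ext i
  · simp only [bracket_fst, smul_fst, smul_snd, mul_neg, Finset.mul_sum]
    congr 1; exact Finset.sum_congr rfl fun _ _ => by ring
  · simp only [bracket_snd, smul_snd, pair_smul, mul_add, Finset.mul_sum, mul_ite, mul_zero]
    congr 1
    · ring
    · exact Finset.sum_congr rfl fun _ _ => Finset.sum_congr rfl fun _ _ => by
        split_ifs <;> ring

theorem bracket_smul_right (r : ℂ) (x y : E7C) : bracket x (r • y) = r • bracket x y := by
  ext i
  · simp only [bracket_fst, smul_fst, smul_snd, mul_neg, Finset.mul_sum]
    congr 1; exact Finset.sum_congr rfl fun _ _ => by ring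
  · simp only [bracket_snd, smul_snd, pair_smul, mul_add, Finset.mul_sum, mul_ite, mul_zero]
    congr 1
    · ring
    · exact Finset.sum_congr rfl fun _ _ => Finset.sum_congr rfl fun _ _ => by
        split_ifs <;> ring

theorem bracket_skew (x y : E7C) : bracket x y = -bracket y x := by
  ext c
  · simp only [bracket_fst, neg_fst, neg_neg]
    rw [← Equiv.sum_comp (Equiv.neg Root), ← Finset.sum_neg_distrib]
    exact Finset.sum_congr rfl fun a _ => by
      simp [Root.neg_val, mul_comm]
  · simp only [bracket_snd, neg_snd]
    rw [Finset.sum_comm, neg_add, ← Finset.sum_neg_distrib]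
    congr 1
    · ring
    · refine Finset.sum_congr rfl fun b _ => ?_
      rw [← Finset.sum_neg_distrib]
      refine Finset.sum_congr rfl fun a _ => ?_
      rw [add_comm b.1]
      split_ifs with h
      · have h1 : ip a.1 b.1 = -1 := by
          have := ip_add_self a b; rw [h, c.2] at this; omega
        rw [eps_swap_of a.1 b.1 h1]; push_cast; ring
      · simp

/-- The bracket as a bilinear map. -/
noncomputable def bracketL : E7C →ₗ[ℂ] E7C →ₗ[ℂ] E7C :=
  LinearMap.mk₂ ℂ bracket bracket_add_left bracket_smul_left bracket_add_right bracket_smul_right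


/-- The element of the Cartan subalgebra with given coordinates. -/
def hh (c : Fin 7 → ℂ) : E7C := mk c 0

/-- The root vector of a lattice vector (zero if that is not a root). -/
def ee (v : Lat) : E7C := mk 0 (fun c => if c.1 = v then 1 else 0)

/-- The lattice vector `v`, as an element of the Cartan subalgebra. -/
def hl (v : Lat) : E7C := hh fun i => (v i : ℂ)

@[simp] theorem hh_fst (c i) : (hh c).cart i = c i := rfl
@[simp] theorem hh_snd (c a) : (hh c).coef a = 0 := rfl
@[simp] theorem ee_fst (c i) : (ee c).cart i = 0 := rfl
@[simp] theorem ee_snd (c a) : (ee c).coef a = if a.1 = c then 1 else 0 := rfl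
@[simp] theorem hl_fst (v i) : (hl v).cart i = v i := rfl
@[simp] theorem hl_snd (v a) : (hl v).coef a = 0 := rfl

theorem pair_zero (a : Lat) (v : Lat) : pair a (ee v).cart = 0 := by simp [pair]

theorem ip_sum (a v : Lat) : ip a v = ∑ i, ip a (Pi.single i 1) * v i := by
  have h : ∀ i, ip a (Pi.single i 1) = ∑ j, a j * CartanMatrix.E₇ j i := by
    intro i
    simp [ip, dotProduct]
  simp only [h]
  simp only [ip, dotProduct, Matrix.mulVec, Finset.mul_sum, Finset.sum_mul]
  rw [Finset.sum_comm]
  exact Finset.sum_congr rfl fun _ _ => Finset.sum_congr rfl fun _ _ => by ring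

theorem pair_hl (a v : Lat) : pair a (hl v).cart = ip a v := by
  rw [ip_sum]; simp [pair]

theorem bracket_hh (c d : Fin 7 → ℂ) : bracket (hh c) (hh d) = 0 := by
  ext i <;> simp [bracket_fst, bracket_snd]

theorem bracket_he (c : Fin 7 → ℂ) (v : Lat) : bracket (hh c) (ee v) = pair v c • ee v := by
  ext i
  · simp [bracket_fst]
  · simp only [bracket_snd, ee_snd, hh_snd, smul_snd]
    simp only [zero_mul, mul_zero, ite_self, Finset.sum_const_zero, add_zero, sub_zero]
    split_ifs with h
    · rw [h]; rfl
    · simp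

theorem bracket_eh (c : Fin 7 → ℂ) (v : Lat) : bracket (ee v) (hh c) = -(pair v c • ee v) := by
  rw [bracket_skew, bracket_he]

theorem ee_of_ne {v : Lat} (h : ip v v ≠ 2) : ee v = 0 := by
  ext i
  · rfl
  · simp only [ee_snd, zero_snd, ite_eq_right_iff]
    rintro rfl; exact absurd i.2 h

theorem bracket_ee (a b : Root) : bracket (ee a.1) (ee b.1) =
    (if a.1 + b.1 = 0 then -hl a.1 else 0) + (eps a.1 b.1 : ℂ) • ee (a.1 + b.1) := by
  have hs : ∀ (t : Root → ℂ) (a : Root), (∑ p : Root, if p.1 = a.1 then t p else 0) = t a := by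
    intro t a
    rw [Finset.sum_eq_single a (fun x _ hx => if_neg fun h => hx (Subtype.ext h)) (by simp)]
    simp
  ext i
  · have : ∀ p : Root, (p.1 i : ℂ) * ((ee a.1).coef p * (ee b.1).coef (-p)) =
        if p.1 = a.1 then (p.1 i : ℂ) * (if a.1 + b.1 = 0 then 1 else 0) else 0 := by
      intro p
      by_cases h : p.1 = a.1
      · simp only [ee_snd, h, if_true, one_mul, Root.neg_val]
        congr 2
        rw [neg_eq_iff_add_eq_zero]
      · simp [h]
    rw [bracket_fst, Finset.sum_congr rfl fun x _ => this x, hs]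
    split_ifs <;> simp
  · rw [bracket_snd, pair_zero, pair_zero]
    have : ∀ p q : Root, (if p.1 + q.1 = i.1 then (eps p.1 q.1 : ℂ) *
        ((ee a.1).coef p * (ee b.1).coef q) else 0) = if p.1 = a.1 then (if q.1 = b.1 then
          (if a.1 + b.1 = i.1 then (eps a.1 b.1 : ℂ) else 0) else 0) else 0 := by
      intro p q
      by_cases h : p.1 = a.1
      · by_cases h' : q.1 = b.1
        · simp [h, h']
        · simp [h']
      · simp [h]
    rw [Finset.sum_congr rfl fun x _ => Finset.sum_congr rfl fun y _ => this x y]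
    have h2 : ∀ p : Root, (∑ q : Root, if p.1 = a.1 then (if q.1 = b.1 then
          (if a.1 + b.1 = i.1 then (eps a.1 b.1 : ℂ) else 0) else 0) else 0) =
        if p.1 = a.1 then (if a.1 + b.1 = i.1 then (eps a.1 b.1 : ℂ) else 0) else 0 := by
      intro p
      split_ifs with h1 h2
      · exact hs (fun _ => _) b
      · simp
      · simp
    rw [Finset.sum_congr rfl fun x _ => h2 x]
    rw [hs (fun _ => _) a]
    have h3 : (if a.1 + b.1 = 0 then -hl a.1 else 0 : E7C).coef i = 0 := by
      split_ifs <;> simp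
    rw [add_snd, h3, smul_snd, ee_snd]
    by_cases h' : a.1 + b.1 = i.1
    · simp [h']
    · simp [h', Ne.symm h']

theorem bracket_zero_left (x : E7C) : bracket 0 x = 0 := (bracketL.map_zero₂ x :)
theorem bracket_zero_right (x : E7C) : bracket x 0 = 0 := (bracketL x).map_zero
theorem bracket_neg_left (x y : E7C) : bracket (-x) y = -bracket x y := bracketL.map_neg₂ x y
theorem bracket_neg_right (x y : E7C) : bracket x (-y) = -bracket x y := (bracketL x).map_neg y

theorem basis_ind {P : E7C → Prop} (hadd : ∀ x y, P x → P y → P (x + y))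
    (hsmul : ∀ (r : ℂ) x, P x → P (r • x))
    (h1 : ∀ c, P (hh c)) (h2 : ∀ a : Root, P (ee a.1)) (x : E7C) : P x := by
  have hf : ∀ (s : Finset Root) (i), (∑ a ∈ s, x.coef a • ee a.1).cart i = 0 := by
    intro s i
    induction s using Finset.induction_on with
    | empty => simp
    | insert a s ha ih => rw [Finset.sum_insert ha]; simp [ih]
  have hg : ∀ (s : Finset Root) (i), (∑ a ∈ s, x.coef a • ee a.1).coef i =
      ∑ a ∈ s, x.coef a * (if i.1 = a.1 then 1 else 0) := by
    intro s i
    induction s using Finset.induction_on with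
    | empty => simp
    | insert a s ha ih => rw [Finset.sum_insert ha, Finset.sum_insert ha]; simp [ih]
  have key : x = hh x.cart + ∑ a : Root, x.coef a • ee a.1 := by
    ext i
    · simp [hf]
    · rw [add_snd, hg, Finset.sum_eq_single i (fun b _ hb => by
        rw [if_neg fun h => hb (Subtype.ext h.symm), mul_zero]) (by simp)]
      simp
  rw [key]
  refine hadd _ _ (h1 _) ?_
  have hP0 : P 0 := by simpa using hsmul 0 _ (h1 0)
  exact Finset.sum_induction _ P hadd hP0 fun a _ => hsmul _ _ (h2 a)

theorem pair_lat_add (u v : Lat) (c : Fin 7 → ℂ) : pair (u + v) c = pair u c + pair v c := by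
  simp [pair, ip_add_left, add_mul, Finset.sum_add_distrib]

theorem pair_lat_neg (u : Lat) (c : Fin 7 → ℂ) : pair (-u) c = -pair u c := by
  simp [pair, ip_neg_left]

theorem hl_add (u v : Lat) : hl (u + v) = hl u + hl v := by
  ext i <;> simp

theorem hl_neg (u : Lat) : hl (-u) = -hl u := by
  ext i <;> simp

theorem bracket_le (u v : Lat) : bracket (hl u) (ee v) = (ip v u : ℂ) • ee v := by
  rw [hl, bracket_he]; congr 1; exact pair_hl v u

theorem bracket_el (u v : Lat) : bracket (ee v) (hl u) = -((ip v u : ℂ) • ee v) := by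
  rw [bracket_skew, bracket_le]

/-- `[e_a, e_b]` when `a + b ≠ 0`. -/
theorem bracket_ee_of_ne (a b : Root) (h : a.1 + b.1 ≠ 0) :
    bracket (ee a.1) (ee b.1) = (eps a.1 b.1 : ℂ) • ee (a.1 + b.1) := by
  rw [bracket_ee, if_neg h, zero_add]

theorem bracket_neg_root (a : Root) : bracket (ee a.1) (ee (-a.1)) = -hl a.1 := by
  have := bracket_ee a (-a)
  rw [Root.neg_val, add_neg_cancel, if_pos rfl, ee_of_ne (v := 0) (by simp [ip]), smul_zero,
    add_zero] at this
  exact this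

theorem bracket_neg_root' (a : Root) : bracket (ee (-a.1)) (ee a.1) = hl a.1 := by
  rw [bracket_skew, bracket_neg_root, neg_neg]

/-- If `a + b` is not a root and not zero, then `[e_a, e_b] = 0`. -/
theorem bracket_ee_zero (a b : Root) (h : -1 < ip a.1 b.1) : bracket (ee a.1) (ee b.1) = 0 := by
  have h1 : a.1 + b.1 ≠ 0 := by
    intro h0
    have := ip_add_self a b
    rw [h0] at this; simp [ip] at this; simp [ip] at h; omega
  rw [bracket_ee_of_ne a b h1, ee_of_ne, smul_zero]
  rw [ip_add_self]; omega

/-- Two applications of the bracket with nonzero total weight. -/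
theorem double (a b c : Root) (hbc : b.1 + c.1 ≠ 0) (hs : a.1 + b.1 + c.1 ≠ 0) :
    bracket (ee a.1) (bracket (ee b.1) (ee c.1)) =
      (if ip b.1 c.1 = -1 then (eps a.1 b.1 * eps a.1 c.1 * eps b.1 c.1 : ℂ) else 0) •
        ee (a.1 + b.1 + c.1) := by
  have h1 := le_ip b c hbc
  rcases h1.lt_or_eq with h | h
  · rw [bracket_ee_zero b c h, if_neg (by omega), bracket_zero_right, zero_smul]
  · rw [bracket_ee_of_ne b c hbc, if_pos h.symm, bracket_smul_right]
    have hr : ip (b.1 + c.1) (b.1 + c.1) = 2 := by rw [ip_add_self]; omega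
    have := bracket_ee_of_ne a ⟨b.1 + c.1, hr⟩ (by rwa [← add_assoc])
    simp only at this
    rw [this, smul_smul, ← add_assoc, eps_add_right]
    push_cast; ring_nf

theorem leibniz_opp (a b : Root) : bracket (ee a.1) (bracket (ee b.1) (ee (-b.1))) =
    bracket (bracket (ee a.1) (ee b.1)) (ee (-b.1)) +
      bracket (ee b.1) (bracket (ee a.1) (ee (-b.1))) := by
  rw [bracket_neg_root, bracket_neg_right, bracket_el, neg_neg]
  have hnb : ip a.1 (-b).1 = -ip a.1 b.1 := by rw [Root.neg_val, ip_neg_right]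
  by_cases h0 : a = b
  · subst h0
    have : bracket (ee a.1) (ee a.1) = 0 := bracket_ee_zero a a (by rw [a.2]; norm_num)
    rw [this, bracket_zero_left, bracket_neg_root, bracket_neg_right, bracket_el, a.2]; simp
  by_cases h1 : a = -b
  · subst h1
    have : bracket (ee (-b).1) (ee (-b.1)) = 0 :=
      bracket_ee_zero (-b) (-b) (by rw [(-b).2]; norm_num)
    rw [this, bracket_zero_right, Root.neg_val, bracket_neg_root', bracket_le, ip_neg_left, b.2]
    simp
  have g0 : a.1 + (-b).1 ≠ 0 := fun h => h0 (Subtype.ext (by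
    rw [Root.neg_val] at h; exact add_neg_eq_zero.1 h))
  have g1 : a.1 + b.1 ≠ 0 := fun h => h1 (Subtype.ext (by
    rw [Root.neg_val]; exact eq_neg_of_add_eq_zero_left h))
  have k0 := le_ip a (-b) g0
  have k1 := le_ip a b g1
  have ha : a.1 ≠ 0 := by
    intro h
    have := a.2
    rw [h, ip_zero_left] at this
    omega
  have e1 : -b.1 + a.1 + b.1 = a.1 := by abel
  have e2 : b.1 + a.1 + -b.1 = a.1 := by abel
  have t1 := double (-b) a b g1 (by rw [Root.neg_val, e1]; exact ha)
  have t2 := double b a (-b) g0 (by rw [Root.neg_val, e2]; exact ha)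
  rw [Root.neg_val, e1, eps_neg_left, eps_neg_left, eps_root] at t1
  rw [hnb, Root.neg_val, e2, eps_neg_right, eps_neg_right, eps_root] at t2
  rw [Root.neg_val, ip_neg_right] at k0
  rw [bracket_skew _ (ee (-b.1)), t1, t2]
  have hv : ip a.1 b.1 = -1 ∨ ip a.1 b.1 = 0 ∨ ip a.1 b.1 = 1 := by omega
  have hsq : (eps a.1 b.1 : ℂ) * eps a.1 b.1 = 1 := by exact_mod_cast eps_mul_self a.1 b.1
  rcases hv with hv | hv | hv
  · have := eps_swap_of a.1 b.1 hv
    rw [hv, this]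
    simp [hsq]
  · simp [hv]
  · have : eps b.1 a.1 = -eps a.1 b.1 := by rw [eps_swap, hv]; simp
    rw [hv, this]
    simp [hsq]

theorem leibniz_zero (a b c : Root) (h : a.1 + b.1 + c.1 = 0) :
    bracket (ee a.1) (bracket (ee b.1) (ee c.1)) =
    bracket (bracket (ee a.1) (ee b.1)) (ee c.1) + bracket (ee b.1) (bracket (ee a.1) (ee c.1)) := by
  have hbc : b.1 + c.1 = -a.1 := by rw [eq_neg_iff_add_eq_zero, ← h]; abel
  have hac : a.1 + c.1 = -b.1 := by rw [eq_neg_iff_add_eq_zero, ← h]; abel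
  have hab : a.1 + b.1 = -c.1 := by rw [eq_neg_iff_add_eq_zero, ← h]
  have ne : ∀ r : Root, -r.1 ≠ 0 := by
    intro r h
    have := r.2
    rw [neg_eq_zero.1 h, ip_zero_left] at this
    omega
  have hip : ip a.1 b.1 = -1 := by
    have := ip_add_self a b
    rw [hab, ip_neg_left, ip_neg_right, c.2] at this
    omega
  rw [bracket_ee_of_ne b c (hbc ▸ ne a), bracket_ee_of_ne a b (hab ▸ ne c),
    bracket_ee_of_ne a c (hac ▸ ne b), hbc, hab, hac, bracket_smul_right, bracket_smul_right,
    bracket_smul_left, bracket_neg_root, bracket_neg_root, bracket_neg_root']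
  have hc : c.1 = -(a.1 + b.1) := by rw [hab, neg_neg]
  rw [hc, eps_neg_right, eps_neg_right, eps_add_right, eps_add_right, eps_root, eps_root,
    eps_swap_of a.1 b.1 hip, hl_neg, hl_add]
  push_cast
  module

theorem leibniz_ee (a b c : Root) : bracket (ee a.1) (bracket (ee b.1) (ee c.1)) =
    bracket (bracket (ee a.1) (ee b.1)) (ee c.1) + bracket (ee b.1) (bracket (ee a.1) (ee c.1)) := by
  have of0 : ∀ x y : Root, x.1 + y.1 = 0 → y = -x := fun x y h =>
    Subtype.ext (eq_neg_of_add_eq_zero_right h)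
  by_cases hbc : b.1 + c.1 = 0
  · rw [of0 b c hbc]; exact leibniz_opp a b
  by_cases hac : a.1 + c.1 = 0
  · rw [of0 a c hac]
    have := leibniz_opp b a
    rw [Root.neg_val, this, bracket_skew (ee a.1) (ee b.1), bracket_neg_left]
    abel
  by_cases hab : a.1 + b.1 = 0
  · rw [of0 a b hab]
    have := leibniz_opp c a
    rw [Root.neg_val, bracket_skew (ee (-a.1)) (ee c.1), bracket_skew (ee a.1) (ee c.1),
      bracket_skew (bracket (ee a.1) (ee (-a.1))) (ee c.1), this, bracket_neg_right,
      bracket_neg_right, bracket_skew (ee (-a.1)) (bracket _ _)]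
    abel
  by_cases hs : a.1 + b.1 + c.1 = 0
  · exact leibniz_zero a b c hs
  have hs' : b.1 + a.1 + c.1 ≠ 0 := by rwa [add_comm b.1]
  have hs'' : c.1 + a.1 + b.1 ≠ 0 := by rwa [add_assoc, add_comm c.1]
  rw [bracket_skew (bracket _ _) (ee c.1), double a b c hbc hs, double b a c hac hs',
    double c a b hab hs'', add_comm b.1 a.1, add_assoc c.1, add_comm c.1]
  by_cases hr : ip (a.1 + b.1 + c.1) (a.1 + b.1 + c.1) = 2
  swap
  · simp [ee_of_ne hr]
  have hsum : ip a.1 b.1 + ip b.1 c.1 + ip a.1 c.1 = -2 := by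
    rw [ip_add_left (a.1 + b.1), ip_add_right (a.1 + b.1) (a.1 + b.1), ip_add_self,
      ip_add_right c.1, c.2, ip_comm c.1, ip_add_left a.1 b.1 c.1] at hr
    omega
  have l1 := le_ip a b hab
  have l2 := le_ip b c hbc
  have l3 := le_ip a c hac
  have up : ∀ x y : Root, ip x.1 y.1 ≤ 1 ∨ x = y := fun x y => by
    by_cases h : x = y
    · exact Or.inr h
    · exact Or.inl (ip_le x y h)
  have u1 : ip a.1 b.1 ≤ 1 := by
    rcases up a b with h | h
    · exact h
    · subst h; rw [a.2] at hsum; omega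
  have u2 : ip b.1 c.1 ≤ 1 := by
    rcases up b c with h | h
    · exact h
    · subst h; rw [b.2] at hsum; omega
  have u3 : ip a.1 c.1 ≤ 1 := by
    rcases up a c with h | h
    · exact h
    · subst h; rw [a.2, ip_comm b.1] at hsum; omega
  rw [eps_swap a.1 b.1, eps_swap a.1 c.1, eps_swap b.1 c.1]
  have hcases : (ip a.1 b.1 = -1 ∧ ip b.1 c.1 = -1 ∧ ip a.1 c.1 = 0) ∨
      (ip a.1 b.1 = -1 ∧ ip b.1 c.1 = 0 ∧ ip a.1 c.1 = -1) ∨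
      (ip a.1 b.1 = 0 ∧ ip b.1 c.1 = -1 ∧ ip a.1 c.1 = -1) := by omega
  rcases hcases with ⟨p, q, r⟩ | ⟨p, q, r⟩ | ⟨p, q, r⟩ <;> rw [p, q, r] <;> simp <;> module

theorem leibniz (x y z : E7C) : bracket x (bracket y z) =
    bracket (bracket x y) z + bracket y (bracket x z) := by
  induction x using basis_ind with
  | hadd x x' h h' => simp only [bracket_add_left, bracket_add_right, h, h']; abel
  | hsmul r x h => simp only [bracket_smul_left, bracket_smul_right, h, smul_add]
  | h1 p =>
    induction y using basis_ind with
    | hadd x x' h h' => simp only [bracket_add_left, bracket_add_right, h, h']; abel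
    | hsmul r x h => simp only [bracket_smul_left, bracket_smul_right, h, smul_add]
    | h1 q =>
      induction z using basis_ind with
      | hadd x x' h h' => simp only [bracket_add_left, bracket_add_right, h, h']; abel
      | hsmul r x h => simp only [bracket_smul_left, bracket_smul_right, h, smul_add]
      | h1 r => simp [bracket_hh, bracket_zero_left, bracket_zero_right]
      | h2 c =>
        simp only [bracket_hh, bracket_he, bracket_smul_right, bracket_zero_left]
        module
    | h2 b =>
      induction z using basis_ind with
      | hadd x x' h h' => simp only [bracket_add_left, bracket_add_right, h, h']; abel
      | hsmul r x h => simp only [bracket_smul_left, bracket_smul_right, h, smul_add]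
      | h1 r =>
        simp only [bracket_hh, bracket_he, bracket_eh, bracket_smul_right, bracket_zero_right,
          bracket_neg_right, bracket_smul_left]
        module
      | h2 c =>
        simp only [bracket_he, bracket_smul_right, bracket_smul_left, bracket_ee,
          bracket_add_right, pair_lat_add]
        split_ifs with h
        · rw [h, ee_of_ne (v := 0) (by simp [ip]), bracket_neg_right, hl, bracket_hh]
          have : pair b.1 p + pair c.1 p = 0 := by rw [← pair_lat_add, h]; simp [pair, ip]
          rw [← add_smul, this]; simp
        · rw [bracket_zero_right]; module
  | h2 a =>
    induction y using basis_ind with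
    | hadd x x' h h' => simp only [bracket_add_left, bracket_add_right, h, h']; abel
    | hsmul r x h => simp only [bracket_smul_left, bracket_smul_right, h, smul_add]
    | h1 q =>
      induction z using basis_ind with
      | hadd x x' h h' => simp only [bracket_add_left, bracket_add_right, h, h']; abel
      | hsmul r x h => simp only [bracket_smul_left, bracket_smul_right, h, smul_add]
      | h1 r =>
        simp only [bracket_hh, bracket_he, bracket_eh, bracket_smul_right, bracket_zero_right,
          bracket_neg_right, bracket_smul_left, bracket_neg_left]
        module
      | h2 c =>
        simp only [bracket_he, bracket_eh, bracket_smul_right, bracket_smul_left, bracket_ee,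
          bracket_add_right, pair_lat_add, bracket_neg_left]
        split_ifs with h
        · rw [h, ee_of_ne (v := 0) (by simp [ip]), bracket_neg_right, hl, bracket_hh]
          have : pair a.1 q + pair c.1 q = 0 := by rw [← pair_lat_add, h]; simp [pair, ip]
          rw [eq_neg_of_add_eq_zero_left this]; simp
        · rw [bracket_zero_right]; module
    | h2 b =>
      induction z using basis_ind with
      | hadd x x' h h' => simp only [bracket_add_left, bracket_add_right, h, h']; abel
      | hsmul r x h => simp only [bracket_smul_left, bracket_smul_right, h, smul_add]
      | h1 r =>
        simp only [bracket_eh, bracket_smul_right, bracket_neg_right]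
        rw [bracket_skew (ee b.1) (ee a.1)]
        simp only [bracket_eh, bracket_smul_right, bracket_smul_left, bracket_ee,
          bracket_add_left, pair_lat_add, bracket_neg_left, bracket_neg_right, ]
        split_ifs with h
        · rw [h, ee_of_ne (v := 0) (by simp [ip]), bracket_neg_left, hl, bracket_hh]
          have : pair a.1 r + pair b.1 r = 0 := by rw [← pair_lat_add, h]; simp [pair, ip]
          rw [eq_neg_of_add_eq_zero_left this]; simp
        · rw [bracket_zero_left]; module
      | h2 c => exact leibniz_ee a b c

end E7C

namespace E7C

noncomputable instance : LieRing E7C :=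
  { (inferInstance : AddCommGroup E7C) with
    bracket := bracket
    add_lie := bracket_add_left
    lie_add := bracket_add_right
    lie_self := fun x => by
      have h := bracket_skew x x
      have h2 : (2 : ℂ) • bracket x x = 0 := by
        rw [two_smul]; nth_rewrite 1 [h]; exact neg_add_cancel _
      exact (smul_eq_zero.1 h2).resolve_left two_ne_zero
    leibniz_lie := leibniz }

theorem lie_def (x y : E7C) : ⁅x, y⁆ = bracket x y := rfl

noncomputable instance : LieAlgebra ℂ E7C where
  lie_smul r x y := bracket_smul_right r x y

noncomputable instance : LieAlgebra ℝ E7C where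
  lie_smul r x y := by
    have := bracket_smul_right (r : ℂ) x y
    exact this

open ComplexConjugate in
/-- The compact real form: the fixed points of the antilinear involution
`h ↦ -conj h`, `z eₐ ↦ conj z e₋ₐ`, that is, the real span of the `i αⱼ`, `eₐ + e₋ₐ` and
`i (eₐ - e₋ₐ)`. Its Killing form is negative definite (`e7.killing_neg`). -/
noncomputable def realForm : LieSubalgebra ℝ E7C where
  carrier := {x | (∀ i, conj (x.cart i) = -x.cart i) ∧ ∀ a, x.coef (-a) = conj (x.coef a)}
  add_mem' := by
    rintro x y ⟨h1, h2⟩ ⟨h3, h4⟩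
    refine ⟨fun i => ?_, fun a => ?_⟩
    · rw [add_fst, map_add, h1, h3]; ring
    · rw [add_snd, add_snd, map_add, h2, h4]
  zero_mem' := ⟨fun i => by simp, fun a => by simp⟩
  smul_mem' := by
    rintro c x ⟨h1, h2⟩
    refine ⟨fun i => ?_, fun a => ?_⟩
    · rw [rsmul_fst, map_mul, h1, Complex.conj_ofReal]; ring
    · rw [rsmul_snd, rsmul_snd, map_mul, h2, Complex.conj_ofReal]
  lie_mem' := by
    rintro x y ⟨h1, h2⟩ ⟨h3, h4⟩
    have hp : ∀ z : E7C, (∀ i, conj (z.cart i) = -z.cart i) → ∀ c : Lat,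
        conj (pair c z.cart) = -pair c z.cart := by
      intro z hz c
      simp [pair, hz]
    refine ⟨fun i => ?_, fun c => ?_⟩
    · rw [lie_def, bracket_fst, map_neg]
      refine congrArg _ ?_
      rw [map_sum, ← Finset.sum_neg_distrib, ← Equiv.sum_comp (Equiv.neg Root)]
      refine Finset.sum_congr rfl fun a _ => ?_
      rw [Equiv.neg_apply, neg_neg, map_mul, map_mul, ← h2, neg_neg, ← h4, Root.neg_val]
      simp
    · rw [lie_def, bracket_snd, bracket_snd, map_add, map_sub, map_mul, map_mul, hp x h1, hp y h3,
        h2, h4, Root.neg_val, pair_lat_neg, pair_lat_neg, map_sum (starRingEnd ℂ)]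
      refine congrArg₂ (· + ·) (by ring) ?_
      rw [← Equiv.sum_comp (Equiv.neg Root)]
      refine Finset.sum_congr rfl fun a _ => ?_
      rw [← Equiv.sum_comp (Equiv.neg Root), map_sum]
      refine Finset.sum_congr rfl fun b _ => ?_
      simp only [Equiv.neg_apply, Root.neg_val, ← neg_add, neg_inj, eps_neg_left, eps_neg_right,
        h2, h4]
      split_ifs <;> simp

/-- The standard invariant bilinear form, a positive multiple of the Killing form. -/
noncomputable def form (x y : E7C) : ℂ :=
  ∑ i, x.cart i * pair (Pi.single i 1) y.cart - ∑ a : Root, x.coef a * y.coef (-a)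

theorem form_add_left (x y z : E7C) : form (x + y) z = form x z + form y z := by
  simp only [form, add_fst, add_snd, add_mul, Finset.sum_add_distrib]; ring

theorem form_add_right (x y z : E7C) : form x (y + z) = form x y + form x z := by
  simp only [form, add_snd, pair_add, mul_add, Finset.sum_add_distrib]; ring

theorem form_smul_left (r : ℂ) (x y : E7C) : form (r • x) y = r * form x y := by
  simp only [form, smul_fst, smul_snd, mul_assoc, ← Finset.mul_sum]; ring

theorem form_smul_right (r : ℂ) (x y : E7C) : form x (r • y) = r * form x y := by
  simp only [form, smul_snd, pair_smul, mul_left_comm _ r, ← Finset.mul_sum]; ring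

theorem form_neg_left (x z : E7C) : form (-x) z = -form x z := by
  have := form_smul_left (-1) x z; simpa using this

theorem form_neg_right (x z : E7C) : form x (-z) = -form x z := by
  have := form_smul_right (-1) x z; simpa using this

theorem form_zero_left (z : E7C) : form 0 z = 0 := by
  have := form_smul_left 0 0 z; simpa using this

theorem form_zero_right (z : E7C) : form z 0 = 0 := by
  have := form_smul_right 0 z 0; simpa using this

theorem form_symm (x y : E7C) : form x y = form y x := by
  unfold form
  congr 1
  · simp only [pair, Finset.mul_sum]
    rw [Finset.sum_comm]
    refine Finset.sum_congr rfl fun a _ => Finset.sum_congr rfl fun b _ => ?_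
    rw [ip_comm]; ring
  · rw [← Equiv.sum_comp (Equiv.neg Root)]
    refine Finset.sum_congr rfl fun a _ => ?_
    simp [mul_comm]

theorem form_he (c : Fin 7 → ℂ) (v : Lat) : form (hh c) (ee v) = 0 := by
  simp [form, pair_zero]

theorem form_eh (c : Fin 7 → ℂ) (v : Lat) : form (ee v) (hh c) = 0 := by
  simp [form]

theorem pair_eq (v : Lat) (c : Fin 7 → ℂ) : pair v c = ∑ i, (v i : ℂ) * pair (Pi.single i 1) c := by
  simp only [pair, Finset.mul_sum]
  rw [Finset.sum_comm]
  refine Finset.sum_congr rfl fun j _ => ?_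
  rw [ip_comm, ip_sum]
  push_cast
  rw [Finset.sum_mul]
  refine Finset.sum_congr rfl fun i _ => ?_
  rw [ip_comm]; ring

theorem form_lh (v : Lat) (c : Fin 7 → ℂ) : form (hl v) (hh c) = pair v c := by
  rw [pair_eq, form]; simp only [hl_fst, hl_snd, zero_mul, Finset.sum_const_zero, sub_zero]; rfl

theorem form_ee (v : Lat) (b : Root) :
    form (ee v) (ee b.1) = if v + b.1 = 0 then -1 else 0 := by
  simp only [form, ee_fst, zero_mul, Finset.sum_const_zero, zero_sub, ee_snd, Root.neg_val]
  rw [Finset.sum_eq_single (-b)]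
  · simp only [Root.neg_val, neg_neg, if_true, mul_one, neg_eq_iff_add_eq_zero, add_comm v]
    split_ifs <;> simp
  · intro a _ ha
    rw [if_neg (c := -a.1 = b.1), mul_zero]
    intro h; apply ha; apply Subtype.ext; rw [Root.neg_val, ← h, neg_neg]
  · simp

theorem form_invariant (x y z : E7C) : form ⁅x, y⁆ z = form x ⁅y, z⁆ := by
  simp only [lie_def]
  induction x using basis_ind with
  | hadd x x' h h' => simp only [bracket_add_left, form_add_left, h, h']
  | hsmul r x h => simp only [bracket_smul_left, form_smul_left, h]
  | h1 p =>
    induction y using basis_ind with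
    | hadd x x' h h' =>
      simp only [bracket_add_left, bracket_add_right, form_add_left, form_add_right, h, h']
    | hsmul r x h =>
      simp only [bracket_smul_left, bracket_smul_right, form_smul_left, form_smul_right, h]
    | h1 q =>
      induction z using basis_ind with
      | hadd x x' h h' => simp only [bracket_add_right, form_add_right, h, h']
      | hsmul r x h => simp only [bracket_smul_right, form_smul_right, h]
      | h1 r => simp [bracket_hh, form_zero_left, form_zero_right]
      | h2 c => simp [bracket_hh, bracket_he, form_zero_left, form_smul_right, form_he]
    | h2 b =>
      induction z using basis_ind with
      | hadd x x' h h' => simp only [bracket_add_right, form_add_right, h, h']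
      | hsmul r x h => simp only [bracket_smul_right, form_smul_right, h]
      | h1 r =>
        simp [bracket_he, bracket_eh, form_smul_left, form_smul_right, form_he, form_eh,
          form_neg_right]
      | h2 c =>
        rw [bracket_he, bracket_ee, form_smul_left, form_add_right, form_smul_right, form_he,
          form_ee]
        split_ifs with h
        · rw [form_neg_right, form_symm, form_lh]; ring
        · rw [form_zero_right]; ring
  | h2 a =>
    induction y using basis_ind with
    | hadd x x' h h' =>
      simp only [bracket_add_left, bracket_add_right, form_add_left, form_add_right, h, h']
    | hsmul r x h =>
      simp only [bracket_smul_left, bracket_smul_right, form_smul_left, form_smul_right, h]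
    | h1 q =>
      induction z using basis_ind with
      | hadd x x' h h' => simp only [bracket_add_right, form_add_right, h, h']
      | hsmul r x h => simp only [bracket_smul_right, form_smul_right, h]
      | h1 r =>
        simp [bracket_hh, bracket_eh, form_smul_left, form_eh, form_neg_left, form_zero_right]
      | h2 c =>
        rw [bracket_eh, bracket_he, form_neg_left, form_smul_left, form_smul_right, form_ee]
        split_ifs with h
        · rw [eq_neg_of_add_eq_zero_left h, pair_lat_neg]; ring
        · ring
    | h2 b =>
      induction z using basis_ind with
      | hadd x x' h h' => simp only [bracket_add_right, form_add_right, h, h']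
      | hsmul r x h => simp only [bracket_smul_right, form_smul_right, h]
      | h1 r =>
        rw [bracket_eh, bracket_ee, form_add_left, form_smul_left, form_eh, form_neg_right,
          form_smul_right, form_ee]
        split_ifs with h
        · rw [form_neg_left, form_lh, eq_neg_of_add_eq_zero_left h, pair_lat_neg]; ring
        · rw [form_zero_left]; ring
      | h2 c =>
        have hz : ∀ (u v w : Root), form (if u.1 + v.1 = 0 then -hl u.1 else 0) (ee w.1) = 0 := by
          intro u v w
          split_ifs
          · rw [form_neg_left, hl, form_he, neg_zero]
          · exact form_zero_left _
        rw [bracket_ee, bracket_ee, form_add_left, form_symm (ee a.1), form_add_left, hz, hz,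
          form_smul_left, form_smul_left, form_ee, form_ee]
        by_cases h : a.1 + b.1 + c.1 = 0
        · have h' : b.1 + c.1 + a.1 = 0 := by rw [← h]; abel
          rw [if_pos h, if_pos h']
          have hc : c.1 = -(a.1 + b.1) := (neg_eq_of_add_eq_zero_right h).symm
          have hip : ip a.1 b.1 = -1 := by
            have := ip_add_self a b
            have hc2 := c.2
            rw [hc, ip_neg_left, ip_neg_right] at hc2
            omega
          rw [hc, eps_neg_right, eps_add_right, eps_root, eps_swap_of a.1 b.1 hip]
          push_cast; ring
        · have h' : b.1 + c.1 + a.1 ≠ 0 := by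
            intro h'; apply h; rw [← h']; abel
          rw [if_neg h, if_neg h']; simp

end E7C

/-- The compact simple Lie algebra `e₇`, of dimension `133`. -/
abbrev e7 : Type := E7C.realForm

namespace e7
open E7C ComplexConjugate

noncomputable instance : NormedAddCommGroup e7 :=
  inferInstanceAs (NormedAddCommGroup E7C.realForm.toSubmodule)

noncomputable instance : NormedSpace ℝ e7 :=
  inferInstanceAs (NormedSpace ℝ E7C.realForm.toSubmodule)

instance : FiniteDimensional ℝ e7 :=
  inferInstanceAs (FiniteDimensional ℝ E7C.realForm.toSubmodule)


/-- Minus the real part of the invariant form, a positive definite invariant inner product on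
`e₇`. It is used only to show that the Killing form is negative definite. -/
noncomputable def inner : LinearMap.BilinForm ℝ e7 :=
  LinearMap.mk₂ ℝ (fun x y => -(form x.1 y.1).re)
    (fun x y z => by simp [form_add_left]; ring)
    (fun c x y => by
      have := form_smul_left (c : ℂ) x.1 y.1
      have h : ((c • x : e7) : E7C) = (c : ℂ) • (x : E7C) := rfl
      rw [h, this]; simp)
    (fun x y z => by simp [form_add_right]; ring)
    (fun c x y => by
      have := form_smul_right (c : ℂ) x.1 y.1
      have h : ((c • y : e7) : E7C) = (c : ℂ) • (y : E7C) := rfl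
      rw [h, this]; simp)

theorem inner_apply (x y : e7) : inner x y = -(form x.1 y.1).re := rfl

theorem cart_eq (x : e7) (i) : x.1.cart i = Complex.I * ((x.1.cart i).im : ℂ) := by
  have := congrArg Complex.re (x.2.1 i)
  simp at this
  apply Complex.ext
  · simp; linarith
  · simp

theorem inner_self (x : e7) : inner x x =
    (fun i => (x.1.cart i).im) ⬝ᵥ (CartanMatrix.E₇.map (Int.cast : ℤ → ℝ)).mulVec
      (fun i => (x.1.cart i).im) + ∑ a, Complex.normSq (x.1.coef a) := by
  rw [inner_apply, form]
  have h1 : ∀ a, x.1.coef a * x.1.coef (-a) = (Complex.normSq (x.1.coef a) : ℂ) := by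
    intro a; rw [x.2.2 a, Complex.mul_conj]
  have hC : ∀ i j, ip (Pi.single i 1) (Pi.single j 1) = CartanMatrix.E₇ i j := by
    intro i j; simp [ip]
  simp only [h1, pair, hC]
  rw [Complex.sub_re, neg_sub, sub_eq_add_neg, add_comm]
  congr 1
  · simp only [Complex.re_sum, ← Finset.sum_neg_distrib, dotProduct, Matrix.mulVec,
      Finset.mul_sum]
    refine Finset.sum_congr rfl fun i _ => Finset.sum_congr rfl fun j _ => ?_
    rw [cart_eq x i, cart_eq x j]
    simp
  · simp [Complex.re_sum]

theorem inner_pos {x : e7} (hx : x ≠ 0) : 0 < inner x x := by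
  rw [inner_self]
  have hn : 0 ≤ ∑ a, Complex.normSq (x.1.coef a) :=
    Finset.sum_nonneg fun _ _ => Complex.normSq_nonneg _
  by_cases h : (fun i => (x.1.cart i).im) = 0
  · rw [h, zero_dotProduct, zero_add]
    refine hn.lt_of_ne fun h0 => hx ?_
    have h2 := (Finset.sum_eq_zero_iff_of_nonneg
      fun a _ => Complex.normSq_nonneg (x.1.coef a)).1 h0.symm
    apply Subtype.ext
    ext i
    · rw [cart_eq x i, congrFun h i]; simp
    · simpa using h2 i (Finset.mem_univ _)
  · have := real_pos h
    linarith

theorem inner_symm (x y : e7) : inner x y = inner y x := by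
  rw [inner_apply, inner_apply, form_symm]

theorem inner_invariant (x y z : e7) : inner ⁅x, y⁆ z = -inner y ⁅x, z⁆ := by
  have h : inner ⁅y, x⁆ z = inner y ⁅x, z⁆ := by
    rw [inner_apply, inner_apply]
    exact congrArg (fun t : ℂ => -t.re) (form_invariant y.1 x.1 z.1)
  rw [← lie_skew, map_neg, LinearMap.neg_apply, h]

theorem trace_neg {V : Type} [AddCommGroup V] [Module ℝ V] [FiniteDimensional ℝ V]
    (S : LinearMap.BilinForm ℝ V) (hs : ∀ x y, S x y = S y x) (hp : ∀ x, x ≠ 0 → 0 < S x x)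
    (T : V →ₗ[ℝ] V) (hT : ∀ x y, S (T x) y = -S x (T y)) (hT0 : T ≠ 0) :
    LinearMap.trace ℝ V (T ∘ₗ T) < 0 := by
  have : Invertible (2 : ℝ) := invertibleOfNonzero two_ne_zero
  obtain ⟨v, hv⟩ := LinearMap.BilinForm.exists_orthogonal_basis (B := S) ⟨hs⟩
  have hrep : ∀ x i, v.repr x i = S x (v i) / S (v i) (v i) := by
    intro x i
    rw [eq_div_iff (hp _ (v.ne_zero i)).ne']
    conv_rhs => rw [← v.sum_repr x]
    rw [map_sum, LinearMap.sum_apply, Finset.sum_eq_single i]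
    · simp
    · intro j _ hj
      rw [map_smul, LinearMap.smul_apply, hv hj, smul_zero]
    · simp
  have htr : LinearMap.trace ℝ V (T ∘ₗ T) = ∑ i, -(S (T (v i)) (T (v i)) / S (v i) (v i)) := by
    rw [LinearMap.trace_eq_matrix_trace ℝ v, Matrix.trace]
    refine Finset.sum_congr rfl fun i _ => ?_
    rw [Matrix.diag_apply, LinearMap.toMatrix_apply, hrep, LinearMap.comp_apply, hT, neg_div]
  have hnn : ∀ x, 0 ≤ S x x := fun x => by
    by_cases h : x = 0
    · simp [h]
    · exact (hp x h).le
  rw [htr]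
  obtain ⟨i, hi⟩ : ∃ i, T (v i) ≠ 0 := by
    by_contra hcon
    push Not at hcon
    exact hT0 (v.ext fun i => by rw [hcon i]; rfl)
  refine Finset.sum_neg' (fun j _ => ?_) ⟨i, Finset.mem_univ _, ?_⟩
  · have := hnn (T (v j)); have := hp _ (v.ne_zero j)
    rw [neg_nonpos]; positivity
  · have := hp _ hi; have := hp _ (v.ne_zero i)
    rw [neg_lt_zero]; positivity

theorem ad_ne_zero {x : e7} (hx : x ≠ 0) : LieAlgebra.ad ℝ e7 x ≠ 0 := by
  intro h0
  apply hx
  have hb : ∀ y : e7, bracket x.1 y.1 = 0 := fun y => by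
    have := LinearMap.congr_fun h0 y
    exact congrArg Subtype.val this
  have hcoef : ∀ c, x.1.coef c = 0 := by
    intro c
    have hm : Complex.I • hl c.1 ∈ E7C.realForm := by
      refine ⟨fun i => ?_, fun a => ?_⟩ <;> simp
    have := hb ⟨_, hm⟩
    have := congrArg (fun z : E7C => z.coef c) this
    simp only [bracket_snd, smul_snd, hl_snd, mul_zero, ite_self, Finset.sum_const_zero,
      pair_smul, pair_hl, c.2, zero_snd] at this
    simpa using this
  have hpair : ∀ c : Root, pair c.1 x.1.cart = 0 := by
    intro c
    have hm : ee c.1 + ee (-c.1) ∈ E7C.realForm := by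
      refine ⟨fun i => ?_, fun a => ?_⟩
      · simp
      · have hiff : -a.1 = c.1 ↔ a.1 = -c.1 := neg_eq_iff_eq_neg
        simp only [add_snd, ee_snd, Root.neg_val, neg_inj, hiff]
        rw [add_comm]
        split_ifs <;> simp
    have := hb ⟨_, hm⟩
    have := congrArg (fun z : E7C => z.coef c) this
    have hne : c.1 ≠ -c.1 := by
      intro h
      have h2 := c.2
      nth_rewrite 1 [h] at h2
      rw [ip_neg_left, c.2] at h2
      omega
    simp only [bracket_snd, add_snd, hcoef, pair_add, pair_zero, zero_snd, ee_snd] at this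
    simpa [hne] using this
  apply Subtype.ext
  have hsimple : ∀ i : Fin 7, ip (Pi.single i 1) (Pi.single i 1) = 2 := by
    intro i; simp [ip]
  have hx0 : inner x x = 0 := by
    rw [inner_apply, form]
    simp only [hcoef, zero_mul, Finset.sum_const_zero, sub_zero]
    rw [Finset.sum_eq_zero]
    · simp
    · intro i _
      rw [hpair ⟨_, hsimple i⟩, mul_zero]
  by_contra hne
  exact (inner_pos (x := x) fun h => hne (by rw [h])).ne' hx0

theorem killing_neg {x : e7} (hx : x ≠ 0) : killingForm ℝ e7 x x < 0 := by
  rw [killingForm_apply_apply]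
  exact trace_neg inner inner_symm (fun _ h => inner_pos h) _
    (fun y z => inner_invariant x y z) (ad_ne_zero hx)

end e7

open E7C

/-! ### The subalgebra -/

/-- Seven pairwise orthogonal roots. In the usual realization of the roots in `ℝ⁸`, with
`α₁ = (ε₁ + ε₈ - ε₂ - ⋯ - ε₇) / 2`, `α₂ = ε₁ + ε₂`, `αⱼ = εⱼ₋₁ - εⱼ₋₂` for `j ≥ 3`, they are
`ε₂ - ε₁`, `ε₁ + ε₂`, `ε₄ - ε₃`, `ε₃ + ε₄`, `ε₆ - ε₅`, `ε₅ + ε₆`, `ε₈ - ε₇`. -/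
def beta : Fin 7 → Lat :=
  ![![0, 0, 1, 0, 0, 0, 0], ![0, 1, 0, 0, 0, 0, 0], ![0, 0, 0, 0, 1, 0, 0],
    ![0, 1, 1, 2, 1, 0, 0], ![0, 0, 0, 0, 0, 0, 1], ![0, 1, 1, 2, 2, 2, 1],
    ![2, 2, 3, 4, 3, 2, 1]]

theorem ip_beta (i j : Fin 7) : ip (beta i) (beta j) = if i = j then 2 else 0 := by
  revert i j; decide

/-- The roots `± βⱼ`. -/
def IsKRoot (a : Root) : Prop := ∃ j, a.1 = beta j ∨ a.1 = -beta j

theorem IsKRoot.ip_ne {a b : Root} (ha : IsKRoot a) (hb : IsKRoot b) : ip a.1 b.1 ≠ -1 := by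
  obtain ⟨i, hi⟩ := ha
  obtain ⟨j, hj⟩ := hb
  have h := ip_beta i j
  rcases hi with hi | hi <;> rcases hj with hj | hj <;> rw [hi, hj] <;>
    simp only [ip_neg_left, ip_neg_right, h] <;> split_ifs <;> omega

/-- The subalgebra `𝔨 ≅ 𝔰𝔲(2)⁷` of maximal rank: the real form of the sum of the seven commuting
subalgebras `ℂ βⱼ ⊕ ℂ e_{βⱼ} ⊕ ℂ e_{-βⱼ} ≅ 𝔰𝔩₂(ℂ)`. The `βⱼ` span the Cartan subalgebra, so that
`𝔨` consists of the elements of `e₇` with no component along the other root vectors. -/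
noncomputable def k : LieSubalgebra ℝ e7 where
  carrier := {x | ∀ a : Root, ¬IsKRoot a → x.1.coef a = 0}
  add_mem' := by
    intro x y hx hy a ha
    change x.1.coef a + y.1.coef a = 0
    rw [hx a ha, hy a ha, add_zero]
  zero_mem' := fun a _ => rfl
  smul_mem' := by
    intro c x hx a ha
    change (c : ℂ) * x.1.coef a = 0
    rw [hx a ha, mul_zero]
  lie_mem' := by
    intro x y hx hy c hc
    change (bracket x.1 y.1).coef c = 0
    rw [bracket_snd, hx c hc, hy c hc, mul_zero, mul_zero, sub_zero, zero_add]
    refine Finset.sum_eq_zero fun a _ => Finset.sum_eq_zero fun b _ => ?_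
    split_ifs with h
    · by_cases ha : IsKRoot a
      · by_cases hb : IsKRoot b
        · exfalso
          have := ip_add_self a b
          rw [h, c.2] at this
          exact ha.ip_ne hb (by omega)
        · rw [hy b hb]; ring
      · rw [hx a ha]; ring
    · rfl

/-- The orthogonal complement `𝔭` of `𝔨` for the Killing form, that is, the tangent space of `G/K`
at the base point. -/
noncomputable def p : Submodule ℝ e7 := (killingForm ℝ e7).orthogonal k.toSubmodule

theorem isCompl : IsCompl p k.toSubmodule := by
  have hr : (killingForm ℝ e7).IsRefl := (LieModule.traceForm_isSymm ℝ e7 e7).isRefl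
  refine ((LinearMap.BilinForm.isCompl_orthogonal_iff_disjoint hr).2 ?_).symm
  rw [Submodule.disjoint_def]
  intro x hx hx'
  by_contra h
  exact (e7.killing_neg h).ne (hx' x hx)

/-- The projection `X ↦ X_𝔭` along `𝔨`. -/
noncomputable def projP : e7 →ₗ[ℝ] p := p.projectionOnto k.toSubmodule isCompl

/-! ### Groups -/

/-- The group generated by the operators `exp (ad X)`, `X ∈ S`. -/
noncomputable def expGroup (S : Set e7) : Subgroup (e7 →L[ℝ] e7)ˣ :=
  Subgroup.closure {u | ∃ X ∈ S, (u : e7 →L[ℝ] e7) =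
    NormedSpace.exp (LinearMap.toContinuousLinearMap (LieAlgebra.ad ℝ e7 X))}

/-- The compact connected Lie group `E₇` in its adjoint form: the group generated by all
`exp (ad X)`. (The isotropy representation and the invariant tensors of `E₇/SU(2)⁷` do not depend on
the connected form of the group, since the centre of `E₇` acts trivially.) -/
noncomputable def G : Subgroup (e7 →L[ℝ] e7)ˣ := expGroup Set.univ

/-- The connected subgroup of `G` with Lie algebra `𝔨`. -/
noncomputable def K : Subgroup (e7 →L[ℝ] e7)ˣ := expGroup k

theorem K_le_G : K ≤ G := Subgroup.closure_mono fun _ ⟨X, _, h⟩ => ⟨X, Set.mem_univ X, h⟩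

/-- The isotropy representation `Ad(u)|_𝔭`, for `u ∈ K` (which leaves `𝔭` invariant). -/
noncomputable def chi (u : (e7 →L[ℝ] e7)ˣ) : Module.End ℝ p :=
  projP ∘ₗ ((u : e7 →L[ℝ] e7) : e7 →ₗ[ℝ] e7) ∘ₗ p.subtype

/-! ### Invariant metrics -/

/-- Inner products on `𝔭`. -/
structure PosForm where
  form : LinearMap.BilinForm ℝ p
  symm : ∀ x y, form x y = form y x
  pos : ∀ x, x ≠ 0 → 0 < form x x

/-- The inner product is `Ad(K)`-invariant; such inner products are the `G`-invariant Riemannian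
metrics on `G/K`. -/
def PosForm.IsInvariant (Q : PosForm) : Prop :=
  ∀ u ∈ K, ∀ x y, Q.form (chi u x) (chi u y) = Q.form x y

/-- The standard metric `g_B`: minus the Killing form of `e₇`, restricted to `𝔭`. -/
noncomputable def standard : PosForm where
  form := -(killingForm ℝ e7).domRestrict₁₂ p p
  symm x y := by
    simp only [LinearMap.neg_apply, LinearMap.domRestrict₁₂_apply]
    rw [LieModule.traceForm_comm]
  pos x hx := by
    simp only [LinearMap.neg_apply, LinearMap.domRestrict₁₂_apply]
    exact neg_pos.2 (e7.killing_neg fun h => hx (Subtype.ext h))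

/-! ### Curvature -/

/-- The operator `ad_𝔭 X : Y ↦ [X, Y]_𝔭` on `𝔭`, for `X ∈ 𝔤`. -/
noncomputable def adP : e7 →ₗ[ℝ] Module.End ℝ p :=
  LinearMap.mk₂ ℝ (fun X (Y : p) => projP ⁅X, (Y : e7)⁆)
    (fun X Y Z => by simp) (fun c X Y => by simp) (fun X Y Z => by simp) (fun c X Y => by simp)

theorem adP_apply (X : e7) (Y : p) : adP X Y = projP ⁅X, (Y : e7)⁆ := rfl

theorem adP_skew (X Y : p) : adP X Y = -adP Y X := by
  rw [adP_apply, adP_apply, ← lie_skew, map_neg]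

namespace PosForm
variable (Q : PosForm)

theorem nondegenerate : Q.form.Nondegenerate := by
  refine ⟨fun x hx => ?_, fun x hx => ?_⟩ <;>
  · by_contra h
    exact (Q.pos x h).ne' (hx x)

/-- The musical isomorphism: `Q.form (Q.sharp f) y = f y`. -/
noncomputable def sharp : Module.Dual ℝ p ≃ₗ[ℝ] p :=
  (LinearMap.BilinForm.toDual Q.form Q.nondegenerate).symm

theorem form_sharp (f : Module.Dual ℝ p) (y : p) : Q.form (Q.sharp f) y = f y :=
  LinearMap.BilinForm.apply_toDual_symm_apply f y

/-- The metric trace `∑ᵢ F(Xᵢ, Xᵢ)` of a bilinear map `F`, for any `Q`-orthonormal basis `Xᵢ`;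
here written as `∑ᵢ F(bᵢ, bⁱ)` for a basis `bᵢ` and its `Q`-dual basis `bⁱ`. -/
noncomputable def contract {W : Type} [AddCommGroup W] (F : p → p → W) : W :=
  ∑ i, F (finBasis ℝ p i) (Q.sharp ((finBasis ℝ p).coord i))

/-- The Koszul formula at the base point:
`2 ⟨Λ(X)Y, Z⟩ = ⟨[X, Y]_𝔭, Z⟩ + ⟨Y, [Z, X]_𝔭⟩ + ⟨X, [Z, Y]_𝔭⟩`. -/
noncomputable def koszul (X Y : p) : Module.Dual ℝ p :=
  (1 / 2 : ℝ) • (Q.form (adP X Y)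
    + (Q.form Y ∘ₗ (adP.domRestrict p).flip X + Q.form X ∘ₗ (adP.domRestrict p).flip Y))

theorem koszul_apply (X Y Z : p) : Q.koszul X Y Z =
    1 / 2 * (Q.form (adP X Y) Z + (Q.form Y (adP Z X) + Q.form X (adP Z Y))) := rfl

/-- The map `Λ : 𝔭 → End 𝔭` that describes the Levi-Civita connection of an invariant metric on the
reductive space `G/K`. It is the only one with `Λ(X)Y - Λ(Y)X = [X, Y]_𝔭` and all `Λ(X)` skew
(`nomizu_torsion_free`, `nomizu_metric`). -/
noncomputable def nomizu : p →ₗ[ℝ] Module.End ℝ p :=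
  LinearMap.mk₂ ℝ (fun X Y => Q.sharp (Q.koszul X Y))
    (fun X Y Z => by
      rw [← map_add]; congr 1; ext W; simp [koszul_apply]; ring)
    (fun c X Y => by
      rw [← map_smul]; congr 1; ext W; simp [koszul_apply]; ring)
    (fun X Y Z => by
      rw [← map_add]; congr 1; ext W; simp [koszul_apply]; ring)
    (fun c X Y => by
      rw [← map_smul]; congr 1; ext W; simp [koszul_apply]; ring)

theorem form_nomizu (X Y Z : p) : Q.form (Q.nomizu X Y) Z =
    1 / 2 * (Q.form (adP X Y) Z + (Q.form Y (adP Z X) + Q.form X (adP Z Y))) :=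
  Q.form_sharp _ _

theorem ext_form {x y : p} (h : ∀ z, Q.form x z = Q.form y z) : x = y := by
  rw [← sub_eq_zero]
  by_contra hne
  refine (Q.pos _ hne).ne' ?_
  rw [LinearMap.map_sub₂, h, sub_self]

theorem nomizu_torsion_free (X Y : p) : Q.nomizu X Y - Q.nomizu Y X = adP X Y := by
  refine Q.ext_form fun Z => ?_
  rw [map_sub, LinearMap.sub_apply, form_nomizu, form_nomizu, adP_skew Y X]
  simp only [map_neg, LinearMap.neg_apply]
  ring

theorem nomizu_metric (X Y Z : p) : Q.form (Q.nomizu X Y) Z = -Q.form Y (Q.nomizu X Z) := by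
  rw [Q.symm Y, form_nomizu, form_nomizu, adP_skew Y X, adP_skew Z X, adP_skew Z Y]
  simp only [map_neg]
  rw [Q.symm Z, Q.symm Y]
  ring

/-- The Riemannian curvature `R(X, Y) = [Λ(X), Λ(Y)] - Λ([X, Y]_𝔭) - ad [X, Y]_𝔨` of an invariant
metric. -/
noncomputable def curv : p →ₗ[ℝ] p →ₗ[ℝ] Module.End ℝ p :=
  LinearMap.mk₂ ℝ (fun X Y => ⁅Q.nomizu X, Q.nomizu Y⁆ - Q.nomizu (adP X Y)
      - adP (⁅(X : e7), (Y : e7)⁆ - (adP X Y : e7)))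
    (fun X Y Z => by simp [Ring.lie_def, add_mul, mul_add]; abel)
    (fun c X Y => by simp [Ring.lie_def, smul_sub])
    (fun X Y Z => by simp [Ring.lie_def, add_mul, mul_add]; abel)
    (fun c X Y => by simp [Ring.lie_def, smul_sub])

/-- The Ricci tensor `Rc(Y, Z) = tr (X ↦ R(X, Y)Z)`. -/
noncomputable def ricci : LinearMap.BilinForm ℝ p :=
  LinearMap.mk₂ ℝ (fun Y Z => LinearMap.trace ℝ p ((Q.curv.flip Y).flip Z))
    (fun X Y Z => by
      have h : (Q.curv.flip (X + Y)).flip Z = (Q.curv.flip X).flip Z + (Q.curv.flip Y).flip Z := by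
        rw [map_add]; rfl
      rw [h, map_add])
    (fun c X Y => by
      have h : (Q.curv.flip (c • X)).flip Y = c • (Q.curv.flip X).flip Y := by
        rw [map_smul]; rfl
      rw [h, map_smul])
    (fun X Y Z => by rw [map_add, map_add]) (fun c X Y => by rw [map_smul, map_smul])

/-- The Ricci operator, `⟨Ric X, Y⟩ = Rc(X, Y)`. -/
noncomputable def ricciOp : Module.End ℝ p := Q.sharp.toLinearMap ∘ₗ Q.ricci

/-- The scalar curvature. -/
noncomputable def scal : ℝ := LinearMap.trace ℝ p Q.ricciOp

/-- `Rc = ρ g`. -/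
def IsEinstein (rho : ℝ) : Prop := Q.ricci = rho • Q.form

/-- The space `sym(𝔭)^K` of the self-adjoint operators on `𝔭` that commute with `Ad(K)`. Through
`T = ⟨A ·, ·⟩` it is the space of `G`-invariant symmetric `2`-tensors on `G/K`. -/
noncomputable def symK : Submodule ℝ (Module.End ℝ p) where
  carrier := {A | (∀ x y, Q.form (A x) y = Q.form x (A y)) ∧ ∀ u ∈ K, chi u ∘ₗ A = A ∘ₗ chi u}
  add_mem' := by
    rintro A B ⟨h1, h2⟩ ⟨h3, h4⟩
    refine ⟨fun x y => by simp [h1, h3], fun u hu => ?_⟩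
    rw [LinearMap.comp_add, LinearMap.add_comp, h2 u hu, h4 u hu]
  zero_mem' := ⟨fun x y => by simp, fun u hu => by simp⟩
  smul_mem' := by
    rintro c A ⟨h1, h2⟩
    refine ⟨fun x y => by simp [h1], fun u hu => ?_⟩
    rw [LinearMap.comp_smul, LinearMap.smul_comp, h2 u hu]

/-- The second covariant derivative `∇²_{X,Y} A = ∇_X (∇_Y A) - ∇_{∇_X Y} A` at the base point of the
`G`-invariant field of endomorphisms `A`: an invariant tensor has `∇_X A = [Λ(X), A]`. -/
noncomputable def hess (A : Module.End ℝ p) (X Y : p) : Module.End ℝ p :=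
  ⁅Q.nomizu X, ⁅Q.nomizu Y, A⁆⁆ - ⁅Q.nomizu (Q.nomizu X Y), A⁆

/-- The action of the curvature on symmetric tensors, `X ↦ ∑ᵢ R(X, Xᵢ) A Xᵢ` with `Xᵢ` an
orthonormal basis. -/
noncomputable def curvAction (A : Module.End ℝ p) : Module.End ℝ p :=
  Q.contract fun Y Z => (Q.curv.flip Y).flip (A Z)

/-- The Lichnerowicz Laplacian `Δ_L A = ∇*∇ A + Ric ∘ A + A ∘ Ric - 2 ∑ᵢ R(·, Xᵢ) A Xᵢ` on
`G`-invariant symmetric `2`-tensors `⟨A ·, ·⟩`, where `∇*∇ = - ∑ᵢ ∇²_{Xᵢ,Xᵢ}`. -/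
noncomputable def lichnerowicz (A : Module.End ℝ p) : Module.End ℝ p :=
  -Q.contract (Q.hess A) + (Q.ricciOp ∘ₗ A + A ∘ₗ Q.ricciOp) - (2 : ℝ) • Q.curvAction A

/-- The divergence `δ A = - ∑ᵢ (∇_{Xᵢ} A) Xᵢ`. -/
noncomputable def divergence (A : Module.End ℝ p) : p :=
  -Q.contract fun X Y => ⁅Q.nomizu X, A⁆ Y

/-- `⟨A ·, ·⟩` is a `G`-invariant TT-tensor (traceless and divergence free). -/
def IsTT (A : Module.End ℝ p) : Prop :=
  A ∈ Q.symK ∧ LinearMap.trace ℝ p A = 0 ∧ Q.divergence A = 0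

/-- The eigenvalues of the Lichnerowicz Laplacian on `G`-invariant TT-tensors. -/
def specTT : Set ℝ := {μ | ∃ A, Q.IsTT A ∧ A ≠ 0 ∧ Q.lichnerowicz A = μ • A}

/-- The metric is Einstein with constant `ρ`, and the least eigenvalue of the Lichnerowicz
Laplacian on `G`-invariant TT-tensors is larger than `2ρ`. -/
def IsGStable (rho : ℝ) : Prop :=
  Q.IsEinstein rho ∧ ∃ l, IsLeast Q.specTT l ∧ 2 * rho < l

/-- The Gram determinant of the metric in a fixed basis of `𝔭`. The total volume of the metric on
`G/K` is a fixed constant times its square root. -/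
noncomputable def gram : ℝ := (LinearMap.BilinForm.toMatrix (finBasis ℝ p) Q.form).det

/-- The `G`-invariant metrics with the same volume as `Q`. -/
def sameVolume : Set PosForm := {Q' | Q'.IsInvariant ∧ Q'.gram = Q.gram}

/-- `Q` is a local maximum of the scalar curvature on the space of `G`-invariant metrics of the same
volume, with the topology of the finite-dimensional space of bilinear forms. -/
def IsLocalMaxScal : Prop := ∃ δ > 0, ∀ Q' ∈ Q.sameVolume,
  (∀ x, |Q'.form x x - Q.form x x| ≤ δ * Q.form x x) → Q'.scal ≤ Q.scal

end PosForm

/-- The operator `L_𝔭 A = -½ ∑ᵢ [ad_𝔭 Xᵢ, [ad_𝔭 Xᵢ, A]]`, where `Xᵢ` is a `g_B`-orthonormal basis. -/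
noncomputable def Lp : Module.End ℝ (Module.End ℝ p) where
  toFun A := -(1 / 2 : ℝ) • standard.contract fun X Y => ⁅adP X, ⁅adP Y, A⁆⁆
  map_add' A B := by
    simp only [PosForm.contract, Ring.lie_def, ← smul_add, ← Finset.sum_add_distrib]
    congr 1
    exact Finset.sum_congr rfl fun _ _ => by
      simp only [mul_add, add_mul, mul_sub, sub_mul]
      abel
  map_smul' c A := by
    simp only [PosForm.contract, Ring.lie_def, RingHom.id_apply, mul_smul_comm, smul_mul_assoc,
      ← smul_sub, ← Finset.smul_sum]
    rw [smul_comm]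

/-- `W` is an `Ad(K)`-invariant subspace of `𝔭`. -/
def IsoInvariant (W : Submodule ℝ p) : Prop := ∀ u ∈ K, ∀ x ∈ W, chi u x ∈ W

/-- `W` is an irreducible `Ad(K)`-invariant subspace of `𝔭`. -/
def IsoIrreducible (W : Submodule ℝ p) : Prop :=
  IsoInvariant W ∧ W ≠ ⊥ ∧ ∀ V ≤ W, IsoInvariant V → V = ⊥ ∨ V = W

/-- There is an isomorphism `f : V → W` with `f(Ad(u)x) = Ad(u)f(x)` for all `u ∈ K`. -/
def IsoEquivalent (V W : Submodule ℝ p) : Prop :=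
  ∃ f : V ≃ₗ[ℝ] W, ∀ u ∈ K, ∀ x y : V, chi u x = y → chi u (f x) = f y

/-- The index sets `(1234)`, `(1256)`, `(3456)`, `(1357)`, `(2457)`, `(1467)`, `(2367)` of the seven
summands, as subsets of `{0, …, 6}`. -/
def code : Fin 7 → Finset (Fin 7) :=
  ![{0, 1, 2, 3}, {0, 1, 4, 5}, {2, 3, 4, 5}, {0, 2, 4, 6}, {1, 3, 4, 6}, {0, 3, 5, 6},
    {1, 2, 5, 6}]

/-- The roots that are non-orthogonal to `βⱼ` exactly for the `j` in the index set. They are the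
`16` roots `½ ∑_{j ∈ code i} ± βⱼ`. -/
def delta (i : Fin 7) : Set Root := {a | ∀ j, ip a.1 (beta j) ≠ 0 ↔ j ∈ code i}

/-- The summand `𝔭ᵢ`, with complexification the sum of the root spaces for the roots in `delta i`. -/
noncomputable def summand (i : Fin 7) : Submodule ℝ p where
  carrier := {x | (∀ j, x.1.1.cart j = 0) ∧ ∀ a ∉ delta i, x.1.1.coef a = 0}
  add_mem' := by
    rintro x y ⟨h1, h2⟩ ⟨h3, h4⟩
    refine ⟨fun j => ?_, fun a ha => ?_⟩
    · change x.1.1.cart j + y.1.1.cart j = 0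
      rw [h1, h3, add_zero]
    · change x.1.1.coef a + y.1.1.coef a = 0
      rw [h2 a ha, h4 a ha, add_zero]
  zero_mem' := ⟨fun _ => rfl, fun _ _ => rfl⟩
  smul_mem' := by
    rintro c x ⟨h1, h2⟩
    refine ⟨fun j => ?_, fun a ha => ?_⟩
    · change (c : ℂ) * x.1.1.cart j = 0
      rw [h1, mul_zero]
    · change (c : ℂ) * x.1.1.coef a = 0
      rw [h2 a ha, mul_zero]

/-- The family `X` is a `g_B`-orthonormal basis of the subspace `W`. -/
def IsOrthonormalBasisOf {n : ℕ} (X : Fin n → p) (W : Submodule ℝ p) : Prop :=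
  (∀ a b, standard.form (X a) (X b) = if a = b then 1 else 0) ∧
    Submodule.span ℝ (Set.range X) = W

/-- The structural constant `∑ ⟨[Xₐ, Yᵦ], Z_c⟩²` of three families of vectors of `𝔭`. -/
noncomputable def structConst {l m n : ℕ} (X : Fin l → p) (Y : Fin m → p) (Z : Fin n → p) : ℝ :=
  ∑ a, ∑ b, ∑ c, (-killingForm ℝ e7 ⁅(X a : e7), (Y b : e7)⁆ (Z c)) ^ 2

end E7SU2

/-! The roots `β₁, …, β₇` are orthogonal of squared length 2 and span the Cartan subalgebra, so a
lattice vector `v` is determined by the seven integers `nb v j = ⟨v, βⱼ⟩`, and `2⟨v, w⟩` is the dot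
product of two such tuples (`two_mul_ip`). Reduced mod 2, the tuples of lattice vectors form the
simplex code of length 7: the zero word and seven words of weight 4 (`odd_nb`). A root other than
`±βⱼ` has entries in `{-1, 0, 1}` whose squares sum to 4, hence is `½ ∑ ±βⱼ` over one of the seven
words, and all 16 sign choices occur. These are the sets `delta k`. Adding a root `±βⱼ` does not
change parities, so `𝔨` preserves each block; adding two roots adds their parities, so a bracket of
blocks `i` and `j` has its `𝔭`-component in the block whose word is the symmetric difference. The
triples of blocks that interact are thus the lines of a Fano plane.

The representation theory rests on a Schur lemma (`exists_eq_blockScalar`). Since `𝔨` contains the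
Cartan subalgebra, an operator commuting with `𝔨` is a scalar on each root space; self-adjointness
makes the scalars real; commuting with the root vectors of the `βⱼ` makes them invariant under the
reflections at the `βⱼ`, which act transitively on each `delta k`. Hence `sym(𝔭)^K` is a copy of
`ℝ⁷`, realised by `blockScalar`. Irreducibility follows by applying this to orthogonal projections,
inequivalence from the disjointness of the sets of torus weights.

The analysis reduces to the single operator `A ↦ ∑ ad_𝔭 Xₐ ∘ A ∘ ad_𝔭 Xₐ` (`sandwich`). Counting
brackets of root vectors shows that on block scalars it is `m ↦ (mᵢ - ∑ m) / 9`
(`sandwich_blockScalar`). For `A = 1` this is the Casimir value `-2/3`; comparison with the trace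
defining the Killing form leaves `1/6` for the `𝔨`-components of brackets (`kForm_eq`), and the
Ricci constant is `¼ · ⅔ + ⅙ = ⅓`. As `g_B` is naturally reductive, `Λ = ½ ad_𝔭`, and both `L_𝔭` and
the Lichnerowicz Laplacian equal `A ↦ ⅔ A + sandwich A`, that is, the matrix `(7/9) I - (1/9) J` on
`ℝ⁷` with `J` the all-ones matrix. Its eigenvalues are 0 on constants and 7/9 on vectors of sum
zero, which are the traceless tensors; the divergence vanishes automatically.

The local maximum is proved directly, not from the spectrum. An invariant metric is a block scalar
`m`, and its scalar curvature is `8 ∑ mᵢ⁻¹` minus `8/9` times a sum over the seven lines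
(`scal_blockScalar`, `sum_ricciTerm`). With `m = exp u`, equal volume means `∑ u = 0`, and a
second-order Taylor estimate with explicit remainder shows that the value at `u = 0` is not
exceeded. -/

namespace E7SU2

open Module

/-! ### Roots in terms of the orthogonal frame `β₁, …, β₇` -/

/-- The pairing of a lattice vector with `βⱼ`. -/
def nb (v : Lat) (j : Fin 7) : ℤ := ip v (beta j)

theorem nb_add (v w : Lat) (j) : nb (v + w) j = nb v j + nb w j := ip_add_left _ _ _
theorem nb_neg (v : Lat) (j) : nb (-v) j = -nb v j := ip_neg_left _ _
theorem nb_beta (i j) : nb (beta i) j = if i = j then 2 else 0 := ip_beta i j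

/-- Expansion in an orthogonal basis of vectors of squared length 2; the factor 2 keeps it integral.
It is a linear identity in the coordinates of `v`, checked one coordinate at a time. -/
theorem sum_nb_smul_beta (v : Lat) : ∑ j, nb v j • beta j = (2 : ℤ) • v := by
  funext i
  fin_cases i <;>
  simp [nb, ip, beta, CartanMatrix.E₇, dotProduct, Matrix.mulVec, Fin.sum_univ_succ] <;> ring

theorem ip_smul_left (c : ℤ) (v w : Lat) : ip (c • v) w = c * ip v w := by
  rw [ip, smul_dotProduct, smul_eq_mul, ip]

theorem ip_sum_left {ι : Type*} (s : Finset ι) (f : ι → Lat) (w : Lat) :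
    ip (∑ i ∈ s, f i) w = ∑ i ∈ s, ip (f i) w := by
  simp [ip, sum_dotProduct]

theorem two_mul_ip (v w : Lat) : 2 * ip v w = ∑ j, nb v j * nb w j := by
  rw [← ip_smul_left, ← sum_nb_smul_beta, ip_sum_left]
  refine Finset.sum_congr rfl fun j _ => ?_
  rw [ip_smul_left, ip_comm, nb, nb]

theorem nb_injective {v w : Lat} (h : ∀ j, nb v j = nb w j) : v = w := by
  have h2 : (2 : ℤ) • v = (2 : ℤ) • w := by
    rw [← sum_nb_smul_beta, ← sum_nb_smul_beta]; simp only [h]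
  exact smul_right_injective _ (two_ne_zero) h2

theorem sum_sq_nb (a : Root) : ∑ j, nb a.1 j ^ 2 = 4 := by
  have := two_mul_ip a.1 a.1
  rw [a.2] at this
  simp only [pow_two, ← this]
  norm_num

/-- The root `βⱼ`. -/
def betaRoot (j : Fin 7) : Root := ⟨beta j, by rw [ip_beta, if_pos rfl]⟩

theorem isKRoot_betaRoot (j) : IsKRoot (betaRoot j) := ⟨j, Or.inl rfl⟩

theorem isKRoot_neg {a : Root} : IsKRoot (-a) ↔ IsKRoot a := by
  constructor <;> rintro ⟨j, h | h⟩ <;> refine ⟨j, ?_⟩ <;> rw [Root.neg_val] at *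
  · right; rw [← h, neg_neg]
  · left; exact neg_injective h
  · right; rw [h]
  · left; rw [h, neg_neg]

theorem ip_mem (a b : Root) : a = b ∨ a = -b ∨ ip a.1 b.1 = -1 ∨ ip a.1 b.1 = 0 ∨
    ip a.1 b.1 = 1 := by
  by_cases h1 : a = b
  · exact Or.inl h1
  by_cases h2 : a = -b
  · exact Or.inr (Or.inl h2)
  have := ip_le a b h1
  have := le_ip a b fun h0 => h2 (Subtype.ext (eq_neg_of_add_eq_zero_left h0))
  omega

/-- Two roots that are neither equal nor opposite have inner product of absolute value at most 1.
For roots outside `𝔨`, odd and nonzero therefore mean the same for the pairings with the `βⱼ`, which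
turns the definition of `delta` into a parity condition. -/
theorem nb_mem {a : Root} (ha : ¬IsKRoot a) (j) : nb a.1 j = -1 ∨ nb a.1 j = 0 ∨ nb a.1 j = 1 := by
  rcases ip_mem a (betaRoot j) with h | h | h
  · exact absurd ⟨j, Or.inl (by rw [h]; rfl)⟩ ha
  · exact absurd ⟨j, Or.inr (by rw [h]; rfl)⟩ ha
  · exact h

/-- The set of the `j` with odd pairing with `βⱼ` is empty or one of the seven code words. -/
theorem odd_nb (v : Lat) : (∀ j, ¬Odd (nb v j)) ∨ ∃ k, ∀ j, Odd (nb v j) ↔ j ∈ code k := by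
  -- Parity checks of the code: the coordinates 3, 5, 6 are free and determine the others mod 2, so
  -- there are eight words.
  have h4 : (nb v 4 - nb v 5 - nb v 6) % 2 = 0 := by
    simp [nb, ip, beta, CartanMatrix.E₇, dotProduct, Matrix.mulVec, Fin.sum_univ_succ]; omega
  have h2 : (nb v 2 - nb v 3 - nb v 6) % 2 = 0 := by
    simp [nb, ip, beta, CartanMatrix.E₇, dotProduct, Matrix.mulVec, Fin.sum_univ_succ]; omega
  have h1 : (nb v 1 - nb v 3 - nb v 5) % 2 = 0 := by
    simp [nb, ip, beta, CartanMatrix.E₇, dotProduct, Matrix.mulVec, Fin.sum_univ_succ]; omega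
  have h0 : (nb v 0 - nb v 3 - nb v 5 - nb v 6) % 2 = 0 := by
    simp [nb, ip, beta, CartanMatrix.E₇, dotProduct, Matrix.mulVec, Fin.sum_univ_succ]; omega
  have all : ∀ P : Fin 7 → Prop, P 0 → P 1 → P 2 → P 3 → P 4 → P 5 → P 6 → ∀ j, P j := by
    intro P p0 p1 p2 p3 p4 p5 p6 j
    fin_cases j <;> assumption
  simp only [Int.odd_iff]
  rcases Int.emod_two_eq_zero_or_one (nb v 3) with x | x <;>
  rcases Int.emod_two_eq_zero_or_one (nb v 5) with y | y <;>
  rcases Int.emod_two_eq_zero_or_one (nb v 6) with z | z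
  · left; refine all (fun j => ¬nb v j % 2 = 1) ?_ ?_ ?_ ?_ ?_ ?_ ?_ <;> omega
  all_goals right
  · refine ⟨3, all (fun j => nb v j % 2 = 1 ↔ j ∈ code 3) ?_ ?_ ?_ ?_ ?_ ?_ ?_⟩ <;> simp [code] <;> omega
  · refine ⟨1, all (fun j => nb v j % 2 = 1 ↔ j ∈ code 1) ?_ ?_ ?_ ?_ ?_ ?_ ?_⟩ <;> simp [code] <;> omega
  · refine ⟨6, all (fun j => nb v j % 2 = 1 ↔ j ∈ code 6) ?_ ?_ ?_ ?_ ?_ ?_ ?_⟩ <;> simp [code] <;> omega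
  · refine ⟨0, all (fun j => nb v j % 2 = 1 ↔ j ∈ code 0) ?_ ?_ ?_ ?_ ?_ ?_ ?_⟩ <;> simp [code] <;> omega
  · refine ⟨4, all (fun j => nb v j % 2 = 1 ↔ j ∈ code 4) ?_ ?_ ?_ ?_ ?_ ?_ ?_⟩ <;> simp [code] <;> omega
  · refine ⟨2, all (fun j => nb v j % 2 = 1 ↔ j ∈ code 2) ?_ ?_ ?_ ?_ ?_ ?_ ?_⟩ <;> simp [code] <;> omega
  · refine ⟨5, all (fun j => nb v j % 2 = 1 ↔ j ∈ code 5) ?_ ?_ ?_ ?_ ?_ ?_ ?_⟩ <;> simp [code] <;> omega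

theorem code_injective : Function.Injective code := by decide

theorem code_nonempty (k) : (code k).Nonempty := by revert k; decide

theorem card_code (k) : (code k).card = 4 := by revert k; decide

/-- The seven sets `delta k` and the roots `±βⱼ` partition the roots. -/
theorem exists_mem_delta {a : Root} (ha : ¬IsKRoot a) : ∃ k, a ∈ delta k := by
  have hodd : ∀ j, Odd (nb a.1 j) ↔ nb a.1 j ≠ 0 := by
    intro j
    rcases nb_mem ha j with h | h | h <;> rw [h] <;> decide
  rcases odd_nb a.1 with h | ⟨k, h⟩
  -- The zero word would make all pairings vanish, against `∑ nb² = 4`.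
  · exfalso
    have := sum_sq_nb a
    rw [Finset.sum_eq_zero] at this
    · omega
    · intro j _
      have := h j
      rw [hodd, not_not] at this
      rw [this]; rfl
  · exact ⟨k, fun j => by rw [← h j, hodd]; rfl⟩

/-- The root `±βⱼ` is non-orthogonal to only one of the `βᵢ`, while a code word has four elements.
-/
theorem not_isKRoot_of_mem_delta {a : Root} {k} (ha : a ∈ delta k) : ¬IsKRoot a := by
  rintro ⟨j, hj⟩
  have h0 : ∀ i, i ≠ j → i ∉ code k := by
    intro i hi
    rw [← ha i, not_not]
    rcases hj with h | h <;> rw [h] <;> simp [ip_neg_left, ip_beta, hi.symm]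
  have : code k ⊆ {j} := fun i hi => by
    by_contra h
    exact h0 i (by simpa using h) hi
  have := Finset.card_le_card this
  rw [card_code] at this
  simp at this

theorem delta_unique {a : Root} {i k} (hi : a ∈ delta i) (hk : a ∈ delta k) : i = k := by
  apply code_injective
  ext j
  rw [← hi j, ← hk j]

theorem neg_mem_delta {a : Root} {k} : -a ∈ delta k ↔ a ∈ delta k := by
  simp only [delta, Set.mem_ofPred_eq, Root.neg_val, ip_neg_left, neg_ne_zero]

/-- A root with the same parities as a root of `delta k` is in `delta k`. -/
theorem mem_delta_of_odd {a : Root} {k} (h : ∀ j, Odd (nb a.1 j) ↔ j ∈ code k) : a ∈ delta k := by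
  have ha : ¬IsKRoot a := by
    rintro ⟨i, hi⟩
    obtain ⟨j, hj⟩ := code_nonempty k
    have := (h j).2 hj
    rcases hi with hi | hi <;> rw [hi] at this <;>
      simp only [nb_neg, nb_beta, odd_neg] at this <;> split_ifs at this <;>
      revert this <;> decide
  intro j
  rw [← h j]
  change nb a.1 j ≠ 0 ↔ _
  rcases nb_mem ha j with h | h | h <;> rw [h] <;> decide

theorem odd_nb_of_mem_delta {a : Root} {k} (ha : a ∈ delta k) (j) :
    Odd (nb a.1 j) ↔ j ∈ code k := by
  rw [← ha j]
  change _ ↔ nb a.1 j ≠ 0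
  rcases nb_mem (not_isKRoot_of_mem_delta ha) j with h | h | h <;> rw [h] <;> decide

/-! ### Counting roots -/

/-- The elements of the code words, in increasing order. -/
def codeList : Fin 7 → Fin 4 → Fin 7 :=
  ![![0, 1, 2, 3], ![0, 1, 4, 5], ![2, 3, 4, 5], ![0, 2, 4, 6], ![1, 3, 4, 6], ![0, 3, 5, 6],
    ![1, 2, 5, 6]]

/-- The sign `±1` of a truth value. -/
def sgn (b : Bool) : ℤ := if b then 1 else -1

/-- `½ ∑ ± βⱼ`, the sum over the code word `k`. -/
def halfSum (k : Fin 7) (s : Fin 4 → Bool) : Lat :=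
  fun i => (∑ m, sgn (s m) * beta (codeList k m) i) / 2

theorem even_sum_beta (k i : Fin 7) : (2 : ℤ) ∣ ∑ m, beta (codeList k m) i := by
  revert k i; decide

/-- The integer division in `halfSum` is exact: `∑ βⱼ` over a code word is divisible by 2 in the
root lattice, and a change of sign alters the sum by an even vector. -/
theorem two_smul_halfSum (k s) :
    (2 : ℤ) • halfSum k s = ∑ m, sgn (s m) • beta (codeList k m) := by
  funext i
  simp only [Pi.smul_apply, smul_eq_mul, halfSum, Finset.sum_apply]
  apply Int.mul_ediv_cancel'
  have h : ∑ m, sgn (s m) * beta (codeList k m) i = ∑ m, beta (codeList k m) i +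
      ∑ m, (sgn (s m) - 1) * beta (codeList k m) i := by
    rw [← Finset.sum_add_distrib]
    exact Finset.sum_congr rfl fun m _ => by ring
  rw [h]
  refine dvd_add (even_sum_beta k i) (Finset.dvd_sum fun m _ => Dvd.dvd.mul_right ?_ _)
  cases s m <;> decide

theorem nb_halfSum (k s j) :
    nb (halfSum k s) j = ∑ m, if codeList k m = j then sgn (s m) else 0 := by
  have h : 2 * nb (halfSum k s) j = 2 * ∑ m, if codeList k m = j then sgn (s m) else 0 := by
    rw [nb, ← ip_smul_left, two_smul_halfSum, ip_sum_left, Finset.mul_sum]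
    refine Finset.sum_congr rfl fun m _ => ?_
    rw [ip_smul_left, ip_beta]
    split_ifs <;> ring
  omega

theorem codeList_injective (k) : Function.Injective (codeList k) := by
  revert k; decide

theorem mem_code_iff {k j} : j ∈ code k ↔ ∃ m, codeList k m = j := by
  revert k j; decide

theorem nb_halfSum_codeList (k s m) : nb (halfSum k s) (codeList k m) = sgn (s m) := by
  rw [nb_halfSum]
  simp [(codeList_injective k).eq_iff]

theorem nb_halfSum_of_notMem {k j} (s) (h : j ∉ code k) : nb (halfSum k s) j = 0 := by
  rw [nb_halfSum]
  refine Finset.sum_eq_zero fun m _ => if_neg fun h' => h (mem_code_iff.2 ⟨m, h'⟩)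

theorem ip_halfSum (k s) : ip (halfSum k s) (halfSum k s) = 2 := by
  have h := two_mul_ip (halfSum k s) (halfSum k s)
  have h2 : ∀ j, nb (halfSum k s) j * nb (halfSum k s) j = if j ∈ code k then 1 else 0 := by
    intro j
    split_ifs with hj
    · obtain ⟨m, rfl⟩ := mem_code_iff.1 hj
      rw [nb_halfSum_codeList]
      cases s m <;> rfl
    · rw [nb_halfSum_of_notMem s hj]; rfl
  rw [Finset.sum_congr rfl fun j _ => h2 j, Finset.sum_ite_mem, Finset.univ_inter,
    Finset.sum_const, card_code] at h
  simp at h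
  omega

theorem halfSum_mem_delta (k s) : (⟨halfSum k s, ip_halfSum k s⟩ : Root) ∈ delta k := by
  intro j
  change nb (halfSum k s) j ≠ 0 ↔ _
  by_cases hj : j ∈ code k
  · obtain ⟨m, rfl⟩ := mem_code_iff.1 hj
    rw [nb_halfSum_codeList]
    simp only [hj, iff_true]
    cases s m <;> decide
  · simp [hj, nb_halfSum_of_notMem s hj]

/-- The roots in `delta k` correspond to the choices of four signs. -/
noncomputable def deltaEquiv (k : Fin 7) : (Fin 4 → Bool) ≃ delta k :=
  Equiv.ofBijective (fun s => ⟨⟨halfSum k s, ip_halfSum k s⟩, halfSum_mem_delta k s⟩) (by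
    constructor
    · intro s t h
      have h' : halfSum k s = halfSum k t := congrArg (fun x => x.1.1) h
      funext m
      have := congrArg (fun v => nb v (codeList k m)) h'
      simp only [nb_halfSum_codeList] at this
      revert this
      cases s m <;> cases t m <;> decide
    · rintro ⟨a, ha⟩
      -- The signs are read off from the pairings, which are `±1` on the code word and 0 off it.
      refine ⟨fun m => decide (nb a.1 (codeList k m) = 1), Subtype.ext (Subtype.ext ?_)⟩
      apply nb_injective
      intro j
      by_cases hj : j ∈ code k
      · have h0 := (ha j).2 hj
        obtain ⟨m, rfl⟩ := mem_code_iff.1 hj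
        rw [nb_halfSum_codeList]
        rcases nb_mem (not_isKRoot_of_mem_delta ha) (codeList k m) with h | h | h
        · rw [h]; rfl
        · exact absurd h h0
        · rw [h]; rfl
      · have : nb a.1 j = 0 := not_not.1 fun h => hj ((ha j).1 h)
        rw [nb_halfSum_of_notMem _ hj]
        exact this.symm)

open Classical in
theorem card_delta (k) : Fintype.card (delta k) = 16 := by
  rw [← Fintype.card_congr (deltaEquiv k)]
  simp

/-! ### Reflections and second moments of the sets `delta k` -/

/-- The reflection of a root at `βⱼ`. -/
def refl (j : Fin 7) (a : Root) : Root := ⟨a.1 + -(nb a.1 j • beta j), by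
  have h : ip (beta j) a.1 = nb a.1 j := ip_comm _ _
  have h2 : ip a.1 (nb a.1 j • beta j) = nb a.1 j * nb a.1 j := by
    rw [ip_comm, ip_smul_left, h]
  rw [ip_add_left, ip_add_right, ip_add_right, ip_neg_left, ip_neg_right, ip_neg_left,
    ip_neg_right, ip_smul_left, h2, h, ip_smul_left, ip_comm (beta j), ip_smul_left, ip_beta, a.2]
  simp; ring⟩

theorem refl_val (j : Fin 7) (a : Root) : (refl j a).1 = a.1 + -(nb a.1 j • beta j) := rfl

theorem nb_refl (j : Fin 7) (a : Root) (i) :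
    nb (refl j a).1 i = if i = j then -nb a.1 i else nb a.1 i := by
  have : nb (nb a.1 j • beta j) i = nb a.1 j * nb (beta j) i := ip_smul_left _ _ _
  rw [refl_val, nb_add, nb_neg, this, nb_beta]
  split_ifs with h1 h2 h2
  · rw [h1]; ring
  · exact absurd h1.symm h2
  · exact absurd h2.symm h1
  · ring

theorem refl_mem_delta {j : Fin 7} {a : Root} {k} : refl j a ∈ delta k ↔ a ∈ delta k := by
  have : ∀ i, ip (refl j a).1 (beta i) ≠ 0 ↔ ip a.1 (beta i) ≠ 0 := by
    intro i
    have := nb_refl j a i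
    simp only [nb] at this
    rw [this]
    split_ifs <;> simp
  simp only [delta, Set.mem_ofPred_eq, this]

theorem refl_refl (j : Fin 7) (a : Root) : refl j (refl j a) = a := by
  apply Subtype.ext
  apply nb_injective
  intro i
  rw [nb_refl, nb_refl]
  split_ifs <;> simp

open Classical in
theorem sum_refl (j k : Fin 7) (f : Root → ℤ) :
    ∑ b : Root with b ∈ delta k, f (refl j b) = ∑ b : Root with b ∈ delta k, f b := by
  refine Finset.sum_bij' (fun b _ => refl j b) (fun b _ => refl j b) ?_ ?_ ?_ ?_ ?_
  · intro b hb; simpa [refl_mem_delta] using hb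
  · intro b hb; simpa [refl_mem_delta] using hb
  · intro b _; exact refl_refl j b
  · intro b _; exact refl_refl j b
  · intro b _; rfl

-- On the diagonal each of the 16 roots contributes 1 or 0. Off the diagonal, the reflection at `βⱼ`
-- permutes `delta k` and changes the sign of one factor only, so the sum is its own negative.
open Classical in
theorem sum_nb_mul_nb (k i j : Fin 7) : ∑ b : Root with b ∈ delta k, nb b.1 i * nb b.1 j =
    if i = j ∧ j ∈ code k then 16 else 0 := by
  by_cases hij : i = j
  · subst hij
    by_cases hj : i ∈ code k
    · rw [if_pos ⟨rfl, hj⟩]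
      have h1 : ∀ b ∈ Finset.univ.filter (· ∈ delta k), nb b.1 i * nb b.1 i = 1 := by
        intro b hb
        have hb' : b ∈ delta k := by simpa using hb
        have h0 := (hb' i).2 hj
        rcases nb_mem (not_isKRoot_of_mem_delta hb') i with h | h | h
        · rw [h]; rfl
        · exact absurd h h0
        · rw [h]; rfl
      rw [Finset.sum_congr rfl h1, Finset.sum_const, ← Fintype.card_subtype]
      have := card_delta k
      simp only [nsmul_eq_mul, mul_one]
      exact_mod_cast this
    · rw [if_neg fun h => hj h.2]
      refine Finset.sum_eq_zero fun b hb => ?_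
      have hb' : b ∈ delta k := by simpa using hb
      have : nb b.1 i = 0 := not_not.1 fun h => hj ((hb' i).1 h)
      rw [this]; rfl
  · rw [if_neg fun h => hij h.1]
    have := sum_refl j k fun b => nb b.1 i * nb b.1 j
    simp only [nb_refl, if_true, if_neg hij, mul_neg, Finset.sum_neg_distrib] at this
    omega

-- Expanding `2⟨v, b⟩ = ∑ nb v j * nb b j` and using the second moments gives `4 ∑ ⟨v, b⟩² = 16 ∑ nb
-- v j²`. This one count yields both the normalisation of the Killing form and the structural
-- constants.
open Classical in
theorem sum_ip_sq (k : Fin 7) (v : Lat) :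
    ∑ b : Root with b ∈ delta k, ip v b.1 ^ 2 = 4 * ∑ j ∈ code k, nb v j ^ 2 := by
  have h : 4 * ∑ b : Root with b ∈ delta k, ip v b.1 ^ 2 = 16 * ∑ j ∈ code k, nb v j ^ 2 := by
    have h1 : ∀ b : Root, 4 * ip v b.1 ^ 2 =
        ∑ i, ∑ j, nb v i * nb v j * (nb b.1 i * nb b.1 j) := by
      intro b
      have : 4 * ip v b.1 ^ 2 = (2 * ip v b.1) * (2 * ip v b.1) := by ring
      rw [this, two_mul_ip, Finset.sum_mul_sum]
      exact Finset.sum_congr rfl fun _ _ => Finset.sum_congr rfl fun _ _ => by ring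
    rw [Finset.mul_sum, Finset.sum_congr rfl fun b _ => h1 b, Finset.sum_comm]
    have h2 : ∀ i : Fin 7, (∑ b : Root with b ∈ delta k,
        ∑ j, nb v i * nb v j * (nb b.1 i * nb b.1 j)) =
        if i ∈ code k then 16 * nb v i ^ 2 else 0 := by
      intro i
      rw [Finset.sum_comm]
      simp only [← Finset.mul_sum, sum_nb_mul_nb]
      rw [Finset.sum_eq_single i]
      · by_cases hi : i ∈ code k <;> simp [hi]; ring
      · intro j _ hj
        rw [if_neg fun h => hj h.1.symm, mul_zero]
      · simp
    rw [Finset.sum_congr rfl fun i _ => h2 i, Finset.sum_ite_mem, Finset.univ_inter,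
      Finset.mul_sum]
  omega

/-! ### Sums over the roots -/

open Classical in
theorem sum_kRoot (f : Root → ℝ) (hf : ∀ a, f (-a) = f a) :
    ∑ a : Root with IsKRoot a, f a = 2 * ∑ j, f (betaRoot j) := by
  have hne : ∀ i j, betaRoot i ≠ -betaRoot j := by
    intro i j h
    have := congrArg (fun a : Root => nb a.1 i) h
    simp only [Root.neg_val, nb_neg, betaRoot, nb_beta] at this
    split_ifs at this <;> omega
  have hinj : ∀ i j, betaRoot i = betaRoot j → i = j := by
    intro i j h
    by_contra hij
    have := congrArg (fun a : Root => nb a.1 i) h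
    simp only [betaRoot, nb_beta, if_true, if_neg (Ne.symm hij)] at this
    omega
  have h1 : ∀ a, (if IsKRoot a then f a else 0) =
      ∑ j, ((if a = betaRoot j then f a else 0) + if a = -betaRoot j then f a else 0) := by
    intro a
    by_cases ha : IsKRoot a
    · rw [if_pos ha]
      obtain ⟨j, h | h⟩ := ha
      · have h' : a = betaRoot j := Subtype.ext h
        rw [h', Finset.sum_eq_single j]
        · simp [hne]
        · intro i _ hi
          rw [if_neg fun e => hi (hinj _ _ e).symm, if_neg (hne _ _), add_zero]
        · simp
      · have h' : a = -betaRoot j := Subtype.ext h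
        rw [h', Finset.sum_eq_single j]
        · simp [(hne _ _).symm]
        · intro i _ hi
          rw [if_neg fun e => hne _ _ e.symm, if_neg fun e => hi (hinj _ _ (neg_injective e)).symm,
            add_zero]
        · simp
    · rw [if_neg ha, Finset.sum_eq_zero]
      intro j _
      rw [if_neg, if_neg, add_zero]
      · rintro rfl; exact ha ⟨j, Or.inr rfl⟩
      · rintro rfl; exact ha ⟨j, Or.inl rfl⟩
  rw [Finset.sum_filter, Finset.sum_congr rfl fun a _ => h1 a, Finset.sum_comm]
  simp [Finset.sum_add_distrib, hf, two_mul]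

open Classical in
theorem sum_root_split (f : Root → ℝ) : ∑ a, f a =
    ∑ a : Root with IsKRoot a, f a + ∑ k, ∑ a : Root with a ∈ delta k, f a := by
  simp only [Finset.sum_filter]
  rw [Finset.sum_comm, ← Finset.sum_add_distrib]
  refine Finset.sum_congr rfl fun a _ => ?_
  by_cases ha : IsKRoot a
  · rw [if_pos ha, Finset.sum_eq_zero, add_zero]
    exact fun k _ => if_neg fun h => not_isKRoot_of_mem_delta h ha
  · obtain ⟨k, hk⟩ := exists_mem_delta ha
    rw [if_neg ha, zero_add, Finset.sum_eq_single k, if_pos hk]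
    · exact fun i _ hi => if_neg fun h => hi (delta_unique h hk)
    · simp

/-- Every index lies in exactly four of the seven code words. -/
theorem sum_code (f : Fin 7 → ℝ) : ∑ k, ∑ j ∈ code k, f j = 4 * ∑ j, f j := by
  have h : ∀ j, (Finset.univ.filter fun k => j ∈ code k).card = 4 := by decide
  have : ∀ k, ∑ j ∈ code k, f j = ∑ j, if j ∈ code k then f j else 0 := by
    intro k; simp
  simp only [this]
  rw [Finset.sum_comm, Finset.mul_sum]
  refine Finset.sum_congr rfl fun j _ => ?_
  rw [← Finset.sum_filter, Finset.sum_const, h]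
  simp

-- Since `∑ nb v j² = 2⟨v, v⟩`, the roots `±βⱼ` contribute `4⟨v, v⟩` and the seven blocks together
-- `4 · 4 · 2⟨v, v⟩ = 32⟨v, v⟩`. The constant 36 is twice the Coxeter number 18 of `E₇`.
open Classical in
theorem sum_root_ip_sq (v : Lat) : ∑ a : Root, (ip v a.1 : ℝ) ^ 2 = 36 * ip v v := by
  rw [sum_root_split, sum_kRoot _ (by intro a; simp [Root.neg_val, ip_neg_right])]
  have h : ∀ k, ∑ a : Root with a ∈ delta k, (ip v a.1 : ℝ) ^ 2 =
      4 * ∑ j ∈ code k, (nb v j : ℝ) ^ 2 := fun k => by exact_mod_cast sum_ip_sq k v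
  have h2 : ∑ j, (nb v j : ℝ) ^ 2 = 2 * ip v v := by
    have := two_mul_ip v v
    simp only [← pow_two] at this
    exact_mod_cast this.symm
  simp only [h, ← Finset.mul_sum]
  rw [sum_code]
  change 2 * ∑ j, (nb v j : ℝ) ^ 2 + _ = _
  rw [h2]
  ring

/-! ### Elements of the compact real form -/

open E7C ComplexConjugate

namespace e7

/-- The element `i v` of the Cartan subalgebra. -/
noncomputable def ih (v : Lat) : e7 := ⟨Complex.I • hl v, by
  refine ⟨fun i => ?_, fun a => ?_⟩ <;> simp⟩

/-- The element `z eₐ + conj z e₋ₐ`. -/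
noncomputable def pl (a : Root) (z : ℂ) : e7 := ⟨z • ee a.1 + conj z • ee (-a.1), by
  refine ⟨fun i => ?_, fun c => ?_⟩
  · simp
  · have hiff : -c.1 = a.1 ↔ c.1 = -a.1 := neg_eq_iff_eq_neg
    simp only [add_snd, smul_snd, ee_snd, Root.neg_val, neg_inj, hiff]
    rw [add_comm]
    split_ifs <;> simp⟩

theorem pl_val (a : Root) (z : ℂ) : (pl a z).1 = z • ee a.1 + conj z • ee (-a.1) := rfl

open Classical in
theorem pl_coef (a : Root) (z : ℂ) (c : Root) :
    (pl a z).1.coef c = (if c = a then z else 0) + if c = -a then conj z else 0 := by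
  rw [pl_val]
  simp [Subtype.ext_iff, Root.neg_val]

theorem root_ne_neg (a : Root) : a ≠ -a := by
  intro h
  have h2 := a.2
  nth_rewrite 1 [h] at h2
  rw [Root.neg_val, ip_neg_left, a.2] at h2
  omega

theorem pl_coef_self (a : Root) (z : ℂ) : (pl a z).1.coef a = z := by
  rw [pl_coef, if_pos rfl, if_neg (root_ne_neg a), add_zero]

theorem pl_coef_of_ne {a c : Root} (z : ℂ) (h1 : c ≠ a) (h2 : c ≠ -a) : (pl a z).1.coef c = 0 := by
  rw [pl_coef, if_neg h1, if_neg h2, add_zero]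

theorem pl_cart (a : Root) (z : ℂ) (i) : (pl a z).1.cart i = 0 := by
  rw [pl_val]; simp

theorem lie_val (x y : e7) : (⁅x, y⁆ : e7).1 = bracket x.1 y.1 := rfl

theorem add_val (x y : e7) : (x + y).1 = x.1 + y.1 := rfl
theorem sub_val (x y : e7) : (x - y).1 = x.1 - y.1 := rfl
theorem smul_val (c : ℝ) (x : e7) : (c • x).1 = c • x.1 := rfl
theorem neg_val (x : e7) : (-x).1 = -x.1 := rfl

theorem lie_ih_coef (v : Lat) (x : e7) (c : Root) :
    (⁅ih v, x⁆ : e7).1.coef c = Complex.I * ip c.1 v * x.1.coef c := by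
  rw [lie_val, bracket_snd]
  simp [ih, pair_smul, pair_hl]

theorem lie_ih_cart (v : Lat) (x : e7) (i) : (⁅ih v, x⁆ : e7).1.cart i = 0 := by
  rw [lie_val, bracket_fst]
  simp [ih]

theorem ext' {x y : e7} (h1 : ∀ i, x.1.cart i = y.1.cart i) (h2 : ∀ a, x.1.coef a = y.1.coef a) :
    x = y := Subtype.ext (E7C.ext h1 h2)

theorem lie_pl_pl_I (a : Root) : ⁅pl a 1, pl a Complex.I⁆ = (2 : ℝ) • ih a.1 := by
  have h0 : bracket (ee a.1) (ee a.1) = 0 := bracket_ee_zero a a (by rw [a.2]; norm_num)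
  have h1 : bracket (ee (-a.1)) (ee (-a.1)) = 0 :=
    bracket_ee_zero (-a) (-a) (by rw [(-a).2]; norm_num)
  apply Subtype.ext
  rw [lie_val, pl_val, pl_val]
  simp only [bracket_add_left, bracket_add_right, bracket_smul_right, h0, h1,
    bracket_neg_root, bracket_neg_root', Complex.conj_I, map_one, one_smul]
  change _ = (2 : ℝ) • (Complex.I • hl a.1)
  ext c <;> simp; ring

theorem lie_ih_pl (v : Lat) (a : Root) (z : ℂ) :
    ⁅ih v, pl a z⁆ = pl a (Complex.I * ip a.1 v * z) := by
  apply ext'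
  · intro i; rw [lie_ih_cart, pl_cart]
  · intro c
    rw [lie_ih_coef, pl_coef, pl_coef]
    by_cases h1 : c = a
    · subst h1; simp [root_ne_neg]
    · by_cases h2 : c = -a
      · rw [h2, if_pos rfl, if_neg (root_ne_neg a).symm, if_pos rfl, Root.neg_val, ip_neg_left]
        simp [(root_ne_neg a).symm]
      · simp [h1, h2]

/-! ### Operators commuting with the torus -/

/-- An operator that commutes with the Cartan subalgebra acts by a scalar on each root space. -/
theorem exists_root_scalar (T : e7 →ₗ[ℝ] e7) (hT : ∀ v x, T ⁅ih v, x⁆ = ⁅ih v, T x⁆) :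
    ∃ l : Root → ℂ, ∀ x a, (T x).1.coef a = l a * x.1.coef a := by
  have key : ∀ (x : e7) (a : Root), x.1.coef a = 0 → (T x).1.coef a = 0 := by
    intro x a hx
    have hxn : x.1.coef (-a) = 0 := by rw [x.2.2, hx, map_zero]
    have hz : ∀ c, (0 : e7).1.coef c = 0 := fun _ => rfl
    -- With `D = ad (i a)`, the polynomial `D³ + D` kills everything except the root spaces of `±a`,
    -- because `D` acts there by `0` or `±i`. At `a` it acts by `(2i)³ + 2i = -6i ≠ 0`, and it
    -- commutes with `T`; so an `x` without `a`-component has an image without `a`-component.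
    have h0 : ⁅ih a.1, ⁅ih a.1, ⁅ih a.1, x⁆⁆⁆ + ⁅ih a.1, x⁆ = 0 := by
      apply ext'
      · intro i
        rw [add_val, add_fst, lie_ih_cart, lie_ih_cart, add_zero]; rfl
      · intro c
        rw [add_val, add_snd, lie_ih_coef, lie_ih_coef, lie_ih_coef, hz]
        rcases ip_mem c a with h | h | h | h | h
        · rw [h, hx]; simp
        · rw [h, hxn]; simp
        · rw [h]; push_cast; linear_combination (-(Complex.I) * x.1.coef c) * Complex.I_sq
        · rw [h]; simp
        · rw [h]; push_cast; linear_combination (Complex.I * x.1.coef c) * Complex.I_sq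
    have h1 := congrArg T h0
    rw [map_add, hT, hT, hT, map_zero] at h1
    have h2 := congrArg (fun z : e7 => z.1.coef a) h1
    simp only [add_val, add_snd, lie_ih_coef, a.2] at h2
    have h3 : (-6 * Complex.I) * (T x).1.coef a = 0 := by
      rw [hz] at h2
      push_cast at h2
      linear_combination h2 - 8 * Complex.I * (T x).1.coef a * Complex.I_sq
    simpa using h3
  refine ⟨fun a => (T (pl a 1)).1.coef a, fun x a => ?_⟩
  -- Half of `ad (i a)` multiplies the `a`-coefficient by `i`; commuting with it makes `T` complex
  -- linear on this root space.
  have hI : pl a Complex.I = (1 / 2 : ℝ) • ⁅ih a.1, pl a 1⁆ := by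
    rw [lie_ih_pl, a.2]
    apply ext'
    · intro i; rw [pl_cart, smul_val, rsmul_fst, pl_cart, mul_zero]
    · intro c; rw [smul_val, rsmul_snd, pl_coef, pl_coef]
      have c2 : conj (2 : ℂ) = 2 := map_ofNat _ _
      split_ifs <;> simp [c2] <;> ring
  have hTI : (T (pl a Complex.I)).1.coef a = Complex.I * (T (pl a 1)).1.coef a := by
    rw [hI, map_smul, hT, smul_val, rsmul_snd, lie_ih_coef, a.2]
    push_cast; ring
  have hd := key (x - ((x.1.coef a).re • pl a 1 + (x.1.coef a).im • pl a Complex.I)) a (by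
    simp only [sub_val, sub_snd, add_val, add_snd, smul_val, rsmul_snd, pl_coef_self]
    linear_combination -(Complex.re_add_im (x.1.coef a)))
  rw [map_sub, map_add, map_smul, map_smul, sub_val, add_val, smul_val, smul_val, sub_snd, add_snd,
    rsmul_snd, rsmul_snd, hTI] at hd
  linear_combination hd + (T (pl a 1)).1.coef a * Complex.re_add_im (x.1.coef a)

/-! ### The Killing form in terms of root coefficients -/

theorem inner_of_cart {x y : e7} (hy : ∀ i, y.1.cart i = 0) :
    inner x y = ∑ a, (x.1.coef a * conj (y.1.coef a)).re := by
  have hp : ∀ v, pair v y.1.cart = 0 := by intro v; simp [pair, hy]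
  rw [inner_apply, form]
  simp only [hp, mul_zero, Finset.sum_const_zero, zero_sub, Complex.neg_re, neg_neg,
    Complex.re_sum, y.2.2]

theorem inner_pl (x : e7) (a : Root) (z : ℂ) :
    inner x (pl a z) = 2 * (x.1.coef a * conj z).re := by
  classical
  rw [inner_of_cart (pl_cart a z)]
  have h : ∀ c, (x.1.coef c * conj ((pl a z).1.coef c)).re =
      (if c = a then (x.1.coef c * conj z).re else 0) +
        if c = -a then (x.1.coef c * z).re else 0 := by
    intro c
    rw [pl_coef]
    by_cases h1 : c = a
    · subst h1; simp [root_ne_neg]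
    · simp only [if_neg h1, zero_add]; split_ifs <;> simp
  simp only [h, Finset.sum_add_distrib, Finset.sum_ite_eq', Finset.mem_univ, if_true]
  rw [x.2.2]
  simp; ring

/-- Real coordinates on `e₇`. -/
noncomputable def coordEquiv : e7 ≃ₗ[ℝ] (Fin 7 ⊕ Root → ℝ) where
  -- The coefficients at `a` and `-a` are conjugate, so the values at these two roots are `re + im`
  -- and `re - im`, which determine both parts. This gives one real coordinate per root without a
  -- choice of positive roots.
  toFun x := Sum.elim (fun i => (x.1.cart i).im) (fun a => (x.1.coef a).re + (x.1.coef a).im)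
  map_add' x y := by
    funext s; cases s
    · simp [add_val]
    · simp [add_val]; ring
  map_smul' c x := by
    funext s; cases s
    · simp
    · simp; ring
  invFun f := ⟨mk (fun i => Complex.I * f (Sum.inl i)) (fun a =>
      ⟨(f (Sum.inr a) + f (Sum.inr (-a))) / 2, (f (Sum.inr a) - f (Sum.inr (-a))) / 2⟩), by
    refine ⟨fun i => by simp, fun a => ?_⟩
    apply Complex.ext <;> simp <;> ring⟩
  left_inv x := by
    apply ext'
    · intro i; exact (cart_eq x i).symm
    · intro a
      apply Complex.ext
      · simp [x.2.2]; ring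
      · simp [x.2.2]
  right_inv f := by
    funext s; cases s
    · simp
    · simp; ring

/-- The square of `ad (i v)` is diagonal in the real coordinates, with entry `-⟨v, a⟩²` at the root
`a` and 0 on the Cartan part, so the trace is the root sum `sum_root_ip_sq`. -/
theorem killing_ih (v : Lat) : killingForm ℝ e7 (ih v) (ih v) = -(36 * ip v v) := by
  classical
  rw [killingForm_apply_apply, LinearMap.trace_eq_matrix_trace ℝ (Basis.ofEquivFun coordEquiv),
    Matrix.trace]
  have hr : ∀ (x : e7) (s), (Basis.ofEquivFun coordEquiv).repr x s = coordEquiv x s :=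
    fun x s => Basis.ofEquivFun_repr_apply _ _ _
  have hb : ∀ s, coordEquiv (Basis.ofEquivFun coordEquiv s) = Pi.single s 1 := by
    intro s
    rw [Basis.coe_ofEquivFun, LinearEquiv.apply_symm_apply]
  simp only [Matrix.diag_apply, LinearMap.toMatrix_apply, hr]
  have h1 : ∀ (x : e7) (i), coordEquiv ((LieAlgebra.ad ℝ e7 (ih v) ∘ₗ LieAlgebra.ad ℝ e7 (ih v)) x)
      (Sum.inl i) = 0 := by
    intro x i
    change (Complex.im ((⁅ih v, ⁅ih v, x⁆⁆ : e7).1.cart i)) = 0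
    rw [lie_ih_cart]; rfl
  have h2 : ∀ (x : e7) (a : Root),
      coordEquiv ((LieAlgebra.ad ℝ e7 (ih v) ∘ₗ LieAlgebra.ad ℝ e7 (ih v)) x) (Sum.inr a) =
        -(ip v a.1 : ℝ) ^ 2 * coordEquiv x (Sum.inr a) := by
    intro x a
    have : (⁅ih v, ⁅ih v, x⁆⁆ : e7).1.coef a = ((-(ip v a.1 : ℝ) ^ 2 : ℝ) : ℂ) * x.1.coef a := by
      rw [lie_ih_coef, lie_ih_coef, ip_comm]
      push_cast
      linear_combination ((ip v a.1 : ℂ) ^ 2 * x.1.coef a) * Complex.I_sq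
    change Complex.re ((⁅ih v, ⁅ih v, x⁆⁆ : e7).1.coef a) +
      Complex.im ((⁅ih v, ⁅ih v, x⁆⁆ : e7).1.coef a) = _ * (Complex.re _ + Complex.im _)
    rw [this, Complex.re_ofReal_mul, Complex.im_ofReal_mul, mul_add]
  rw [Fintype.sum_sum_type]
  simp only [h1, h2, hb, Pi.single_eq_same, mul_one, Finset.sum_const_zero, zero_add,
    Finset.sum_neg_distrib]
  rw [sum_root_ip_sq]

/-- Each of `ih a`, `pl a 1`, `pl a I` is, up to the factor 2, a bracket of the other two, so
invariance of the Killing form carries the value at `ih a` over to `pl a 1`. -/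
theorem killing_pl (a : Root) : killingForm ℝ e7 (pl a 1) (pl a 1) = -72 := by
  have h := LieModule.traceForm_apply_lie_apply ℝ e7 e7 (pl a 1) (pl a Complex.I) (ih a.1)
  have h2 : ⁅pl a Complex.I, ih a.1⁆ = (2 : ℝ) • pl a 1 := by
    rw [← lie_skew, lie_ih_pl, a.2]
    apply ext'
    · intro i; rw [smul_val, neg_val]; simp [pl_cart]
    · intro c
      rw [smul_val, neg_val, neg_snd, rsmul_snd, pl_coef, pl_coef]
      have c2 : conj (2 : ℂ) = 2 := map_ofNat _ _
      split_ifs <;> simp [c2] <;> ring_nf <;> simp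
  rw [lie_pl_pl_I, h2, map_smul, map_smul, LinearMap.smul_apply] at h
  have h3 := killing_ih a.1
  rw [a.2] at h3
  change (2 : ℝ) • killingForm ℝ e7 (ih a.1) (ih a.1) = (2 : ℝ) • killingForm ℝ e7 (pl a 1) (pl a 1)
    at h
  rw [h3] at h
  simp at h
  linarith

theorem inner_nondegenerate : inner.Nondegenerate := by
  refine ⟨fun x hx => ?_, fun x hx => ?_⟩ <;>
  · by_contra h
    exact (inner_pos h).ne' (hx x)

theorem ext_inner {x y : e7} (h : ∀ z, inner x z = inner y z) : x = y := by
  rw [← sub_eq_zero]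
  exact inner_nondegenerate.1 _ fun z => by rw [map_sub, LinearMap.sub_apply, h, sub_self]

theorem killing_lie (x y z : e7) : killingForm ℝ e7 ⁅x, y⁆ z = -killingForm ℝ e7 y ⁅x, z⁆ := by
  have h := LieModule.traceForm_apply_lie_apply ℝ e7 e7 y x z
  rw [← lie_skew, map_neg, LinearMap.neg_apply]
  exact congrArg Neg.neg h

theorem killing_symm (x y : e7) : killingForm ℝ e7 x y = killingForm ℝ e7 y x :=
  LieModule.traceForm_comm _ _ _ _ _

/-- The Killing form is `-36` times the standard inner product, on the sum of the root spaces. -/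
theorem killing_eq {x y : e7} (hy : ∀ i, y.1.cart i = 0) :
    killingForm ℝ e7 x y = -(36 * inner x y) := by
  -- `T` represents minus the Killing form with respect to `inner`. Both forms are invariant, so `T`
  -- commutes with `ad` and is a scalar on each root space.
  let T : e7 →ₗ[ℝ] e7 :=
    (LinearMap.BilinForm.toDual inner inner_nondegenerate).symm.toLinearMap ∘ₗ (-killingForm ℝ e7)
  have hT : ∀ x y, inner (T x) y = -killingForm ℝ e7 x y := fun x y =>
    LinearMap.BilinForm.apply_toDual_symm_apply (hB := inner_nondegenerate) _ _
  obtain ⟨l, hl⟩ := exists_root_scalar T fun v x => ext_inner fun z => by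
    rw [hT, killing_lie, inner_invariant, hT]
  have hreal : ∀ a, l a = 36 := by
    intro a
    -- Symmetry, tested on `pl a 1` and `pl a I`, kills the imaginary part of the scalar; the real
    -- part comes from `killing_pl`.
    have h1 : inner (T (pl a 1)) (pl a Complex.I) = inner (T (pl a Complex.I)) (pl a 1) := by
      rw [hT, hT, killing_symm]
    have h2 : inner (T (pl a 1)) (pl a 1) = 72 := by
      rw [hT, killing_pl, neg_neg]
    rw [inner_pl, inner_pl, hl, hl, pl_coef_self, pl_coef_self] at h1
    rw [inner_pl, hl, pl_coef_self] at h2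
    simp at h1 h2
    apply Complex.ext
    · simp; linarith
    · simp; linarith
  rw [← neg_eq_iff_eq_neg, ← hT, inner_of_cart hy, inner_of_cart hy, Finset.mul_sum]
  refine Finset.sum_congr rfl fun a _ => ?_
  rw [hl, hreal, mul_assoc]
  simp

end e7

/-! ### The complement -/

open e7

theorem ih_mem_k (v : Lat) : ih v ∈ k := fun a _ => by
  change (Complex.I • hl v).coef a = 0
  simp

theorem pl_mem_k {a : Root} (ha : IsKRoot a) (z : ℂ) : pl a z ∈ k := fun c hc => by
  refine pl_coef_of_ne z ?_ ?_
  · rintro rfl; exact hc ha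
  · rintro rfl; exact hc (isKRoot_neg.2 ha)

theorem mem_p_of {x : e7} (h1 : ∀ i, x.1.cart i = 0) (h2 : ∀ a, IsKRoot a → x.1.coef a = 0) :
    x ∈ p := by
  intro y hy
  change killingForm ℝ e7 y x = 0
  rw [killing_eq h1, inner_of_cart h1, Finset.sum_eq_zero]
  · simp
  · intro a _
    by_cases ha : IsKRoot a
    · rw [h2 a ha]; simp
    · rw [hy a ha]; simp

open Classical in
/-- The part of an element of `e₇` in the sum of the root spaces outside `𝔨`. -/
noncomputable def outer (x : e7) : e7 := ⟨mk 0 (fun a => if IsKRoot a then 0 else x.1.coef a), by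
  refine ⟨fun i => by simp, fun a => ?_⟩
  simp only [mk_coef, isKRoot_neg]
  split_ifs
  · simp
  · exact x.2.2 a⟩

theorem outer_mem_p (x : e7) : outer x ∈ p :=
  mem_p_of (fun _ => rfl) fun _ ha => if_pos ha

theorem sub_outer_mem_k (x : e7) : x - outer x ∈ k := fun a ha => by
  have : (outer x).1.coef a = x.1.coef a := if_neg ha
  rw [sub_val, sub_snd, this, sub_self]

theorem projP_of_mem_p {x : e7} (hx : x ∈ p) : (projP x : e7) = x :=
  congrArg Subtype.val (Submodule.projectionOnto_apply_left isCompl ⟨x, hx⟩)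

theorem projP_of_mem_k {x : e7} (hx : x ∈ k) : projP x = 0 :=
  Submodule.projectionOnto_apply_right isCompl ⟨x, hx⟩

theorem projP_coe (x : p) : projP x = x := Subtype.ext (projP_of_mem_p x.2)

/-- The abstractly defined projection along `𝔨` is the truncation of root coefficients, so `X_𝔭` can
be computed root by root. -/
theorem coe_projP (x : e7) : (projP x : e7) = outer x := by
  have h : x = outer x + (x - outer x) := by abel
  conv_lhs => rw [h]
  rw [map_add, projP_of_mem_k (sub_outer_mem_k x), add_zero, projP_of_mem_p (outer_mem_p x)]

theorem sub_projP_mem_k (x : e7) : x - projP x ∈ k := by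
  rw [coe_projP]; exact sub_outer_mem_k x

theorem projP_coef {a : Root} (ha : ¬IsKRoot a) (x : e7) :
    (projP x : e7).1.coef a = x.1.coef a := by
  rw [coe_projP]; exact if_neg ha

theorem p_cart (x : p) (i) : x.1.1.cart i = 0 := by
  have := coe_projP x
  rw [projP_coe] at this
  rw [this]; rfl

theorem p_coef (x : p) {a : Root} (ha : IsKRoot a) : x.1.1.coef a = 0 := by
  have := coe_projP x
  rw [projP_coe] at this
  rw [this]; exact if_pos ha

theorem standard_apply (x y : p) : standard.form x y = -killingForm ℝ e7 x y := rfl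

theorem standard_eq (x y : p) : standard.form x y = 36 * inner x y := by
  rw [standard_apply, killing_eq (p_cart y), neg_neg]

/-! ### The isotropy representation -/

theorem lie_mem_p {Z x : e7} (hZ : Z ∈ k) (hx : x ∈ p) : ⁅Z, x⁆ ∈ p := by
  intro y hy
  have h : killingForm ℝ e7 ⁅Z, y⁆ x = 0 := hx _ (k.lie_mem hZ hy)
  rw [killing_lie] at h
  exact neg_eq_zero.1 h

theorem projP_lie {Z : e7} (hZ : Z ∈ k) (x : e7) : projP ⁅Z, x⁆ = adP Z (projP x) := by
  have h : ⁅Z, x⁆ = ⁅Z, (projP x : e7)⁆ + ⁅Z, x - projP x⁆ := by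
    rw [← lie_add]; congr 1; abel
  rw [h, map_add, projP_of_mem_k (k.lie_mem hZ (sub_projP_mem_k x)), add_zero, adP_apply]

theorem coe_adP {Z : e7} (hZ : Z ∈ k) (x : p) : (adP Z x : e7) = ⁅Z, (x : e7)⁆ :=
  projP_of_mem_p (lie_mem_p hZ x.2)

/-- The extension of an operator on `𝔭` by zero on `𝔨`. -/
noncomputable def extend (A : Module.End ℝ p) : e7 →ₗ[ℝ] e7 := p.subtype ∘ₗ A ∘ₗ projP

theorem extend_apply (A : Module.End ℝ p) (x : e7) : extend A x = A (projP x) := rfl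

/-- The operator `ad Z`, as a continuous linear map. -/
noncomputable def adL (Z : e7) : e7 →L[ℝ] e7 :=
  LinearMap.toContinuousLinearMap (LieAlgebra.ad ℝ e7 Z)

theorem adL_apply (Z x : e7) : adL Z x = ⁅Z, x⁆ := rfl

theorem adL_smul (t : ℝ) (Z : e7) : adL (t • Z) = t • adL Z := by
  ext1 x
  exact smul_lie t Z x

theorem exp_zero_smul_adL (Z : e7) : NormedSpace.exp ((0 : ℝ) • adL Z) = 1 := by
  have : (0 : ℝ) • adL Z = 0 := by
    rw [← adL_smul]; ext1 x
    rw [adL_apply, zero_smul, zero_lie]; rfl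
  rw [this, NormedSpace.exp_zero]

theorem exists_mem_K {Z : e7} (hZ : Z ∈ k) :
    ∃ u ∈ K, (u : e7 →L[ℝ] e7) = NormedSpace.exp (adL Z) := by
  have hu : IsUnit (NormedSpace.exp (adL Z)) :=
    NormedSpace.isUnit_exp_of_mem_ball (𝕂 := ℝ)
      ((NormedSpace.expSeries_radius_eq_top ℝ (e7 →L[ℝ] e7)).symm ▸ edist_lt_top _ _)
  obtain ⟨u, hu⟩ := hu
  exact ⟨u, Subgroup.subset_closure ⟨Z, hZ, hu⟩, hu⟩

/-- A continuous operator that commutes with `ad Z` for `Z ∈ 𝔨` commutes with `K`. -/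
theorem commute_of_mem_K (T : e7 →L[ℝ] e7) (hT : ∀ Z ∈ k, Commute T (adL Z))
    {u : (e7 →L[ℝ] e7)ˣ} (hu : u ∈ K) : Commute T (u : e7 →L[ℝ] e7) := by
  induction hu using Subgroup.closure_induction with
  | mem u hu =>
    obtain ⟨Z, hZ, h⟩ := hu
    rw [h]
    exact (hT Z hZ).exp_right
  | one => exact Commute.one_right T
  | mul u v _ _ h1 h2 => rw [Units.val_mul]; exact h1.mul_right h2
  | inv u _ h => exact h.units_inv_right

/-- Elements of `K` act on all of `e₇`, where exponentials and products make sense without knowing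
that `𝔭` is invariant; so `A` is first extended by zero on `𝔨`. -/
theorem extend_commute {A : Module.End ℝ p} (hA : ∀ Z ∈ k, adP Z ∘ₗ A = A ∘ₗ adP Z)
    {u : (e7 →L[ℝ] e7)ˣ} (hu : u ∈ K) (x : e7) :
    extend A ((u : e7 →L[ℝ] e7) x) = (u : e7 →L[ℝ] e7) (extend A x) := by
  have := commute_of_mem_K (LinearMap.toContinuousLinearMap (extend A)) (fun Z hZ => by
    ext1 x
    change extend A ⁅Z, x⁆ = ⁅Z, extend A x⁆
    rw [extend_apply, projP_lie hZ, extend_apply, ← coe_adP hZ]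
    exact congrArg _ (LinearMap.congr_fun (hA Z hZ) _).symm) hu
  exact congrArg (fun T : e7 →L[ℝ] e7 => T x) this.eq

theorem K_mem_p {u : (e7 →L[ℝ] e7)ˣ} (hu : u ∈ K) (x : p) : (u : e7 →L[ℝ] e7) x ∈ p := by
  -- The identity of `𝔭` extends to the projection onto `𝔭`; that it commutes with `u` gives the
  -- invariance of `𝔭`.
  have := extend_commute (A := LinearMap.id) (fun _ _ => rfl) hu x
  rw [extend_apply, extend_apply, projP_coe] at this
  have h : (u : e7 →L[ℝ] e7) x = (projP ((u : e7 →L[ℝ] e7) x) : e7) := this.symm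
  rw [h]
  exact Subtype.coe_prop _

theorem coe_chi {u : (e7 →L[ℝ] e7)ˣ} (hu : u ∈ K) (x : p) :
    (chi u x : e7) = (u : e7 →L[ℝ] e7) x := projP_of_mem_p (K_mem_p hu x)

theorem chi_commute_of {A : Module.End ℝ p} (hA : ∀ Z ∈ k, adP Z ∘ₗ A = A ∘ₗ adP Z)
    {u : (e7 →L[ℝ] e7)ˣ} (hu : u ∈ K) : chi u ∘ₗ A = A ∘ₗ chi u := by
  ext1 x
  apply Subtype.ext
  have := extend_commute hA hu x
  rw [extend_apply, extend_apply, projP_coe] at this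
  rw [LinearMap.comp_apply, coe_chi hu]
  exact this.symm

/-- The infinitesimal version of commuting with `Ad(K)`. -/
theorem adP_commute_of {A : Module.End ℝ p} (hA : ∀ u ∈ K, chi u ∘ₗ A = A ∘ₗ chi u)
    {Z : e7} (hZ : Z ∈ k) : adP Z ∘ₗ A = A ∘ₗ adP Z := by
  ext1 x
  -- The relation `Ad(exp tZ) A x = A Ad(exp tZ) x` is differentiated at `t = 0`.
  have hd : ∀ (y : p) (B : e7 →ₗ[ℝ] p), HasDerivAt
      (fun t : ℝ => B (NormedSpace.exp (t • adL Z) (y : e7))) (B ⁅Z, (y : e7)⁆) 0 := by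
    intro y B
    have h1 := (hasDerivAt_exp_smul_const' (𝕂 := ℝ) (adL Z) (0 : ℝ)).clm_apply
      (hasDerivAt_const (0 : ℝ) (y : e7))
    have h2 := (LinearMap.toContinuousLinearMap B).hasFDerivAt.comp_hasDerivAt (0 : ℝ) h1
    simp only [exp_zero_smul_adL] at h2
    simpa [adL_apply] using! h2
  have h1 := hd (A x) projP
  have h2 := hd x (A ∘ₗ projP)
  refine h1.unique (h2.congr_of_eventuallyEq (Filter.Eventually.of_forall fun t => ?_))
  obtain ⟨u, hu, h⟩ := exists_mem_K (k.smul_mem t hZ)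
  rw [adL_smul] at h
  have := LinearMap.congr_fun (hA u hu) x
  beta_reduce
  rw [← h]
  exact this

/-- `K` preserves the Killing form. -/
theorem killing_K {u : (e7 →L[ℝ] e7)ˣ} (hu : u ∈ K) (x y : e7) :
    killingForm ℝ e7 ((u : e7 →L[ℝ] e7) x) ((u : e7 →L[ℝ] e7) y) = killingForm ℝ e7 x y := by
  induction hu using Subgroup.closure_induction generalizing x y with
  | mem u hu =>
    obtain ⟨Z, hZ, h⟩ := hu
    let B : e7 →L[ℝ] e7 →L[ℝ] ℝ := LinearMap.toContinuousLinearMap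
      ((LinearMap.toContinuousLinearMap (𝕜 := ℝ) (E := e7) (F' := ℝ)).toLinearMap ∘ₗ
        killingForm ℝ e7)
    have hB : ∀ x y, B x y = killingForm ℝ e7 x y := fun _ _ => rfl
    -- Invariance of the Killing form makes this derivative vanish at every `t`, so the values at 0
    -- and 1 agree.
    have hd : ∀ t : ℝ, HasDerivAt (fun t : ℝ => B (NormedSpace.exp (t • adL Z) x)
        (NormedSpace.exp (t • adL Z) y)) 0 t := by
      intro t
      have h1 : ∀ y : e7, HasDerivAt (fun t : ℝ => NormedSpace.exp (t • adL Z) y)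
          (⁅Z, NormedSpace.exp (t • adL Z) y⁆) t := by
        intro y
        have h1 := (hasDerivAt_exp_smul_const' (𝕂 := ℝ) (adL Z) t).clm_apply
          (hasDerivAt_const t y)
        simpa [adL_apply] using h1
      have h2 := (B.hasFDerivAt.comp_hasDerivAt t (h1 x)).clm_apply (h1 y)
      convert! h2 using 1
      rw [hB]
      change _ = killingForm ℝ e7 _ _ + killingForm ℝ e7 _ _
      rw [killing_lie, neg_add_cancel]
    have hc := is_const_of_deriv_eq_zero (fun t => (hd t).differentiableAt)
      (fun t => (hd t).deriv) 1 0
    rw [h]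
    simp only [exp_zero_smul_adL, one_smul] at hc
    exact hc
  | one => rfl
  | mul u v _ _ h1 h2 =>
    rw [Units.val_mul]
    exact (h1 _ _).trans (h2 _ _)
  | inv u _ h =>
    have hx : ∀ x, (u : e7 →L[ℝ] e7) (((u⁻¹ : (e7 →L[ℝ] e7)ˣ) : e7 →L[ℝ] e7) x) = x := fun x =>
      congrArg (fun T : e7 →L[ℝ] e7 => T x) u.mul_inv
    rw [← h, hx, hx]

theorem chi_isometry {u : (e7 →L[ℝ] e7)ˣ} (hu : u ∈ K) (x y : p) :
    standard.form (chi u x) (chi u y) = standard.form x y := by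
  rw [standard_apply, standard_apply, coe_chi hu, coe_chi hu, killing_K hu]

theorem chi_chi_inv {u : (e7 →L[ℝ] e7)ˣ} (hu : u ∈ K) (x : p) : chi u (chi u⁻¹ x) = x := by
  apply Subtype.ext
  rw [coe_chi hu, coe_chi (K.inv_mem hu)]
  exact congrArg (fun T : e7 →L[ℝ] e7 => T x) u.mul_inv

theorem standard_isInvariant : standard.IsInvariant := fun _ hu x y => chi_isometry hu x y

/-- `K` is generated by exponentials of `𝔨`, so invariance may be tested on the Lie algebra. This is
the form in which membership in `sym(𝔭)^K` is analysed. -/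
theorem mem_symK {A : Module.End ℝ p} : A ∈ standard.symK ↔
    (∀ x y, standard.form (A x) y = standard.form x (A y)) ∧
      ∀ Z ∈ k, adP Z ∘ₗ A = A ∘ₗ adP Z :=
  and_congr_right fun _ =>
    ⟨fun h _ hZ => adP_commute_of h hZ, fun h _ hu => chi_commute_of h hu⟩

/-! ### Brackets of root vectors -/

/-- The sum of two roots with inner product `-1`. -/
def addRoot (a b : Root) (h : ip a.1 b.1 = -1) : Root := ⟨a.1 + b.1, by rw [ip_add_self, h]; rfl⟩

theorem addRoot_val (a b : Root) (h : ip a.1 b.1 = -1) : (addRoot a b h).1 = a.1 + b.1 := rfl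

/-- With `⟨a, b⟩ = -1` the vectors `±(a - b)` have squared length 6 and are not roots, so only the
brackets of total weight `±(a + b)` survive; they are conjugate because `ε` is unchanged by negating
both arguments. -/
theorem lie_pl_pl {a b : Root} (h : ip a.1 b.1 = -1) (z w : ℂ) :
    ⁅pl a z, pl b w⁆ = pl (addRoot a b h) (eps a.1 b.1 * (z * w)) := by
  have h1 : bracket (ee a.1) (ee (-b.1)) = 0 :=
    bracket_ee_zero a (-b) (by rw [Root.neg_val, ip_neg_right, h]; norm_num)
  have h2 : bracket (ee (-a.1)) (ee b.1) = 0 :=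
    bracket_ee_zero (-a) b (by rw [Root.neg_val, ip_neg_left, h]; norm_num)
  have hn : ∀ a b : Root, ip a.1 b.1 = -1 → a.1 + b.1 ≠ 0 := by
    intro a b h h0
    have := ip_add_self a b
    rw [h0, h, ip_zero_left] at this
    omega
  have h3 := bracket_ee_of_ne a b (hn a b h)
  have h' : ip (-a).1 (-b).1 = -1 := by
    rw [Root.neg_val, Root.neg_val, ip_neg_left, ip_neg_right, neg_neg, h]
  have h4 := bracket_ee_of_ne (-a) (-b) (hn _ _ h')
  rw [Root.neg_val, Root.neg_val, eps_neg_left, eps_neg_right, ← neg_add] at h4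
  apply Subtype.ext
  rw [lie_val, pl_val, pl_val, pl_val]
  simp only [bracket_add_left, bracket_add_right, bracket_smul_left, bracket_smul_right, h1, h2,
    h3, h4, addRoot_val, map_mul, smul_zero, add_zero, zero_add, smul_smul]
  have hc : conj (eps a.1 b.1 : ℂ) = eps a.1 b.1 := by
    rw [← Complex.ofReal_intCast, Complex.conj_ofReal]
  rw [hc]
  congr 2 <;> ring

theorem lie_pl_pl_zero {a b : Root} (h : ip a.1 b.1 = 0) (z w : ℂ) : ⁅pl a z, pl b w⁆ = 0 := by
  have h0 := bracket_ee_zero a b (by rw [h]; norm_num)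
  have h1 : bracket (ee a.1) (ee (-b.1)) = 0 :=
    bracket_ee_zero a (-b) (by rw [Root.neg_val, ip_neg_right, h]; norm_num)
  have h2 : bracket (ee (-a.1)) (ee b.1) = 0 :=
    bracket_ee_zero (-a) b (by rw [Root.neg_val, ip_neg_left, h]; norm_num)
  have h3 : bracket (ee (-a.1)) (ee (-b.1)) = 0 := bracket_ee_zero (-a) (-b) (by
    rw [Root.neg_val, Root.neg_val, ip_neg_left, ip_neg_right, h]; norm_num)
  apply Subtype.ext
  rw [lie_val, pl_val, pl_val]
  simp only [bracket_add_left, bracket_add_right, bracket_smul_left, bracket_smul_right, h0, h1, h2,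
    h3, smul_zero, add_zero]
  rfl

theorem pl_neg (a : Root) (z : ℂ) : pl (-a) z = pl a (conj z) := by
  apply Subtype.ext
  rw [pl_val, pl_val, Root.neg_val, neg_neg, Complex.conj_conj, add_comm]

theorem lie_pl_self_mem (a : Root) (z w : ℂ) (c : Root) : (⁅pl a z, pl a w⁆ : e7).1.coef c = 0 := by
  have h0 : bracket (ee a.1) (ee a.1) = 0 := bracket_ee_zero a a (by rw [a.2]; norm_num)
  have h1 : bracket (ee (-a.1)) (ee (-a.1)) = 0 :=
    bracket_ee_zero (-a) (-a) (by rw [(-a).2]; norm_num)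
  rw [lie_val, pl_val, pl_val]
  simp [bracket_add_left, bracket_add_right, bracket_smul_left, bracket_smul_right, h0, h1,
    bracket_neg_root, bracket_neg_root']

theorem pl_mem_p {a : Root} (ha : ¬IsKRoot a) (z : ℂ) : pl a z ∈ p :=
  mem_p_of (pl_cart a z) fun _ hc => pl_coef_of_ne z (fun h => ha (h ▸ hc))
    fun h => ha (isKRoot_neg.1 (h ▸ hc))

/-! ### Block scalar operators -/

open Classical in
/-- The value `l k` at the roots in `delta k`, and zero at the roots `±βⱼ`. -/
noncomputable def wt (l : Fin 7 → ℝ) (a : Root) : ℝ := ∑ k, if a ∈ delta k then l k else 0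

theorem wt_of_mem (l : Fin 7 → ℝ) {a : Root} {k} (ha : a ∈ delta k) : wt l a = l k := by
  classical
  rw [wt, Finset.sum_eq_single k]
  · rw [if_pos ha]
  · exact fun i _ hi => if_neg fun h => hi (delta_unique h ha)
  · simp

theorem wt_of_isKRoot (l : Fin 7 → ℝ) {a : Root} (ha : IsKRoot a) : wt l a = 0 := by
  classical
  exact Finset.sum_eq_zero fun k _ => if_neg fun h => not_isKRoot_of_mem_delta h ha

theorem wt_neg (l : Fin 7 → ℝ) (a : Root) : wt l (-a) = wt l a := by
  classical
  exact Finset.sum_congr rfl fun k _ => if_congr neg_mem_delta rfl rfl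

/-- A root `±βⱼ` has even pairing with every `βᵢ`, so adding it changes no parity. This is why `𝔨`
preserves the blocks. -/
theorem mem_delta_iff_of_add {a b c : Root} (ha : IsKRoot a) (h : a.1 + b.1 = c.1) (k) :
    b ∈ delta k ↔ c ∈ delta k := by
  have hodd : ∀ j, Odd (nb b.1 j) ↔ Odd (nb c.1 j) := by
    intro j
    have he : Even (nb a.1 j) := by
      obtain ⟨i, hi | hi⟩ := ha <;> rw [hi] <;> simp only [nb_neg, nb_beta, even_neg] <;>
        split_ifs <;> decide
    rw [← h, nb_add, Int.odd_add', iff_true_right he]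
  constructor <;> intro hm <;> apply mem_delta_of_odd <;> intro j
  · rw [← hodd]; exact odd_nb_of_mem_delta hm j
  · rw [hodd]; exact odd_nb_of_mem_delta hm j

theorem wt_of_add (l : Fin 7 → ℝ) {a b c : Root} (ha : IsKRoot a) (h : a.1 + b.1 = c.1) :
    wt l b = wt l c := by
  classical
  exact Finset.sum_congr rfl fun k _ => if_congr (mem_delta_iff_of_add ha h k) rfl rfl

theorem p_ext {x y : p} (h : ∀ a, ¬IsKRoot a → x.1.1.coef a = y.1.1.coef a) : x = y := by
  apply Subtype.ext
  apply e7.ext'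
  · intro i; rw [p_cart, p_cart]
  · intro a
    by_cases ha : IsKRoot a
    · rw [p_coef x ha, p_coef y ha]
    · exact h a ha

/-- The operator on `𝔭` that is multiplication by `l k` on `𝔭ₖ`. -/
noncomputable def blockScalar : (Fin 7 → ℝ) →ₗ[ℝ] Module.End ℝ p :=
  LinearMap.mk₂ ℝ (fun l x => ⟨⟨mk 0 (fun a => (wt l a : ℂ) * x.1.1.coef a), by
      refine ⟨fun i => by simp, fun a => ?_⟩
      simp only [mk_coef, wt_neg, map_mul, Complex.conj_ofReal]
      rw [x.1.2.2]⟩, mem_p_of (fun _ => rfl) fun a ha => by simp [p_coef x ha]⟩)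
    (fun l m x => p_ext fun a _ => by
      change ((wt (l + m) a : ℝ) : ℂ) * x.1.1.coef a =
        (wt l a : ℂ) * x.1.1.coef a + (wt m a : ℂ) * x.1.1.coef a
      rw [← add_mul]; congr 1
      simp [wt, ite_add_zero, Finset.sum_add_distrib])
    (fun c l x => p_ext fun a _ => by
      change ((wt (c • l) a : ℝ) : ℂ) * x.1.1.coef a = (c : ℂ) * ((wt l a : ℂ) * x.1.1.coef a)
      rw [← mul_assoc]; congr 1
      rw [← Complex.ofReal_mul]
      simp [wt, Finset.mul_sum])
    (fun l x y => p_ext fun a _ => mul_add _ _ _)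
    (fun c l x => p_ext fun a _ => mul_left_comm _ _ _)

theorem blockScalar_coef (l : Fin 7 → ℝ) (x : p) (a : Root) :
    (blockScalar l x).1.1.coef a = wt l a * x.1.1.coef a := rfl

theorem standard_coef (x y : p) :
    standard.form x y = 36 * ∑ a, (x.1.1.coef a * conj (y.1.1.coef a)).re := by
  rw [standard_eq, inner_of_cart (p_cart y)]

theorem blockScalar_symm (l : Fin 7 → ℝ) (x y : p) :
    standard.form (blockScalar l x) y = standard.form x (blockScalar l y) := by
  rw [standard_coef, standard_coef]
  congr 1
  refine Finset.sum_congr rfl fun a _ => ?_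
  rw [blockScalar_coef, blockScalar_coef, map_mul, Complex.conj_ofReal]
  congr 1; ring

theorem blockScalar_commute (l : Fin 7 → ℝ) {Z : e7} (hZ : Z ∈ k) :
    adP Z ∘ₗ blockScalar l = blockScalar l ∘ₗ adP Z := by
  ext1 x
  apply p_ext
  intro c hc
  have hp : ∀ (x : p) v, pair v x.1.1.cart = 0 := by intro x v; simp [pair, p_cart]
  rw [LinearMap.comp_apply, LinearMap.comp_apply, blockScalar_coef, coe_adP hZ, coe_adP hZ, lie_val,
    lie_val, bracket_snd, bracket_snd, hp, hp, blockScalar_coef, mul_add, Finset.mul_sum]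
  congr 1
  · ring
  · refine Finset.sum_congr rfl fun a _ => ?_
    rw [Finset.mul_sum]
    refine Finset.sum_congr rfl fun b _ => ?_
    rw [mul_ite, mul_zero]
    split_ifs with h
    swap
    · rfl
    rw [blockScalar_coef]
    by_cases ha : IsKRoot a
    · rw [wt_of_add l ha h]; ring
    · rw [hZ a ha]; ring

theorem blockScalar_mem (l : Fin 7 → ℝ) : blockScalar l ∈ standard.symK :=
  mem_symK.2 ⟨blockScalar_symm l, fun _ hZ => blockScalar_commute l hZ⟩

/-- Two roots of the same block differ only in signs of their pairings, and the reflection at `βⱼ`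
repairs one sign; the induction is on the number of wrong signs. -/
theorem eq_of_refl_invariant {f : Root → ℂ} (hf : ∀ a j, ¬IsKRoot a → f (refl j a) = f a) {k}
    {a b : Root} (ha : a ∈ delta k) (hb : b ∈ delta k) : f a = f b := by
  have : ∀ n, ∀ a ∈ delta k, (Finset.univ.filter fun j => nb a.1 j ≠ nb b.1 j).card = n →
      f a = f b := by
    intro n
    induction n with
    | zero =>
      intro a _ h
      rw [Finset.card_eq_zero, Finset.filter_eq_empty_iff] at h
      congr 1
      exact Subtype.ext (nb_injective fun j => not_not.1 (h (Finset.mem_univ j)))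
    | succ n ih =>
      intro a ha h
      obtain ⟨j, hj⟩ := Finset.card_pos.1 (by rw [h]; omega : 0 < _)
      have hj' : nb a.1 j ≠ nb b.1 j := by simpa using hj
      rw [← hf a j (not_isKRoot_of_mem_delta ha)]
      refine ih _ (refl_mem_delta.2 ha) ?_
      have he : (Finset.univ.filter fun i => nb (refl j a).1 i ≠ nb b.1 i) =
          (Finset.univ.filter fun i => nb a.1 i ≠ nb b.1 i).erase j := by
        ext i
        simp only [Finset.mem_filter, Finset.mem_univ, true_and, Finset.mem_erase, nb_refl]
        by_cases hi : i = j
        · subst hi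
          have h1 := nb_mem (not_isKRoot_of_mem_delta ha) i
          have h2 := nb_mem (not_isKRoot_of_mem_delta hb) i
          have h3 : nb a.1 i ≠ 0 ↔ nb b.1 i ≠ 0 := (ha i).trans (hb i).symm
          simp only [if_true, ne_eq, not_true, false_and, iff_false, not_not]
          omega
        · simp [hi]
      rw [he, Finset.card_erase_of_mem hj, h]
      rfl
  exact this _ a ha rfl

/-- Schur's lemma: the operators in `sym(𝔭)^K` are scalar on each of the seven summands. -/
theorem exists_eq_blockScalar {A : Module.End ℝ p} (hA : A ∈ standard.symK) :
    ∃ l, A = blockScalar l := by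
  obtain ⟨hs, hc⟩ := mem_symK.1 hA
  have hext : ∀ {Z : e7}, Z ∈ k → ∀ x, extend A ⁅Z, x⁆ = ⁅Z, extend A x⁆ := by
    intro Z hZ x
    rw [extend_apply, extend_apply, projP_lie hZ, ← coe_adP hZ]
    exact congrArg _ (LinearMap.congr_fun (hc Z hZ) _).symm
  obtain ⟨f, hf⟩ := exists_root_scalar (extend A) fun v x => hext (ih_mem_k v) x
  have hfA : ∀ (x : p) a, (A x).1.1.coef a = f a * x.1.1.coef a := by
    intro x a
    have := hf x a
    rwa [extend_apply, projP_coe] at this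
  -- Self-adjointness, tested on `pl a 1` and `pl a I`, forces the scalar to be real.
  have him : ∀ a, ¬IsKRoot a → (f a).im = 0 := by
    intro a ha
    have h := hs ⟨pl a 1, pl_mem_p ha 1⟩ ⟨pl a Complex.I, pl_mem_p ha Complex.I⟩
    rw [standard.symm _ (A _), standard_eq, standard_eq, inner_pl, inner_pl, hfA, hfA,
      pl_coef_self, pl_coef_self] at h
    simp at h
    linarith
  have hreal : ∀ a, ¬IsKRoot a → f a = ((f a).re : ℂ) := fun a ha => by
    apply Complex.ext
    · simp
    · simp [him a ha]
  -- Here `a + βⱼ` is the reflected root, and the bracket with `pl βⱼ 1` carries the root vector of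
  -- `a` to a nonzero multiple of that of `a + βⱼ`; commuting with this bracket equates the two
  -- scalars.
  have hstep : ∀ a j, ¬IsKRoot a → nb a.1 j = -1 → f (refl j a) = f a := by
    intro a j ha hj
    have hip : ip (betaRoot j).1 a.1 = -1 := by rw [ip_comm]; exact hj
    have hx : A ⟨pl a 1, pl_mem_p ha 1⟩ = (f a).re • (⟨pl a 1, pl_mem_p ha 1⟩ : p) := by
      apply p_ext
      intro c _
      rw [hfA]
      change f c * (pl a 1).1.coef c = ((f a).re : ℂ) * (pl a 1).1.coef c
      by_cases h1 : c = a
      · rw [h1, ← hreal a ha]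
      by_cases h2 : c = -a
      · have h3 := (A ⟨pl a 1, pl_mem_p ha 1⟩).1.2.2 a
        rw [hfA, hfA] at h3
        change f (-a) * (pl a 1).1.coef (-a) = conj (f a * (pl a 1).1.coef a) at h3
        rw [h2, h3, map_mul, (pl a 1).2.2 a, hreal a ha, Complex.conj_ofReal]
        simp
      · rw [pl_coef_of_ne 1 h1 h2, mul_zero, mul_zero]
    have h1 := hext (pl_mem_k (isKRoot_betaRoot j) 1) (pl a 1)
    have h2 : extend A (pl a 1) = (f a).re • pl a 1 := by
      rw [extend_apply]
      have : projP (pl a 1) = ⟨pl a 1, pl_mem_p ha 1⟩ := projP_coe ⟨pl a 1, pl_mem_p ha 1⟩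
      rw [this, hx]; rfl
    have h3 := congrArg (fun z : e7 => z.1.coef (addRoot (betaRoot j) a hip)) h1
    simp only [hf, h2, lie_smul, lie_pl_pl hip, smul_val, rsmul_snd, pl_coef_self] at h3
    have hrefl : refl j a = addRoot (betaRoot j) a hip := by
      apply Subtype.ext
      rw [refl_val, addRoot_val, hj]
      simp [betaRoot, add_comm]
    have hne : (eps (betaRoot j).1 a.1 : ℂ) ≠ 0 := by
      intro h0
      have := eps_mul_self (betaRoot j).1 a.1
      have h0' : eps (betaRoot j).1 a.1 = 0 := by exact_mod_cast h0
      rw [h0'] at this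
      omega
    rw [hrefl, hreal a ha]
    exact mul_right_cancel₀ (mul_ne_zero hne (by norm_num : (1 * 1 : ℂ) ≠ 0)) h3
  have hrefl : ∀ a j, ¬IsKRoot a → f (refl j a) = f a := by
    intro a j ha
    rcases nb_mem ha j with h | h | h
    · exact hstep a j ha h
    · congr 1
      apply Subtype.ext
      rw [refl_val, h]; simp
    · have hk : ¬IsKRoot (refl j a) := by
        obtain ⟨k, hk⟩ := exists_mem_delta ha
        exact not_isKRoot_of_mem_delta (refl_mem_delta.2 hk)
      have := hstep (refl j a) j hk (by rw [nb_refl, if_pos rfl, h])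
      rw [refl_refl] at this
      exact this.symm
  refine ⟨fun k => (f (deltaEquiv k fun _ => true).1).re, LinearMap.ext fun x => p_ext fun a ha => ?_⟩
  obtain ⟨k, hk⟩ := exists_mem_delta ha
  have h1 := eq_of_refl_invariant hrefl hk (deltaEquiv k fun _ => true).2
  rw [blockScalar_coef, wt_of_mem _ hk, hfA, ← h1, ← hreal a ha]

/-! ### The isotropy summands -/

theorem mem_summand {x : p} {k} : x ∈ summand k ↔ ∀ a ∉ delta k, x.1.1.coef a = 0 :=
  ⟨fun h => h.2, fun h => ⟨p_cart x, h⟩⟩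

theorem blockScalar_of_mem (l : Fin 7 → ℝ) {x : p} {k} (hx : x ∈ summand k) :
    blockScalar l x = l k • x := by
  apply p_ext
  intro a _
  rw [blockScalar_coef]
  change _ = (l k : ℂ) * x.1.1.coef a
  by_cases ha : a ∈ delta k
  · rw [wt_of_mem l ha]
  · rw [mem_summand.1 hx a ha, mul_zero, mul_zero]

/-- The projection onto a summand. -/
noncomputable def blockProj (k : Fin 7) : Module.End ℝ p := blockScalar (Pi.single k 1)

theorem blockProj_of_mem {x : p} {k} (hx : x ∈ summand k) : blockProj k x = x := by
  rw [blockProj, blockScalar_of_mem _ hx, Pi.single_eq_same, one_smul]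

theorem blockProj_of_mem_ne {x : p} {i k} (hx : x ∈ summand i) (h : i ≠ k) :
    blockProj k x = 0 := by
  rw [blockProj, blockScalar_of_mem _ hx, Pi.single_eq_of_ne h, zero_smul]

theorem blockProj_mem (k) (x : p) : blockProj k x ∈ summand k := by
  rw [mem_summand]
  intro a ha
  rw [blockProj, blockScalar_coef]
  by_cases hk : IsKRoot a
  · rw [wt_of_isKRoot _ hk]; simp
  · obtain ⟨i, hi⟩ := exists_mem_delta hk
    have : i ≠ k := fun h => ha (h ▸ hi)
    rw [wt_of_mem _ hi, Pi.single_eq_of_ne this]; simp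

theorem blockScalar_one : blockScalar 1 = LinearMap.id := by
  ext1 x
  apply p_ext
  intro a ha
  obtain ⟨i, hi⟩ := exists_mem_delta ha
  rw [blockScalar_coef, wt_of_mem _ hi]; simp

theorem sum_blockProj (x : p) : ∑ k, blockProj k x = x := by
  have h : ∑ k, blockProj k = blockScalar 1 := by
    simp only [blockProj, ← map_sum]
    congr 1
    funext i
    simp
  have := LinearMap.congr_fun h x
  rw [LinearMap.sum_apply, blockScalar_one] at this
  exact this

theorem summand_isInternal : DirectSum.IsInternal summand := by
  rw [DirectSum.isInternal_submodule_iff_iSupIndep_and_iSup_eq_top]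
  constructor
  · intro i
    rw [Submodule.disjoint_def]
    intro x hx hx'
    have h : ⨆ j, ⨆ (_ : j ≠ i), summand j ≤ LinearMap.ker (blockProj i) :=
      iSup₂_le fun j hj y hy => blockProj_of_mem_ne hy hj
    rw [← blockProj_of_mem hx]
    exact h hx'
  · rw [eq_top_iff]
    intro x _
    rw [← sum_blockProj x]
    exact Submodule.sum_mem _ fun k _ => Submodule.mem_iSup_of_mem k (blockProj_mem k x)

theorem summand_orthogonal {i j} (hij : i ≠ j) {x y : p} (hx : x ∈ summand i)
    (hy : y ∈ summand j) : standard.form x y = 0 := by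
  rw [← blockProj_of_mem hx, blockProj, blockScalar_symm]
  have := blockProj_of_mem_ne hy hij.symm
  rw [blockProj] at this
  rw [this, map_zero]

theorem isoInvariant_summand (k) : IsoInvariant (summand k) := by
  intro u hu x hx
  have := LinearMap.congr_fun ((blockScalar_mem (Pi.single k 1)).2 u hu) x
  rw [LinearMap.comp_apply, LinearMap.comp_apply] at this
  change chi u (blockProj k x) = blockProj k (chi u x) at this
  rw [blockProj_of_mem hx] at this
  rw [this]
  exact blockProj_mem _ _

/-! ### An orthonormal basis of `𝔭`, traces and contractions -/

/-- A root outside `𝔨`. -/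
abbrev PRoot : Type := {a : Root // ¬IsKRoot a}

noncomputable instance : Fintype PRoot := Fintype.ofFinite _

noncomputable instance : DecidableEq PRoot := Classical.decEq _

/-- The `g_B`-orthonormal basis of `𝔭` of the vectors `(ω eₐ + conj ω e₋ₐ) / 6`, with
`ω = (1 + i) / 2`. -/
noncomputable def onb (a : PRoot) : p := ⟨pl a.1 ((1 + Complex.I) / 12), pl_mem_p a.2 _⟩

/-- The phase `1 + i` makes the pairing read off `re + im` of the coefficient at `a`, and `re - im`
at `-a`. So `a` and `-a` give orthogonal vectors, and the basis is indexed by all roots outside `𝔨`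
with no choice of signs. -/
theorem form_onb (x : p) (a : PRoot) :
    standard.form x (onb a) = 6 * ((x.1.1.coef a.1).re + (x.1.1.coef a.1).im) := by
  rw [standard_eq, onb, inner_pl]
  have h : ((1 + Complex.I) / 12 : ℂ) = ⟨1 / 12, 1 / 12⟩ := by
    apply Complex.ext <;> simp
  rw [h]
  simp only [Complex.mul_re, Complex.conj_re, Complex.conj_im]
  ring

theorem form_onb_onb (a b : PRoot) : standard.form (onb a) (onb b) = if a = b then 1 else 0 := by
  rw [form_onb]
  have hz : ((1 + Complex.I) / 12 : ℂ) = ⟨1 / 12, 1 / 12⟩ := by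
    apply Complex.ext <;> simp
  by_cases h : a = b
  · subst h
    rw [onb, if_pos rfl, pl_coef_self, hz]
    norm_num
  · have h1 : b.1 ≠ a.1 := fun h' => h (Subtype.ext h'.symm)
    rw [if_neg h]
    change 6 * (((pl a.1 ((1 + Complex.I) / 12)).1.coef b.1).re +
      ((pl a.1 ((1 + Complex.I) / 12)).1.coef b.1).im) = 0
    rw [hz]
    by_cases h2 : b.1 = -a.1
    · classical
      rw [h2, pl_coef, if_neg (root_ne_neg _).symm, if_pos rfl]
      simp
    · rw [pl_coef_of_ne _ h1 h2]; simp

theorem sum_coef {ι : Type*} (s : Finset ι) (f : ι → p) (c : Root) :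
    (∑ a ∈ s, f a).1.1.coef c = ∑ a ∈ s, (f a).1.1.coef c := by
  classical
  induction s using Finset.induction_on with
  | empty => rfl
  | insert a s ha ih => rw [Finset.sum_insert ha, Finset.sum_insert ha, ← ih]; rfl

/-- The negative of a root outside `𝔨`. -/
def PRoot.neg (a : PRoot) : PRoot := ⟨-a.1, fun h => a.2 (isKRoot_neg.1 h)⟩

theorem sum_form_smul_onb (x : p) : ∑ a, standard.form x (onb a) • onb a = x := by
  classical
  apply p_ext
  intro c hc
  have h : ∀ a : PRoot, (standard.form x (onb a) • onb a).1.1.coef c =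
      (if a = ⟨c, hc⟩ then ((standard.form x (onb a) : ℝ) : ℂ) * ((1 + Complex.I) / 12) else 0) +
      if a = PRoot.neg ⟨c, hc⟩ then
        ((standard.form x (onb a) : ℝ) : ℂ) * conj ((1 + Complex.I) / 12) else 0 := by
    intro a
    have h1 : a = ⟨c, hc⟩ ↔ c = a.1 := by rw [Subtype.ext_iff, eq_comm]
    have h2 : a = PRoot.neg ⟨c, hc⟩ ↔ c = -a.1 := by
      rw [Subtype.ext_iff, PRoot.neg, eq_comm]; exact neg_eq_iff_eq_neg
    change ((standard.form x (onb a) : ℝ) : ℂ) * (pl a.1 _).1.coef c = _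
    rw [pl_coef, mul_add]
    simp only [h1, h2, mul_ite, mul_zero]
  rw [sum_coef, Finset.sum_congr rfl fun a _ => h a, Finset.sum_add_distrib, Finset.sum_ite_eq',
    Finset.sum_ite_eq', if_pos (Finset.mem_univ _), if_pos (Finset.mem_univ _), form_onb, form_onb]
  have h3 : x.1.1.coef (PRoot.neg ⟨c, hc⟩).1 = conj (x.1.1.coef c) := x.1.2.2 c
  have hz : ((1 + Complex.I) / 12 : ℂ) = ⟨1 / 12, 1 / 12⟩ := by
    apply Complex.ext <;> simp
  rw [h3, hz]
  apply Complex.ext <;> simp <;> ring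

theorem onb_ext {x y : p} (h : ∀ a, standard.form x (onb a) = standard.form y (onb a)) : x = y := by
  rw [← sum_form_smul_onb x, ← sum_form_smul_onb y]
  simp only [h]

theorem linearIndependent_of_orthonormal {ι : Type*} {X : ι → p} [DecidableEq ι]
    (h : ∀ a b, standard.form (X a) (X b) = if a = b then 1 else 0) : LinearIndependent ℝ X := by
  rw [linearIndependent_iff']
  intro s g hg a ha
  have := congrArg (fun x => standard.form x (X a)) hg
  simpa [map_sum, LinearMap.sum_apply, h, ha] using this

/-- The vectors `onb` as a basis. -/
noncomputable def onbBasis : Basis PRoot ℝ p :=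
  Basis.mk (linearIndependent_of_orthonormal form_onb_onb) (by
    intro x _
    rw [← sum_form_smul_onb x]
    exact Submodule.sum_mem _ fun a _ => Submodule.smul_mem _ _ (Submodule.subset_span ⟨a, rfl⟩))

theorem onbBasis_apply (a) : onbBasis a = onb a := Basis.mk_apply _ _ _

theorem onbBasis_repr (x : p) (a) : onbBasis.repr x a = standard.form x (onb a) := by
  conv_rhs => rw [← onbBasis.sum_repr x]
  simp [onbBasis_apply, form_onb_onb]

theorem trace_eq (T : Module.End ℝ p) :
    LinearMap.trace ℝ p T = ∑ a, standard.form (T (onb a)) (onb a) := by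
  rw [LinearMap.trace_eq_matrix_trace ℝ onbBasis, Matrix.trace]
  refine Finset.sum_congr rfl fun a _ => ?_
  rw [Matrix.diag_apply, LinearMap.toMatrix_apply, onbBasis_repr, onbBasis_apply]

/-- For bilinear `F` the contraction of a basis with its dual basis does not depend on the basis;
all later contractions are evaluated on `onb`. -/
theorem contract_eq {W : Type} [AddCommGroup W] [Module ℝ W] (F : p →ₗ[ℝ] p →ₗ[ℝ] W) :
    standard.contract (fun X Y => F X Y) = ∑ a, F (onb a) (onb a) := by
  have h1 : ∀ a, ∑ i, standard.form (finBasis ℝ p i) (onb a) •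
      standard.sharp ((finBasis ℝ p).coord i) = onb a := by
    intro a
    refine standard.ext_form fun z => ?_
    conv_rhs => rw [← (finBasis ℝ p).sum_repr z]
    simp only [map_sum, LinearMap.sum_apply, map_smul, LinearMap.smul_apply, standard.form_sharp,
      smul_eq_mul, Basis.coord_apply]
    exact Finset.sum_congr rfl fun i _ => by rw [standard.symm, mul_comm]
  have h2 : ∀ i, F (finBasis ℝ p i) (standard.sharp ((finBasis ℝ p).coord i)) =
      ∑ a, standard.form (finBasis ℝ p i) (onb a) •
        F (onb a) (standard.sharp ((finBasis ℝ p).coord i)) := by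
    intro i
    conv_lhs => rw [← sum_form_smul_onb (finBasis ℝ p i)]
    simp only [map_sum, LinearMap.sum_apply, map_smul, LinearMap.smul_apply]
  rw [PosForm.contract, Finset.sum_congr rfl fun i _ => h2 i, Finset.sum_comm]
  refine Finset.sum_congr rfl fun a _ => ?_
  conv_rhs => arg 2; rw [← h1 a]
  simp only [map_sum, map_smul]

/-- The root vectors in `delta k`, as members of the orthonormal basis. -/
noncomputable def onbDelta (k : Fin 7) (a : delta k) : p :=
  onb ⟨a.1, not_isKRoot_of_mem_delta a.2⟩

theorem onb_mem_summand {a : PRoot} {k} (ha : a.1 ∈ delta k) : onb a ∈ summand k :=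
  mem_summand.2 fun _ hc => pl_coef_of_ne _ (fun h => hc (h ▸ ha))
    fun h => hc (h ▸ neg_mem_delta.2 ha)

open Classical in
theorem form_onbDelta (k) (a b : delta k) :
    standard.form (onbDelta k a) (onbDelta k b) = if a = b then 1 else 0 := by
  rw [onbDelta, onbDelta, form_onb_onb]
  simp only [Subtype.ext_iff]

theorem span_onbDelta (k) : Submodule.span ℝ (Set.range (onbDelta k)) = summand k := by
  apply le_antisymm
  · rw [Submodule.span_le]
    rintro _ ⟨a, rfl⟩
    exact onb_mem_summand a.2
  · intro x hx
    rw [← sum_form_smul_onb x]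
    refine Submodule.sum_mem _ fun a _ => ?_
    by_cases ha : a.1 ∈ delta k
    · exact Submodule.smul_mem _ _ (Submodule.subset_span ⟨⟨a.1, ha⟩, rfl⟩)
    · rw [form_onb, mem_summand.1 hx _ ha]
      simp

theorem finrank_summand (k) : finrank ℝ (summand k) = 16 := by
  classical
  rw [← span_onbDelta, finrank_span_eq_card (linearIndependent_of_orthonormal (form_onbDelta k)),
    card_delta]

theorem summand_ne_bot (k) : summand k ≠ ⊥ := by
  intro h
  have := finrank_summand k
  rw [h, finrank_bot] at this
  omega

/-! ### Irreducibility and inequivalence -/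

/-- The orthogonal projection `A` onto an invariant subspace `V` lies in `sym(𝔭)^K`, hence is a
scalar on the block. A nonzero vector of `V` shows that this scalar is 1, so `V` is the whole block.
-/
theorem isoIrreducible_summand (k) : IsoIrreducible (summand k) := by
  refine ⟨isoInvariant_summand k, summand_ne_bot k, fun V hV hinv => ?_⟩
  have hr : standard.form.IsRefl := fun x y h => by rw [standard.symm]; exact h
  have hcompl : IsCompl V (standard.form.orthogonal V) := by
    refine (LinearMap.BilinForm.isCompl_orthogonal_iff_disjoint hr).2 ?_
    rw [Submodule.disjoint_def]
    intro x hx hx'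
    by_contra h
    exact (standard.pos x h).ne' (hx' x hx)
  have horth : ∀ v ∈ V, ∀ w ∈ standard.form.orthogonal V, standard.form v w = 0 :=
    fun v hv w hw => hw v hv
  let A : Module.End ℝ p := V.subtype ∘ₗ V.projectionOnto _ hcompl
  have hAV : ∀ v ∈ V, A v = v := fun v hv =>
    congrArg Subtype.val (Submodule.projectionOnto_apply_left hcompl ⟨v, hv⟩)
  have hAW : ∀ w ∈ standard.form.orthogonal V, A w = 0 := fun w hw =>
    congrArg Subtype.val (Submodule.projectionOnto_apply_right hcompl ⟨w, hw⟩)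
  have hdec : ∀ x : p, ∃ v ∈ V, ∃ w ∈ standard.form.orthogonal V, v + w = x := fun x =>
    Submodule.mem_sup.1 (hcompl.sup_eq_top ▸ Submodule.mem_top)
  have hmem : A ∈ standard.symK := by
    constructor
    · intro x y
      obtain ⟨v, hv, w, hw, rfl⟩ := hdec x
      obtain ⟨v', hv', w', hw', rfl⟩ := hdec y
      simp only [map_add, LinearMap.add_apply, hAV v hv, hAV v' hv', hAW w hw, hAW w' hw',
        add_zero, horth v hv w' hw', standard.symm w v',
        horth v' hv' w hw]
    · intro u hu
      ext1 x
      obtain ⟨v, hv, w, hw, rfl⟩ := hdec x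
      have hw' : chi u w ∈ standard.form.orthogonal V := by
        intro v' hv'
        change standard.form v' (chi u w) = 0
        rw [← chi_chi_inv hu v', chi_isometry hu]
        exact horth _ (hinv _ (K.inv_mem hu) _ hv') _ hw
      simp only [LinearMap.comp_apply, map_add, hAV v hv, hAW w hw, hAV _ (hinv u hu v hv),
        hAW _ hw', map_zero]
  obtain ⟨l, hl⟩ := exists_eq_blockScalar hmem
  by_cases hbot : V = ⊥
  · exact Or.inl hbot
  right
  refine le_antisymm hV fun x hx => ?_
  obtain ⟨v, hv, hv0⟩ := Submodule.exists_mem_ne_zero_of_ne_bot hbot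
  have h1 := hAV v hv
  rw [hl, blockScalar_of_mem l (hV hv)] at h1
  have hlk : l k = 1 := by
    have : (l k - 1) • v = 0 := by rw [sub_smul, h1, one_smul, sub_self]
    linarith [(smul_eq_zero.1 this).resolve_right hv0]
  have h2 : A x = x := by rw [hl, blockScalar_of_mem l hx, hlk, one_smul]
  rw [← h2]
  exact Subtype.coe_prop _

/-- An intertwiner commutes with the torus, so it cannot move a vector to other root spaces: the
image of block `i` would lie in blocks `i` and `j` at once. Only the torus is used, since the
extended operator `A` is not self-adjoint and the Schur lemma for `symK` does not apply to it. -/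
theorem not_isoEquivalent {i j} (hij : i ≠ j) : ¬IsoEquivalent (summand i) (summand j) := by
  rintro ⟨f, hf⟩
  let pi : p →ₗ[ℝ] summand i := (blockProj i).codRestrict _ (blockProj_mem i)
  let A : Module.End ℝ p := (summand j).subtype ∘ₗ f.toLinearMap ∘ₗ pi
  have hA : ∀ u ∈ K, chi u ∘ₗ A = A ∘ₗ chi u := by
    intro u hu
    ext1 x
    have h := LinearMap.congr_fun ((blockScalar_mem (Pi.single i 1)).2 u hu) x
    exact hf u hu (pi x) (pi (chi u x)) h
  obtain ⟨l, hl⟩ := exists_root_scalar (extend A) fun v x => by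
    rw [extend_apply, extend_apply, projP_lie (ih_mem_k v), ← coe_adP (ih_mem_k v)]
    exact congrArg _ (LinearMap.congr_fun (adP_commute_of hA (ih_mem_k v)) _).symm
  obtain ⟨x, hx, hx0⟩ := Submodule.exists_mem_ne_zero_of_ne_bot (summand_ne_bot i)
  have hpi : pi x = ⟨x, hx⟩ := Subtype.ext (blockProj_of_mem hx)
  have hAx : A x = f ⟨x, hx⟩ := by
    change ((f (pi x) : summand j) : p) = _
    rw [hpi]
  have hmi : A x ∈ summand i := by
    rw [mem_summand]
    intro a ha
    have h := hl x a
    rw [extend_apply, projP_coe, mem_summand.1 hx a ha, mul_zero] at h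
    exact h
  have hmj : A x ∈ summand j := by rw [hAx]; exact Subtype.coe_prop _
  have h0 : A x = 0 := by
    rw [← blockProj_of_mem hmi]; exact blockProj_of_mem_ne hmj hij.symm
  rw [hAx] at h0
  have h1 : f ⟨x, hx⟩ = 0 := Subtype.ext h0
  have h2 : (⟨x, hx⟩ : summand i) = 0 := f.map_eq_zero_iff.1 h1
  exact hx0 (congrArg Subtype.val h2)

/-! ### The structural constants -/

theorem neg_killing_lie (x : e7) (z : p) : -killingForm ℝ e7 x z = standard.form (projP x) z := by
  rw [standard_apply]
  have h : killingForm ℝ e7 (x - projP x) z = 0 := z.2 _ (sub_projP_mem_k x)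
  rw [map_sub, LinearMap.sub_apply, sub_eq_zero] at h
  rw [h]

theorem form_expand_of_mem_span {ι : Type*} [Fintype ι] [DecidableEq ι] {X : ι → p}
    (hX : ∀ a b, standard.form (X a) (X b) = if a = b then 1 else 0) {x : p}
    (hx : x ∈ Submodule.span ℝ (Set.range X)) : ∑ a, standard.form x (X a) • X a = x := by
  induction hx using Submodule.span_induction with
  | mem x hx =>
    obtain ⟨b, rfl⟩ := hx
    simp [hX]
  | zero => simp
  | add x y _ _ h1 h2 =>
    simp only [map_add, LinearMap.add_apply, add_smul, Finset.sum_add_distrib, h1, h2]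
  | smul c x _ h =>
    simp only [map_smul, LinearMap.smul_apply, smul_assoc, ← Finset.smul_sum, h]

/-- The sum of the squares of a linear form over an orthonormal basis of a subspace. -/
theorem sum_sq_eq {ι κ : Type*} [Fintype ι] [Fintype κ] [DecidableEq ι] [DecidableEq κ]
    {X : ι → p} {Y : κ → p}
    (hX : ∀ a b, standard.form (X a) (X b) = if a = b then 1 else 0)
    (hY : ∀ a b, standard.form (Y a) (Y b) = if a = b then 1 else 0)
    (h : Submodule.span ℝ (Set.range X) = Submodule.span ℝ (Set.range Y)) (f : p →ₗ[ℝ] ℝ) :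
    ∑ a, f (X a) ^ 2 = ∑ b, f (Y b) ^ 2 := by
  have h1 : ∀ a, f (X a) = ∑ b, standard.form (X a) (Y b) * f (Y b) := by
    intro a
    have : X a ∈ Submodule.span ℝ (Set.range Y) := h ▸ Submodule.subset_span ⟨a, rfl⟩
    conv_lhs => rw [← form_expand_of_mem_span hY this]
    simp [map_sum]
  have h2 : ∀ b, f (Y b) = ∑ a, standard.form (X a) (Y b) * f (X a) := by
    intro b
    have : Y b ∈ Submodule.span ℝ (Set.range X) := h ▸ Submodule.subset_span ⟨b, rfl⟩
    conv_lhs => rw [← form_expand_of_mem_span hX this]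
    simp [map_sum, standard.symm (Y b)]
  have h3 : ∀ a, f (X a) ^ 2 = ∑ b, f (X a) * (standard.form (X a) (Y b) * f (Y b)) := by
    intro a
    rw [← Finset.mul_sum, ← h1, pow_two]
  have h4 : ∀ b, f (Y b) ^ 2 = ∑ a, f (X a) * (standard.form (X a) (Y b) * f (Y b)) := by
    intro b
    rw [pow_two]
    conv_lhs => arg 1; rw [h2 b]
    rw [Finset.sum_mul]
    exact Finset.sum_congr rfl fun a _ => by ring
  simp only [h3, h4]
  exact Finset.sum_comm

/-- The components of the brackets of the vectors of the orthonormal basis. -/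
noncomputable def sc (a b c : Root) : ℝ :=
  6 * (((⁅pl a ((1 + Complex.I) / 12), pl b ((1 + Complex.I) / 12)⁆ : e7).1.coef c).re +
    ((⁅pl a ((1 + Complex.I) / 12), pl b ((1 + Complex.I) / 12)⁆ : e7).1.coef c).im)

theorem form_adP_onb (a b c : PRoot) :
    standard.form (adP (onb a) (onb b)) (onb c) = sc a.1 b.1 c.1 := by
  rw [form_onb, adP_apply, projP_coef c.2]
  rfl

-- The sum of squares of a linear form over an orthonormal basis depends only on the span. Applied
-- in each of the three slots, this replaces arbitrary bases by root vectors.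
open Classical in
theorem structConst_eq_sum {l m n : ℕ} {X : Fin l → p} {Y : Fin m → p} {Z : Fin n → p} {i j k}
    (hX : IsOrthonormalBasisOf X (summand i)) (hY : IsOrthonormalBasisOf Y (summand j))
    (hZ : IsOrthonormalBasisOf Z (summand k)) : structConst X Y Z =
      ∑ a : Root with a ∈ delta i, ∑ b : Root with b ∈ delta j, ∑ c : Root with c ∈ delta k,
        sc a b c ^ 2 := by
  have hs : ∀ {n : ℕ} {X : Fin n → p} {i} (_ : IsOrthonormalBasisOf X (summand i))
      (f : p →ₗ[ℝ] ℝ), ∑ a, f (X a) ^ 2 = ∑ a, f (onbDelta i a) ^ 2 := by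
    intro n X i hX f
    exact sum_sq_eq hX.1 (form_onbDelta i) (by rw [hX.2, span_onbDelta]) f
  have h1 : ∀ a b c, -killingForm ℝ e7 ⁅(X a : e7), (Y b : e7)⁆ (Z c) =
      standard.form (adP (X a) (Y b)) (Z c) := fun a b c => neg_killing_lie _ _
  have e3 : ∀ x y : p, ∑ c, standard.form (adP x y) (Z c) ^ 2 =
      ∑ c, standard.form (adP x y) (onbDelta k c) ^ 2 := fun x y => hs hZ _
  have e2 : ∀ x z : p, ∑ b, standard.form (adP x (Y b)) z ^ 2 =
      ∑ b, standard.form (adP x (onbDelta j b)) z ^ 2 := fun x z =>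
    hs hY (standard.form.flip z ∘ₗ adP x)
  have e1 : ∀ y z : p, ∑ a, standard.form (adP (X a) y) z ^ 2 =
      ∑ a, standard.form (adP (onbDelta i a) y) z ^ 2 := fun y z =>
    hs hX (standard.form.flip z ∘ₗ (adP.domRestrict p).flip y)
  have hsub : ∀ (i : Fin 7) (f : Root → ℝ),
      ∑ a : Root with a ∈ delta i, f a = ∑ a : delta i, f a.1 := fun i f =>
    Finset.sum_subtype _ (by simp) _
  rw [structConst]
  simp only [h1, e3, hsub]
  have : ∀ (a : Fin l), (∑ b, ∑ c, standard.form (adP (X a) (Y b)) (onbDelta k c) ^ 2) =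
      ∑ b, ∑ c, standard.form (adP (X a) (onbDelta j b)) (onbDelta k c) ^ 2 := by
    intro a
    rw [Finset.sum_comm]
    simp only [e2]
    rw [Finset.sum_comm]
  simp only [this]
  rw [Finset.sum_comm]
  have : ∀ b : delta j, (∑ a, ∑ c, standard.form (adP (X a) (onbDelta j b)) (onbDelta k c) ^ 2) =
      ∑ a, ∑ c, standard.form (adP (onbDelta i a) (onbDelta j b)) (onbDelta k c) ^ 2 := by
    intro b
    rw [Finset.sum_comm]
    simp only [e1]
    rw [Finset.sum_comm]
  simp only [this]
  rw [Finset.sum_comm]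
  refine Finset.sum_congr rfl fun a _ => Finset.sum_congr rfl fun b _ =>
    Finset.sum_congr rfl fun c _ => ?_
  rw [onbDelta, onbDelta, onbDelta, form_adP_onb]

-- The coefficient at `±r` enters as `(re ± im)²`, and the cross term drops out when `u` is real or
-- imaginary. Brackets of basis vectors are of this kind: `(1 + i)²` is imaginary and `|1 + i|²` is
-- real.
open Classical in
theorem coef_pl_sq (r : Root) {u : ℂ} (hu : u.re * u.im = 0) (c : Root) :
    (6 * (((pl r u).1.coef c).re + ((pl r u).1.coef c).im)) ^ 2 =
      36 * (u.re ^ 2 + u.im ^ 2) * ((if c = r then 1 else 0) + if c = -r then 1 else 0) := by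
  rw [pl_coef]
  by_cases h1 : c = r
  · rw [h1]
    simp only [if_true, if_neg (root_ne_neg r), add_zero]
    linear_combination 72 * hu
  · by_cases h2 : c = -r
    · rw [h2]
      simp only [if_true, if_neg (root_ne_neg r).symm, zero_add, Complex.conj_re, Complex.conj_im]
      linear_combination (-72) * hu
    · simp [h1, h2]

theorem onb_coeff : ((1 + Complex.I) / 12 : ℂ) = ⟨1 / 12, 1 / 12⟩ := by
  apply Complex.ext <;> simp

theorem eps_sq (v w : Lat) : (eps v w : ℝ) ^ 2 = 1 := by
  rw [pow_two]; exact_mod_cast eps_mul_self v w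

theorem intCast_eq_mk (n : ℤ) : (n : ℂ) = ⟨n, 0⟩ := by
  apply Complex.ext <;> simp

open Classical in
theorem sc_sq_of_neg_one {a b : Root} (h : ip a.1 b.1 = -1) (c : Root) : sc a b c ^ 2 =
    1 / 144 * ((if c = addRoot a b h then 1 else 0) + if c = -addRoot a b h then 1 else 0) := by
  -- Since `((1 + i) / 12)² = i / 72`, each of the two nonzero squares is `36 / 72² = 1 / 144`.
  have hu : (eps a.1 b.1 * ((1 + Complex.I) / 12 * ((1 + Complex.I) / 12)) : ℂ) =
      ⟨0, eps a.1 b.1 / 72⟩ := by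
    rw [onb_coeff, intCast_eq_mk]
    apply Complex.ext
    · simp
    · simp; ring
  rw [sc, lie_pl_pl h, hu, coef_pl_sq _ (by simp)]
  simp only [div_pow, eps_sq]
  norm_num

open Classical in
theorem sc_sq_of_one {a b : Root} (h' : ip a.1 (-b).1 = -1) (c : Root) :
    sc a b c ^ 2 = 1 / 144 * ((if c = addRoot a (-b) h' then 1 else 0) +
      if c = -addRoot a (-b) h' then 1 else 0) := by
  have hb : pl b ((1 + Complex.I) / 12) = pl (-b) (conj ((1 + Complex.I) / 12)) := by
    rw [pl_neg, Complex.conj_conj]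
  have hu : (eps a.1 (-b).1 * ((1 + Complex.I) / 12 * conj ((1 + Complex.I) / 12)) : ℂ) =
      ⟨eps a.1 (-b).1 / 72, 0⟩ := by
    rw [onb_coeff, intCast_eq_mk]
    apply Complex.ext
    · simp; ring
    · simp
  rw [sc, hb, lie_pl_pl h', hu, coef_pl_sq _ (by simp)]
  simp only [div_pow, eps_sq]
  norm_num

theorem sc_of_zero {a b : Root} (h : ip a.1 b.1 = 0) (c : Root) : sc a b c = 0 := by
  have : ∀ c, (0 : e7).1.coef c = 0 := fun _ => rfl
  rw [sc, lie_pl_pl_zero h, this]; simp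

theorem sc_self (a c : Root) : sc a a c = 0 := by
  rw [sc, lie_pl_self_mem]; simp

theorem sc_neg_self (a c : Root) : sc a (-a) c = 0 := by
  rw [sc, pl_neg, lie_pl_self_mem]; simp

/-- Pairings add, and odd plus odd is even: the set of odd positions of a sum is the symmetric
difference. -/
theorem code_of_add {a b c : Root} (h : c.1 = a.1 + b.1) {i j l} (ha : a ∈ delta i)
    (hb : b ∈ delta j) (hc : c ∈ delta l) : code l = symmDiff (code i) (code j) := by
  ext m
  rw [← odd_nb_of_mem_delta hc, h, nb_add, Finset.mem_symmDiff, ← odd_nb_of_mem_delta ha,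
    ← odd_nb_of_mem_delta hb, Int.odd_add, ← Int.not_odd_iff_even]
  tauto

theorem mem_delta_of_add {a b c : Root} (h : c.1 = a.1 + b.1) {i j l} (ha : a ∈ delta i)
    (hb : b ∈ delta j) (hl : code l = symmDiff (code i) (code j)) : c ∈ delta l := by
  apply mem_delta_of_odd
  intro m
  rw [hl, h, nb_add, Finset.mem_symmDiff, ← odd_nb_of_mem_delta ha,
    ← odd_nb_of_mem_delta hb, Int.odd_add, ← Int.not_odd_iff_even]
  tauto

-- If `⟨a, b⟩ = ±1`, the bracket is supported on `±r` for one root `r = a ∓ b`, and both lie in the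
-- block given by the symmetric difference: `2 · 1/144 = 1/72`. Orthogonal roots commute. If `a =
-- ±b`, the bracket has no root components and the symmetric difference is empty, hence not a code
-- word.
open Classical in
theorem sum_sc_sq {i j l} {a b : Root} (ha : a ∈ delta i) (hb : b ∈ delta j) :
    ∑ c : Root with c ∈ delta l, sc a b c ^ 2 =
      if code l = symmDiff (code i) (code j) then (ip a.1 b.1 : ℝ) ^ 2 / 72 else 0 := by
  have key : ∀ r : Root, (∑ c : Root with c ∈ delta l, (1 / 144 : ℝ) *
      ((if c = r then 1 else 0) + if c = -r then 1 else 0)) =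
        if r ∈ delta l then 1 / 72 else 0 := by
    intro r
    rw [← Finset.mul_sum, Finset.sum_add_distrib, Finset.sum_ite_eq', Finset.sum_ite_eq']
    simp only [Finset.mem_filter, Finset.mem_univ, true_and, neg_mem_delta]
    split_ifs <;> norm_num
  have hr : ∀ {a b r : Root}, r.1 = a.1 + b.1 → a ∈ delta i → b ∈ delta j →
      (r ∈ delta l ↔ code l = symmDiff (code i) (code j)) := fun h ha hb =>
    ⟨fun hr => code_of_add h ha hb hr, fun hl => mem_delta_of_add h ha hb hl⟩
  have hself : i = j → ¬code l = symmDiff (code i) (code j) := by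
    rintro rfl h
    rw [symmDiff_self] at h
    exact (code_nonempty l).ne_empty h
  rcases ip_mem a b with h | h | h | h | h
  · subst h
    rw [if_neg (hself (delta_unique ha hb))]
    exact Finset.sum_eq_zero fun c _ => by rw [sc_self]; norm_num
  · have h' : b = -a := by rw [h, neg_neg]
    subst h'
    rw [if_neg (hself (delta_unique ha (neg_mem_delta.1 hb)))]
    exact Finset.sum_eq_zero fun c _ => by rw [sc_neg_self]; norm_num
  · simp only [sc_sq_of_neg_one h, key, hr (addRoot_val a b h) ha hb, h]
    norm_num
  · rw [Finset.sum_eq_zero fun c _ => by rw [sc_of_zero h, zero_pow two_ne_zero], h]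
    simp
  · have h' : ip a.1 (-b).1 = -1 := by rw [Root.neg_val, ip_neg_right, h]
    simp only [sc_sq_of_one h', key, hr (addRoot_val a (-b) h') ha (neg_mem_delta.2 hb), h]
    norm_num

theorem card_inter_of_symmDiff {i j l : Fin 7} (h : code l = symmDiff (code i) (code j)) :
    (code j ∩ code i).card = 2 := by
  revert i j l; decide

-- Two distinct code words meet in two indices, so `sum_ip_sq` gives `∑ ⟨a, b⟩² = 4 · 2 = 8`, and `8
-- / 72 = 1 / 9`.
open Classical in
theorem sum_sum_sc_sq {i j l} {a : Root} (ha : a ∈ delta i) :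
    ∑ b : Root with b ∈ delta j, ∑ c : Root with c ∈ delta l, sc a b c ^ 2 =
      if code l = symmDiff (code i) (code j) then 1 / 9 else 0 := by
  rw [Finset.sum_congr rfl fun b hb => sum_sc_sq ha (by simpa using hb)]
  split_ifs with h
  · rw [← Finset.sum_div]
    have h1 : ∑ b : Root with b ∈ delta j, (ip a.1 b.1 : ℝ) ^ 2 =
        4 * ∑ m ∈ code j, (nb a.1 m : ℝ) ^ 2 := by exact_mod_cast sum_ip_sq j a.1
    have h2 : ∑ m ∈ code j, (nb a.1 m : ℝ) ^ 2 = 2 := by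
      have : ∀ m, (nb a.1 m : ℝ) ^ 2 = if m ∈ code i then 1 else 0 := by
        intro m
        by_cases hm : m ∈ code i
        · rw [if_pos hm]
          have h0 := (ha m).2 hm
          rcases nb_mem (not_isKRoot_of_mem_delta ha) m with h | h | h
          · rw [h]; norm_num
          · exact absurd h h0
          · rw [h]; norm_num
        · have : nb a.1 m = 0 := not_not.1 fun h => hm ((ha m).1 h)
          rw [if_neg hm, this]; norm_num
      simp only [this]
      rw [Finset.sum_ite_mem, Finset.sum_const, card_inter_of_symmDiff h]
      norm_num
    rw [h1, h2]; norm_num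
  · simp

open Classical in
theorem card_filter_delta (k) : (Finset.univ.filter fun a : Root => a ∈ delta k).card = 16 := by
  rw [← Fintype.card_subtype, ← card_delta k]

open Classical in
theorem sum_sum_sum_sc_sq (i j l) :
    ∑ a : Root with a ∈ delta i, ∑ b : Root with b ∈ delta j, ∑ c : Root with c ∈ delta l,
      sc a b c ^ 2 = if code l = symmDiff (code i) (code j) then 16 / 9 else 0 := by
  rw [Finset.sum_congr rfl fun a ha => sum_sum_sc_sq (by simpa using ha), Finset.sum_const,
    card_filter_delta]
  split_ifs <;> norm_num

/-! ### The connection of the standard metric -/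

theorem form_adP_skew (Z : e7) (x y : p) :
    standard.form (adP Z x) y = -standard.form x (adP Z y) := by
  rw [adP_apply, ← neg_killing_lie, standard.symm x, adP_apply, ← neg_killing_lie, killing_lie,
    killing_symm]

theorem adP_self (x : p) : adP x x = 0 := by
  rw [adP_apply, lie_self, map_zero]

/-- Natural reductivity: each `ad_𝔭 X` is skew for `g_B`, so the last two terms of the Koszul
formula cancel. -/
theorem nomizu_standard (x : p) : standard.nomizu x = (1 / 2 : ℝ) • adP x := by
  ext1 y
  refine standard.ext_form fun z => ?_
  have h1 : standard.form y (adP z x) = standard.form x (adP y z) := by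
    rw [standard.symm y, form_adP_skew, adP_skew z y, map_neg, neg_neg]
  rw [standard.form_nomizu, h1, adP_skew z y, LinearMap.smul_apply, map_smul, LinearMap.smul_apply,
    map_neg, smul_eq_mul]
  ring

theorem adP_adP {Z : e7} (hZ : Z ∈ k) (x y : p) :
    adP Z (adP x y) = adP (adP Z x) y + adP x (adP Z y) := by
  conv_lhs => rw [adP_apply x y]
  rw [← projP_lie hZ, leibniz_lie, map_add, adP_apply _ y, adP_apply _ (adP Z y), coe_adP hZ,
    coe_adP hZ]

/-- An operator may be moved across `∑ Xₐ ⊗ Xₐ` at the price of its adjoint. It is used with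
symmetric operators `A` and with the skew operators `ad_𝔭`. -/
theorem sum_adjoint {W : Type} [AddCommGroup W] [Module ℝ W] (F : p →ₗ[ℝ] p →ₗ[ℝ] W)
    {T T' : Module.End ℝ p} (h : ∀ x y, standard.form (T x) y = standard.form x (T' y)) :
    ∑ a, F (T (onb a)) (onb a) = ∑ a, F (onb a) (T' (onb a)) := by
  have h1 : ∀ a, F (T (onb a)) (onb a) =
      ∑ b, standard.form (T (onb a)) (onb b) • F (onb b) (onb a) := by
    intro a
    conv_lhs => rw [← sum_form_smul_onb (T (onb a))]
    simp only [map_sum, LinearMap.sum_apply, map_smul, LinearMap.smul_apply]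
  have h2 : ∀ b, F (onb b) (T' (onb b)) =
      ∑ a, standard.form (T (onb a)) (onb b) • F (onb b) (onb a) := by
    intro b
    conv_lhs => rw [← sum_form_smul_onb (T' (onb b))]
    simp only [map_sum, map_smul, h]
    exact Finset.sum_congr rfl fun a _ => by rw [standard.symm]
  simp only [h1, h2]
  exact Finset.sum_comm

/-- The operator `∑ₐ ad_𝔭 Xₐ ∘ A ∘ ad_𝔭 Xₐ`. -/
noncomputable def sandwich (A : Module.End ℝ p) : Module.End ℝ p :=
  ∑ a, adP (onb a) ∘ₗ A ∘ₗ adP (onb a)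

theorem sandwich_apply (A : Module.End ℝ p) (x : p) :
    sandwich A x = ∑ a, adP (onb a) (A (adP (onb a) x)) := by
  rw [sandwich, LinearMap.sum_apply]; rfl

theorem form_sandwich (A : Module.End ℝ p) (x y : p) : standard.form (sandwich A x) y =
    -∑ a, standard.form (A (adP (onb a) x)) (adP (onb a) y) := by
  rw [sandwich_apply, map_sum, LinearMap.sum_apply, ← Finset.sum_neg_distrib]
  exact Finset.sum_congr rfl fun a _ => form_adP_skew _ _ _

/-- For `Z ∈ 𝔨` the operator `ad Z` is a derivation of the bracket of `𝔭`; the terms in which it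
hits the basis vectors cancel because it is skew. -/
theorem sandwich_mem {A : Module.End ℝ p} (hA : A ∈ standard.symK) :
    sandwich A ∈ standard.symK := by
  obtain ⟨hs, hc⟩ := mem_symK.1 hA
  refine mem_symK.2 ⟨fun x y => ?_, fun Z hZ => ?_⟩
  · rw [form_sandwich, standard.symm x, form_sandwich]
    congr 1
    exact Finset.sum_congr rfl fun a _ => by rw [hs, standard.symm]
  · ext1 x
    have hc' : ∀ y, adP Z (A y) = A (adP Z y) := fun y => LinearMap.congr_fun (hc Z hZ) y
    have h := sum_adjoint (LinearMap.mk₂ ℝ (fun y z : p => adP y (A (adP z x))) (by simp) (by simp)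
      (by simp) (by simp)) (T := adP Z) (T' := -adP Z) (fun x y => by
        rw [form_adP_skew, LinearMap.neg_apply, map_neg])
    simp only [LinearMap.mk₂_apply, LinearMap.neg_apply] at h
    rw [LinearMap.comp_apply, LinearMap.comp_apply, sandwich_apply, sandwich_apply, map_sum]
    have h1 : ∀ a, adP Z (adP (onb a) (A (adP (onb a) x))) =
        adP (adP Z (onb a)) (A (adP (onb a) x)) + adP (onb a) (A (adP (adP Z (onb a)) x)) +
          adP (onb a) (A (adP (onb a) (adP Z x))) := by
      intro a
      rw [adP_adP hZ, hc', adP_adP hZ, map_add, map_add, add_assoc]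
    rw [Finset.sum_congr rfl fun a _ => h1 a, Finset.sum_add_distrib, Finset.sum_add_distrib, h,
      ← Finset.sum_add_distrib]
    simp

theorem form_blockScalar_onb (m : Fin 7 → ℝ) (x : p) (a : PRoot) :
    standard.form (blockScalar m x) (onb a) = wt m a.1 * standard.form x (onb a) := by
  rw [form_onb, form_onb, blockScalar_coef, Complex.re_ofReal_mul, Complex.im_ofReal_mul]
  ring

theorem form_eq_sum (x y : p) :
    standard.form x y = ∑ a, standard.form x (onb a) * standard.form y (onb a) := by
  conv_lhs => rw [← sum_form_smul_onb y]
  simp [map_sum, mul_comm]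

open Classical in
theorem sum_pRoot (f : Root → ℝ) : ∑ a : PRoot, f a.1 = ∑ k, ∑ a : Root with a ∈ delta k, f a := by
  have h1 := sum_root_split f
  have h2 : ∑ a : PRoot, f a.1 = ∑ a : Root with ¬IsKRoot a, f a :=
    (Finset.sum_subtype _ (by simp) _).symm
  have h3 := Finset.sum_filter_add_sum_filter_not Finset.univ (fun a : Root => IsKRoot a) f
  linarith

/-- For `l ≠ i` there is exactly one `j` completing the line through `i` and `l`; for `l = i` there
is none, the empty set not being a code word. -/
theorem sum_code_symmDiff (m : Fin 7 → ℝ) (i : Fin 7) :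
    ∑ j, ∑ l, (if code l = symmDiff (code i) (code j) then m l else 0) = ∑ l, m l - m i := by
  rw [Finset.sum_comm]
  have h : ∀ l, ∑ j, (if code l = symmDiff (code i) (code j) then m l else 0) =
      m l - if l = i then m l else 0 := by
    intro l
    have hcard : (Finset.univ.filter fun j => code l = symmDiff (code i) (code j)).card =
        if l = i then 0 else 1 := by revert l i; decide
    rw [← Finset.sum_filter, Finset.sum_const, hcard]
    split_ifs <;> simp
  simp only [h, Finset.sum_sub_distrib, Finset.sum_ite_eq', Finset.mem_univ, if_true]

theorem sc_skew (a b c : PRoot) : sc a.1 b.1 c.1 = -sc b.1 a.1 c.1 := by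
  rw [← form_adP_onb, ← form_adP_onb, adP_skew, map_neg, LinearMap.neg_apply]

theorem sc_skew' (a b c : PRoot) : sc a.1 b.1 c.1 = -sc a.1 c.1 b.1 := by
  rw [← form_adP_onb, ← form_adP_onb, form_adP_skew, standard.symm]

/-- By Schur the result is a block scalar, so its value on block `i` can be computed at one basis
vector `b`. There it is minus the sum of `m l / 9` over the pairs `(j, l)` that form a line with
`i`. -/
theorem sandwich_blockScalar (m : Fin 7 → ℝ) :
    sandwich (blockScalar m) = blockScalar fun i => (m i - ∑ l, m l) / 9 := by
  classical
  obtain ⟨l, hl⟩ := exists_eq_blockScalar (sandwich_mem (blockScalar_mem m))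
  rw [hl]
  congr 1
  funext i
  let b : PRoot := ⟨_, not_isKRoot_of_mem_delta (deltaEquiv i fun _ => true).2⟩
  have hb : b.1 ∈ delta i := (deltaEquiv i fun _ => true).2
  have h1 : standard.form (blockScalar l (onb b)) (onb b) = l i := by
    rw [form_blockScalar_onb, wt_of_mem l hb, form_onb_onb, if_pos rfl, mul_one]
  have h2 : ∀ a : PRoot, standard.form (blockScalar m (adP (onb a) (onb b))) (adP (onb a) (onb b)) =
      ∑ j, ∑ c : Root with c ∈ delta j, wt m c * sc b.1 a.1 c ^ 2 := by
    intro a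
    rw [form_eq_sum, ← sum_pRoot]
    refine Finset.sum_congr rfl fun c _ => ?_
    rw [form_blockScalar_onb, form_adP_onb, sc_skew]; ring
  rw [← h1, ← hl, form_sandwich, Finset.sum_congr rfl fun a _ => h2 a,
    sum_pRoot (fun a => ∑ j, ∑ c : Root with c ∈ delta j, wt m c * sc b.1 a c ^ 2)]
  have h3 : ∀ j : Fin 7, (∑ a : Root with a ∈ delta j, ∑ j', ∑ c : Root with c ∈ delta j',
      wt m c * sc b.1 a c ^ 2) = ∑ j', if code j' = symmDiff (code i) (code j) then m j' / 9
        else 0 := by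
    intro j
    rw [Finset.sum_comm]
    refine Finset.sum_congr rfl fun j' _ => ?_
    have h4 : ∀ a : Root, ∑ c : Root with c ∈ delta j', wt m c * sc b.1 a c ^ 2 =
        m j' * ∑ c : Root with c ∈ delta j', sc b.1 a c ^ 2 := by
      intro a
      rw [Finset.mul_sum]
      refine Finset.sum_congr rfl fun c hc => ?_
      rw [wt_of_mem m (by simpa using hc)]
    simp only [h4]
    rw [← Finset.mul_sum, sum_sum_sc_sq hb]
    split_ifs <;> ring
  simp only [h3]
  rw [sum_code_symmDiff (fun j => m j / 9), ← Finset.sum_div]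
  ring

/-- The Casimir operator of the brackets. -/
theorem sandwich_id : sandwich LinearMap.id = (-(2 / 3) : ℝ) • LinearMap.id := by
  -- With all weights equal to 1 the block value is `(1 - 7) / 9 = -2/3`.
  rw [← blockScalar_one, sandwich_blockScalar, ← map_smul]
  congr 1
  funext i
  simp; norm_num

theorem sum_form_adP (x y : p) :
    ∑ a, standard.form (adP (onb a) x) (adP (onb a) y) = 2 / 3 * standard.form x y := by
  have := form_sandwich LinearMap.id x y
  rw [sandwich_id] at this
  simp only [LinearMap.smul_apply, LinearMap.id_apply, map_smul, smul_eq_mul] at this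
  linarith

/-! ### The `𝔨`-component of the brackets -/

/-- The projection `X ↦ X_𝔨`. -/
noncomputable def projK : e7 →ₗ[ℝ] e7 := LinearMap.id - p.subtype ∘ₗ projP

theorem projK_apply (x : e7) : projK x = x - projP x := rfl

theorem projK_mem (x : e7) : projK x ∈ k := sub_projP_mem_k x

theorem killing_projK (x y : e7) : killingForm ℝ e7 (projK x) y =
    killingForm ℝ e7 (projK x) (projK y) := by
  have h : killingForm ℝ e7 (projK x) (projP y) = 0 := (projP y).2 _ (projK_mem x)
  rw [projK_apply y, map_sub, h, sub_zero]

/-- The form `∑ₐ ⟨[x, Xₐ]_𝔨, [y, Xₐ]_𝔨⟩`. -/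
noncomputable def kForm (x y : p) : ℝ :=
  -∑ a, killingForm ℝ e7 (projK ⁅(x : e7), (onb a : e7)⁆) (projK ⁅(y : e7), (onb a : e7)⁆)

theorem kForm_symm (x y : p) : kForm x y = kForm y x := by
  simp only [kForm, killing_symm (projK ⁅(x : e7), _⁆)]

theorem form_adP_projK (x y : p) (W : e7) :
    standard.form (adP (projK W) x) y = killingForm ℝ e7 (projK W) (projK ⁅(y : e7), (x : e7)⁆) := by
  rw [adP_apply, ← neg_killing_lie, ← lie_skew, map_neg, LinearMap.neg_apply, neg_neg, killing_lie,
    ← killing_projK, ← map_neg, lie_skew]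

/-- The trace of `ad x ∘ ad y` over `e₇` splits according to where `ad y` starts and lands. The path
`𝔭 → 𝔭 → 𝔭` gives `-⅔ g`, and the paths `𝔭 → 𝔨 → 𝔭` and `𝔨 → 𝔭 → 𝔨` give `-kForm` each. Hence `g = ⅔
g + 2 kForm`. -/
theorem kForm_eq (x y : p) : kForm x y = 1 / 6 * standard.form x y := by
  let ad := LieAlgebra.ad ℝ e7
  have hid : (LinearMap.id : e7 →ₗ[ℝ] e7) = p.subtype ∘ₗ projP + projK := by
    rw [projK]; abel
  let R : p → p → Module.End ℝ p := fun x y => projP ∘ₗ ad x ∘ₗ projK ∘ₗ ad y ∘ₗ p.subtype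
  have hR : ∀ x y, LinearMap.trace ℝ p (R x y) = -kForm y x := by
    intro x y
    rw [trace_eq, kForm, neg_neg]
    refine Finset.sum_congr rfl fun a _ => ?_
    change standard.form (projP ⁅(x : e7), projK ⁅(y : e7), (onb a : e7)⁆⁆) (onb a) = _
    rw [← neg_killing_lie, killing_lie, neg_neg, killing_projK]
  have h1 : LinearMap.trace ℝ e7 (ad x ∘ₗ ad y ∘ₗ (p.subtype ∘ₗ projP)) =
      LinearMap.trace ℝ p (adP x ∘ₗ adP y) + LinearMap.trace ℝ p (R x y) := by
    have : ad x ∘ₗ ad y ∘ₗ (p.subtype ∘ₗ projP) = (ad x ∘ₗ ad y ∘ₗ p.subtype) ∘ₗ projP := rfl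
    rw [this, LinearMap.trace_comp_comm', ← map_add]
    congr 1
    have h2 : ad x ∘ₗ ad y ∘ₗ p.subtype =
        ad x ∘ₗ (p.subtype ∘ₗ projP + projK) ∘ₗ ad y ∘ₗ p.subtype := by
      rw [← hid]; rfl
    rw [h2, LinearMap.add_comp, LinearMap.comp_add, LinearMap.comp_add]
    rfl
  have h2 : LinearMap.trace ℝ e7 (ad x ∘ₗ ad y ∘ₗ projK) = LinearMap.trace ℝ p (R y x) := by
    have h3 : ad y ∘ₗ projK = p.subtype ∘ₗ (projP ∘ₗ ad y ∘ₗ projK) := by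
      ext1 z
      change ⁅(y : e7), projK z⁆ = projP ⁅(y : e7), projK z⁆
      rw [← lie_skew, map_neg]
      change _ = -(projP ⁅projK z, (y : e7)⁆ : e7)
      rw [projP_of_mem_p (lie_mem_p (projK_mem z) y.2)]
    rw [h3]
    have h4 : ad x ∘ₗ p.subtype ∘ₗ (projP ∘ₗ ad y ∘ₗ projK) =
      (ad x ∘ₗ p.subtype) ∘ₗ (projP ∘ₗ ad y ∘ₗ projK) := rfl
    -- `ad y` maps `𝔨` into `𝔭`, so cyclicity of the trace turns the path `𝔨 → 𝔭 → 𝔨` into one based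
    -- at `𝔭`.
    rw [h4, LinearMap.trace_comp_comm']
    rfl
  have h3 : LinearMap.trace ℝ p (adP x ∘ₗ adP y) = -(2 / 3 * standard.form x y) := by
    rw [trace_eq, ← sum_form_adP, ← Finset.sum_neg_distrib]
    refine Finset.sum_congr rfl fun a _ => ?_
    rw [LinearMap.comp_apply, form_adP_skew, adP_skew (onb a) x, adP_skew (onb a) y,
      standard.symm (-_)]
    simp
  have h4 : standard.form x y = -LinearMap.trace ℝ e7 (ad x ∘ₗ ad y) := by
    rw [standard_apply, killingForm_apply_apply]
  have h5 : ad x ∘ₗ ad y = ad x ∘ₗ ad y ∘ₗ (p.subtype ∘ₗ projP) + ad x ∘ₗ ad y ∘ₗ projK := by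
    rw [← LinearMap.comp_add, ← LinearMap.comp_add, ← hid]; rfl
  rw [h5, map_add, h1, h2, h3, hR, hR, kForm_symm y x] at h4
  linarith

/-! ### The curvature of the standard metric -/

theorem curv_apply (Q : PosForm) (x y z : p) : Q.curv x y z =
    Q.nomizu x (Q.nomizu y z) - Q.nomizu y (Q.nomizu x z) - Q.nomizu (adP x y) z -
      adP (projK ⁅(x : e7), (y : e7)⁆) z := rfl

theorem curv_standard (x y z : p) : standard.curv x y z =
    (1 / 4 : ℝ) • adP x (adP y z) - (1 / 4 : ℝ) • adP y (adP x z) -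
      (1 / 2 : ℝ) • adP (adP x y) z - adP (projK ⁅(x : e7), (y : e7)⁆) z := by
  rw [curv_apply]
  simp only [nomizu_standard, LinearMap.smul_apply, map_smul, smul_smul]
  norm_num

theorem ricci_apply (Q : PosForm) (y z : p) :
    Q.ricci y z = ∑ a, standard.form (Q.curv (onb a) y z) (onb a) := by
  change LinearMap.trace ℝ p ((Q.curv.flip y).flip z) = _
  rw [trace_eq]
  rfl

/-- In the trace `R(Xₐ, y)z` the `𝔭`-brackets contribute `(-¼ + ½) = ¼` of the Casimir value `⅔`,
and the `𝔨`-brackets contribute `kForm`: `⅙ + ⅙ = ⅓`. -/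
theorem standard_isEinstein : standard.IsEinstein (1 / 3) := by
  ext y z
  rw [ricci_apply, LinearMap.smul_apply, LinearMap.smul_apply, smul_eq_mul]
  have h : ∀ a, standard.form (standard.curv (onb a) y z) (onb a) =
      1 / 4 * standard.form (adP (onb a) y) (adP (onb a) z) -
        killingForm ℝ e7 (projK ⁅(y : e7), (onb a : e7)⁆) (projK ⁅(z : e7), (onb a : e7)⁆) := by
    intro a
    have h1 : standard.form (adP (onb a) (adP y z)) (onb a) = 0 := by
      rw [form_adP_skew, adP_self, map_zero, neg_zero]
    have h2 : standard.form (adP y (adP (onb a) z)) (onb a) =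
        standard.form (adP (onb a) y) (adP (onb a) z) := by
      rw [form_adP_skew, standard.symm, adP_skew y, map_neg, LinearMap.neg_apply, neg_neg]
    have h3 : standard.form (adP (adP (onb a) y) z) (onb a) =
        -standard.form (adP (onb a) y) (adP (onb a) z) := by
      rw [adP_skew, map_neg, LinearMap.neg_apply, form_adP_skew, neg_neg, adP_skew z, map_neg]
    have h4 : projK ⁅(onb a : e7), (y : e7)⁆ = -projK ⁅(y : e7), (onb a : e7)⁆ := by
      rw [← lie_skew, map_neg]
    have h5 : projK ⁅(onb a : e7), (z : e7)⁆ = -projK ⁅(z : e7), (onb a : e7)⁆ := by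
      rw [← lie_skew, map_neg]
    rw [curv_standard]
    simp only [map_sub, LinearMap.sub_apply, map_smul, LinearMap.smul_apply, smul_eq_mul]
    rw [h1, h2, h3, form_adP_projK, h4, h5, map_neg, map_neg, LinearMap.neg_apply]
    ring
  have hk := kForm_eq y z
  rw [kForm] at hk
  rw [Finset.sum_congr rfl fun a _ => h a, Finset.sum_sub_distrib, ← Finset.mul_sum, sum_form_adP]
  linarith

theorem ricciOp_standard : standard.ricciOp = (1 / 3 : ℝ) • LinearMap.id := by
  ext1 x
  refine standard.ext_form fun y => ?_
  change standard.form (standard.sharp (standard.ricci x)) y = _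
  rw [standard.form_sharp, standard_isEinstein]
  simp

/-! ### The Lichnerowicz Laplacian -/

theorem contract_eq_of_bilinear {W : Type} [AddCommGroup W] [Module ℝ W] (F : p → p → W)
    (h1 : ∀ x x' y, F (x + x') y = F x y + F x' y) (h2 : ∀ (c : ℝ) x y, F (c • x) y = c • F x y)
    (h3 : ∀ x y y', F x (y + y') = F x y + F x y') (h4 : ∀ (c : ℝ) x y, F x (c • y) = c • F x y) :
    standard.contract F = ∑ a, F (onb a) (onb a) :=
  contract_eq (LinearMap.mk₂ ℝ F h1 h2 h3 h4)

theorem sum_adP_adP_symm {A : Module.End ℝ p}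
    (hA : ∀ x y, standard.form (A x) y = standard.form x (A y)) (x : p) :
    ∑ a, adP (A (onb a)) (adP (onb a) x) = ∑ a, adP (onb a) (adP (A (onb a)) x) := by
  have h := sum_adjoint (LinearMap.mk₂ ℝ (fun y z : p => adP y (adP z x)) (by simp) (by simp)
      (by simp) (by simp)) hA
  simpa only [LinearMap.mk₂_apply] using h

/-- The symmetric tensor `∑ Xₐ ⊗ A Xₐ` is contracted with the skew bracket. This is what makes every
invariant tensor divergence free. -/
theorem sum_adP_self {A : Module.End ℝ p}
    (hA : ∀ x y, standard.form (A x) y = standard.form x (A y)) :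
    ∑ a, adP (onb a) (A (onb a)) = 0 := by
  have h := sum_adjoint (LinearMap.mk₂ ℝ (fun y z : p => adP y z) (by simp) (by simp)
      (by simp) (by simp)) hA
  simp only [LinearMap.mk₂_apply] at h
  have h2 : ∑ a, adP (A (onb a)) (onb a) = -∑ a, adP (onb a) (A (onb a)) := by
    rw [← Finset.sum_neg_distrib]
    exact Finset.sum_congr rfl fun a _ => adP_skew _ _
  rw [h] at h2
  have h3 : (2 : ℝ) • ∑ a, adP (onb a) (A (onb a)) = 0 := by
    rw [two_smul]
    nth_rewrite 1 [h2]
    exact neg_add_cancel _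
  exact (smul_eq_zero.1 h3).resolve_left two_ne_zero

/-- The operators `∑ₐ ad_𝔭 Xₐ ∘ ad_𝔭 (A Xₐ)` and `∑ₐ ad_𝔭 Xₐ ∘ A ∘ ad_𝔭 Xₐ` agree. -/
theorem sum_adP_adP {A : Module.End ℝ p}
    (hA : ∀ x y, standard.form (A x) y = standard.form x (A y)) (x : p) :
    ∑ a, adP (onb a) (adP (A (onb a)) x) = sandwich A x := by
  refine standard.ext_form fun y => ?_
  -- Both sides are written as sums over pairs with the basis vector innermost; first the skew `ad_𝔭
  -- x` and then the symmetric `A` are moved across the sum.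
  have e1 := sum_adjoint (LinearMap.mk₂ ℝ (fun u v : p => standard.form u (A (adP y v)))
    (by simp) (by simp) (by simp) (by simp)) (T := adP x) (T' := -adP x) (fun u v => by
        rw [form_adP_skew, LinearMap.neg_apply, map_neg])
  have e2 := sum_adjoint (LinearMap.mk₂ ℝ (fun u v : p => standard.form (adP y u) (adP x v))
    (by simp) (by simp) (by simp) (by simp)) hA
  simp only [LinearMap.mk₂_apply, LinearMap.neg_apply, map_neg] at e1 e2
  have e3 : ∀ u : p, standard.form u (A (adP y (adP x u))) =
      -standard.form (adP y (A u)) (adP x u) := by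
    intro u
    rw [← hA, form_adP_skew, neg_neg]
  rw [form_sandwich, map_sum, LinearMap.sum_apply]
  have h1 : ∀ a, standard.form (adP (onb a) (adP (A (onb a)) x)) y =
      -standard.form (adP y (onb a)) (adP x (A (onb a))) := by
    intro a
    rw [form_adP_skew, adP_skew (A (onb a)) x, adP_skew (onb a) y, standard.symm]
    simp
  have h2 : ∀ a, standard.form (A (adP (onb a) x)) (adP (onb a) y) =
      standard.form (adP x (onb a)) (A (adP y (onb a))) := by
    intro a
    rw [hA, adP_skew (onb a) x, adP_skew (onb a) y]
    simp
  simp only [h1, h2, e1, e3, Finset.sum_neg_distrib, neg_neg]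
  rw [e2]

theorem add_bracket (A B C : Module.End ℝ p) : ⁅A + B, C⁆ = ⁅A, C⁆ + ⁅B, C⁆ := by
  simp only [Ring.lie_def, add_mul, mul_add]; abel

theorem bracket_add (A B C : Module.End ℝ p) : ⁅A, B + C⁆ = ⁅A, B⁆ + ⁅A, C⁆ := by
  simp only [Ring.lie_def, add_mul, mul_add]; abel

theorem smul_bracket (c : ℝ) (A B : Module.End ℝ p) : ⁅c • A, B⁆ = c • ⁅A, B⁆ := by
  simp only [Ring.lie_def, smul_mul_assoc, mul_smul_comm, smul_sub]

theorem bracket_smul (c : ℝ) (A B : Module.End ℝ p) : ⁅A, c • B⁆ = c • ⁅A, B⁆ := by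
  simp only [Ring.lie_def, smul_mul_assoc, mul_smul_comm, smul_sub]

theorem contract_adP_adP (A : Module.End ℝ p) :
    standard.contract (fun X Y : p => ⁅adP X, ⁅adP Y, A⁆⁆) =
      ∑ a, ⁅adP (onb a), ⁅adP (onb a), A⁆⁆ :=
  contract_eq_of_bilinear _
    (fun x x' y => by rw [Submodule.coe_add, map_add, add_bracket])
    (fun c x y => by rw [Submodule.coe_smul, map_smul, smul_bracket])
    (fun x y y' => by rw [Submodule.coe_add, map_add, add_bracket, bracket_add])
    (fun c x y => by rw [Submodule.coe_smul, map_smul, smul_bracket, bracket_smul])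

/-- `[D, [D, A]] = D²A + AD² - 2DAD`, and the sum of the squares `D²` is the Casimir operator `-⅔`.
-/
theorem Lp_apply {A : Module.End ℝ p} :
    Lp A = (2 / 3 : ℝ) • A + sandwich A := by
  change -(1 / 2 : ℝ) • standard.contract (fun X Y : p => ⁅adP X, ⁅adP Y, A⁆⁆) = _
  rw [contract_adP_adP]
  have h1 : ∀ a, ⁅adP (onb a), ⁅adP (onb a), A⁆⁆ =
      (adP (onb a) ∘ₗ LinearMap.id ∘ₗ adP (onb a)) * A + A * (adP (onb a) ∘ₗ LinearMap.id ∘ₗ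
        adP (onb a)) - (2 : ℝ) • (adP (onb a) ∘ₗ A ∘ₗ adP (onb a)) := by
    intro a
    have : ∀ D : Module.End ℝ p, ⁅D, ⁅D, A⁆⁆ = (D * D) * A + A * (D * D) - (2 : ℝ) • (D * A * D) := by
      intro D
      rw [Ring.lie_def, Ring.lie_def, two_smul]
      simp only [mul_sub, sub_mul, mul_assoc]
      abel
    exact this _
  rw [Finset.sum_congr rfl fun a _ => h1 a, Finset.sum_sub_distrib, Finset.sum_add_distrib,
    ← Finset.sum_mul, ← Finset.mul_sum, ← Finset.smul_sum]
  change -(1 / 2 : ℝ) • (sandwich LinearMap.id * A + A * sandwich LinearMap.id -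
    (2 : ℝ) • sandwich A) = _
  rw [sandwich_id]
  have h2 : ((-(2 / 3) : ℝ) • (LinearMap.id : Module.End ℝ p)) * A = (-(2 / 3) : ℝ) • A := by
    ext1 x; rfl
  have h3 : A * ((-(2 / 3) : ℝ) • (LinearMap.id : Module.End ℝ p)) = (-(2 / 3) : ℝ) • A := by
    rw [mul_smul_comm]; rfl
  rw [h2, h3]
  module

/-- On `ℝ⁷` this is `(7/9) I - (1/9) J` with `7/9 = 2/3 + 1/9` and `J` the all-ones matrix, whose
eigenvalues are 7 and 0. -/
theorem Lp_blockScalar (m : Fin 7 → ℝ) :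
    Lp (blockScalar m) = blockScalar fun i => 7 / 9 * m i - (∑ l, m l) / 9 := by
  rw [Lp_apply, sandwich_blockScalar, ← map_smul, ← map_add]
  congr 1
  funext i
  simp; ring

theorem Lp_mem {A : Module.End ℝ p} (hA : A ∈ standard.symK) : Lp A ∈ standard.symK := by
  obtain ⟨m, rfl⟩ := exists_eq_blockScalar hA
  rw [Lp_blockScalar]
  exact blockScalar_mem _

/-- As `Λ(X)X = 0`, only `[Λ(Xₐ), [Λ(Xₐ), A]]` with `Λ = ½ ad_𝔭` remains: the factor is `¼`, against
`-½` in `L_𝔭`. -/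
theorem contract_hess (A : Module.End ℝ p) :
    standard.contract (standard.hess A) = -(1 / 2 : ℝ) • Lp A := by
  have h1 : standard.contract (standard.hess A) = ∑ a, standard.hess A (onb a) (onb a) :=
    contract_eq_of_bilinear _
      (fun x x' y => by
        simp only [PosForm.hess, map_add, LinearMap.add_apply, add_bracket]; abel)
      (fun c x y => by
        simp only [PosForm.hess, map_smul, LinearMap.smul_apply, smul_bracket, smul_sub])
      (fun x y y' => by
        simp only [PosForm.hess, map_add, add_bracket, bracket_add]; abel)
      (fun c x y => by
        simp only [PosForm.hess, map_smul, smul_bracket, bracket_smul, smul_sub])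
  have h2 : Lp A = -(1 / 2 : ℝ) • ∑ a, ⁅adP (onb a), ⁅adP (onb a), A⁆⁆ := by
    rw [← contract_adP_adP]; rfl
  rw [h1, h2, smul_smul, Finset.smul_sum]
  refine Finset.sum_congr rfl fun a _ => ?_
  rw [PosForm.hess, nomizu_standard, LinearMap.smul_apply, adP_self, smul_zero, map_zero,
    smul_bracket, smul_bracket, bracket_smul, smul_smul, Ring.lie_def 0, zero_mul, mul_zero, sub_zero,
    sub_zero]
  norm_num

theorem sum_adP_projK (x : p) : ∑ a, adP (projK ⁅(x : e7), (onb a : e7)⁆) (onb a) =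
    -(1 / 6 : ℝ) • x := by
  refine standard.ext_form fun y => ?_
  rw [map_sum, LinearMap.sum_apply]
  simp only [form_adP_projK]
  have := kForm_eq x y
  rw [kForm] at this
  rw [map_smul, LinearMap.smul_apply, smul_eq_mul]
  linarith

/-- Of the four curvature terms, the first vanishes by `sum_adP_self`, the next two give `(¼ - ½)
sandwich A`, and in the last `A` commutes with the action of `𝔨`, which leaves `⅙ A` by `kForm_eq`.
-/
theorem curvAction_eq {A : Module.End ℝ p} (hA : A ∈ standard.symK) :
    standard.curvAction A = -(1 / 4 : ℝ) • sandwich A + (1 / 6 : ℝ) • A := by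
  obtain ⟨hs, hc⟩ := mem_symK.1 hA
  have h1 : standard.curvAction A = ∑ a, (standard.curv.flip (onb a)).flip (A (onb a)) :=
    contract_eq_of_bilinear (fun Y Z => (standard.curv.flip Y).flip (A Z)) (fun x x' y => by
      ext1 z; simp) (fun c x y => by ext1 z; simp) (fun x y y' => by simp) (fun c x y => by simp)
  rw [h1]
  ext1 x
  have h2 : ∀ a, (standard.curv.flip (onb a)).flip (A (onb a)) x =
      (1 / 4 : ℝ) • adP x (adP (onb a) (A (onb a))) +
        (1 / 4 : ℝ) • adP (onb a) (adP (A (onb a)) x) -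
        (1 / 2 : ℝ) • adP (A (onb a)) (adP (onb a) x) -
        A (adP (projK ⁅(x : e7), (onb a : e7)⁆) (onb a)) := by
    intro a
    change standard.curv x (onb a) (A (onb a)) = _
    have e1 : adP (adP x (onb a)) (A (onb a)) = adP (A (onb a)) (adP (onb a) x) := by
      rw [adP_skew, adP_skew x, map_neg, neg_neg]
    have e2 := LinearMap.congr_fun (hc _ (projK_mem ⁅(x : e7), (onb a : e7)⁆)) (onb a)
    simp only [LinearMap.comp_apply] at e2
    rw [curv_standard, e1, e2, adP_skew x (A (onb a)), map_neg, smul_neg, sub_neg_eq_add]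
  rw [LinearMap.sum_apply, Finset.sum_congr rfl fun a _ => h2 a, Finset.sum_sub_distrib,
    Finset.sum_sub_distrib, Finset.sum_add_distrib]
  simp only [← Finset.smul_sum, ← map_sum]
  rw [sum_adP_self hs, sum_adP_adP_symm hs, sum_adP_adP hs, sum_adP_projK, map_zero, map_smul]
  simp only [LinearMap.add_apply, LinearMap.smul_apply]
  module

/-- The terms are `½ L_𝔭 A`, `⅔ A` from Ricci, and `½ sandwich A - ⅓ A` from the curvature; the last
three add up to `⅓ A + ½ sandwich A`, which is `½ L_𝔭 A` again. -/
theorem lichnerowicz_eq {A : Module.End ℝ p} (hA : A ∈ standard.symK) :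
    standard.lichnerowicz A = Lp A := by
  rw [PosForm.lichnerowicz, contract_hess, curvAction_eq hA, ricciOp_standard, Lp_apply]
  have h2 : ((1 / 3 : ℝ) • (LinearMap.id : Module.End ℝ p)) ∘ₗ A = (1 / 3 : ℝ) • A := by
    ext1 x; rfl
  have h3 : A ∘ₗ ((1 / 3 : ℝ) • (LinearMap.id : Module.End ℝ p)) = (1 / 3 : ℝ) • A := by
    rw [LinearMap.comp_smul, LinearMap.comp_id]
  rw [h2, h3]
  module

theorem divergence_eq_zero {A : Module.End ℝ p} (hA : A ∈ standard.symK) :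
    standard.divergence A = 0 := by
  have h : standard.contract (fun X Y => ⁅standard.nomizu X, A⁆ Y) =
      ∑ a, ⁅standard.nomizu (onb a), A⁆ (onb a) :=
    contract_eq_of_bilinear _
      (fun x x' y => by rw [map_add, add_bracket, LinearMap.add_apply])
      (fun c x y => by rw [map_smul, smul_bracket, LinearMap.smul_apply])
      (fun x y y' => map_add _ _ _) (fun c x y => map_smul _ _ _)
  rw [PosForm.divergence, h, neg_eq_zero]
  have h2 : ∀ a, ⁅standard.nomizu (onb a), A⁆ (onb a) = (1 / 2 : ℝ) • adP (onb a) (A (onb a)) := by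
    intro a
    rw [Ring.lie_def, LinearMap.sub_apply, Module.End.mul_apply, Module.End.mul_apply,
      nomizu_standard, LinearMap.smul_apply, LinearMap.smul_apply, adP_self, smul_zero, map_zero,
      sub_zero]
  rw [Finset.sum_congr rfl fun a _ => h2 a, ← Finset.smul_sum, sum_adP_self hA.1, smul_zero]

theorem isTT_iff (A : Module.End ℝ p) :
    standard.IsTT A ↔ A ∈ standard.symK ∧ LinearMap.trace ℝ p A = 0 :=
  ⟨fun h => ⟨h.1, h.2.1⟩, fun h => ⟨h.1, h.2, divergence_eq_zero h.1⟩⟩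

/-! ### The spectrum -/

theorem trace_blockScalar (m : Fin 7 → ℝ) :
    LinearMap.trace ℝ p (blockScalar m) = 16 * ∑ i, m i := by
  classical
  rw [trace_eq]
  have h : ∀ a : PRoot, standard.form (blockScalar m (onb a)) (onb a) = wt m a.1 := fun a => by
    rw [form_blockScalar_onb, form_onb_onb, if_pos rfl, mul_one]
  rw [Finset.sum_congr rfl fun a _ => h a, sum_pRoot, Finset.mul_sum]
  refine Finset.sum_congr rfl fun k _ => ?_
  rw [Finset.sum_congr rfl fun a ha => wt_of_mem m (by simpa using ha), Finset.sum_const,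
    card_filter_delta]
  simp

theorem blockScalar_injective : Function.Injective blockScalar := by
  intro l m h
  funext k
  obtain ⟨x, hx, hx0⟩ := Submodule.exists_mem_ne_zero_of_ne_bot (summand_ne_bot k)
  have := LinearMap.congr_fun h x
  rw [blockScalar_of_mem l hx, blockScalar_of_mem m hx] at this
  exact smul_left_injective ℝ hx0 this

/-- Schur's lemma as a linear isomorphism. -/
theorem map_blockScalar_top : (⊤ : Submodule ℝ (Fin 7 → ℝ)).map blockScalar = standard.symK := by
  ext A
  constructor
  · rintro ⟨l, -, rfl⟩
    exact blockScalar_mem l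
  · intro hA
    obtain ⟨l, rfl⟩ := exists_eq_blockScalar hA
    exact ⟨l, trivial, rfl⟩

theorem finrank_map_blockScalar (V : Submodule ℝ (Fin 7 → ℝ)) :
    finrank ℝ (V.map blockScalar) = finrank ℝ V :=
  (Submodule.equivMapOfInjective _ blockScalar_injective V).finrank_eq.symm

theorem finrank_symK : finrank ℝ standard.symK = 7 := by
  rw [← map_blockScalar_top, finrank_map_blockScalar, finrank_top]
  simp

/-- The sum of the coordinates. -/
noncomputable def coordSum : (Fin 7 → ℝ) →ₗ[ℝ] ℝ := ∑ i, LinearMap.proj i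

theorem coordSum_apply (m : Fin 7 → ℝ) : coordSum m = ∑ i, m i := by
  simp [coordSum]

theorem Lp_blockScalar_eq_iff (m : Fin 7 → ℝ) (μ : ℝ) :
    Lp (blockScalar m) = μ • blockScalar m ↔ ∀ i, (7 / 9 - μ) * m i = (∑ l, m l) / 9 := by
  rw [Lp_blockScalar, ← map_smul, blockScalar_injective.eq_iff, funext_iff]
  refine forall_congr' fun i => ?_
  rw [Pi.smul_apply, smul_eq_mul]
  constructor <;> intro h <;> linarith

theorem Lp_eq_iff_sum_eq_zero (m : Fin 7 → ℝ) :
    Lp (blockScalar m) = (7 / 9 : ℝ) • blockScalar m ↔ ∑ l, m l = 0 := by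
  rw [Lp_blockScalar_eq_iff]
  constructor
  · intro h
    linarith [h 0]
  · intro h i
    rw [h]; ring

theorem Lp_eq_zero_iff (m : Fin 7 → ℝ) :
    Lp (blockScalar m) = (0 : ℝ) • blockScalar m ↔ ∃ c, m = fun _ => c := by
  rw [Lp_blockScalar_eq_iff]
  constructor
  · intro h
    exact ⟨(∑ l, m l) / 7, funext fun i => by linarith [h i]⟩
  · rintro ⟨c, rfl⟩ i
    simp; ring

/-- Summing the seven equations gives `μ ∑ m = 0`. If `μ ≠ 0`, the sum vanishes and `(7/9 - μ) mᵢ =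
0` for all `i`. -/
theorem eigenvalue_mem {m : Fin 7 → ℝ} (hm : m ≠ 0) {μ : ℝ}
    (h : Lp (blockScalar m) = μ • blockScalar m) : μ = 7 / 9 ∨ μ = 0 := by
  rw [Lp_blockScalar_eq_iff] at h
  by_contra! hcon
  have h1 : (7 / 9 - μ) ≠ 0 := sub_ne_zero.2 hcon.1.symm
  have h2 : ∑ i, (7 / 9 - μ) * m i = 7 * ((∑ l, m l) / 9) := by
    simp only [h]; simp
  rw [← Finset.mul_sum] at h2
  have h3 : μ * ∑ l, m l = 0 := by linarith
  have h4 := (mul_eq_zero.1 h3).resolve_left hcon.2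
  apply hm
  funext i
  have := h i
  rw [h4, zero_div] at this
  exact (mul_eq_zero.1 this).resolve_left h1

theorem symK_inf_eigenspace (μ : ℝ) :
    standard.symK ⊓ Module.End.eigenspace Lp μ = Submodule.map blockScalar
      ((Module.End.eigenspace Lp μ).comap blockScalar) := by
  rw [← map_blockScalar_top, Submodule.map_comap_eq, Submodule.map_top]

theorem finrank_eigenspace : finrank ℝ ↥(standard.symK ⊓ Module.End.eigenspace Lp (7 / 9)) = 6 := by
  rw [symK_inf_eigenspace, finrank_map_blockScalar]
  have h : (Module.End.eigenspace Lp (7 / 9)).comap blockScalar = LinearMap.ker coordSum := by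
    ext m
    rw [Submodule.mem_comap, Module.End.mem_eigenspace_iff, LinearMap.mem_ker, coordSum_apply,
      Lp_eq_iff_sum_eq_zero]
  have hsurj : LinearMap.range coordSum = ⊤ := by
    rw [LinearMap.range_eq_top]
    intro c
    exact ⟨Pi.single 0 c, by rw [coordSum_apply]; simp⟩
  have := LinearMap.finrank_range_add_finrank_ker coordSum
  rw [hsurj, finrank_top] at this
  rw [h]
  simp at this
  omega

theorem finrank_eigenspace_zero :
    finrank ℝ ↥(standard.symK ⊓ Module.End.eigenspace Lp 0) = 1 := by
  rw [symK_inf_eigenspace, finrank_map_blockScalar]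
  have h : (Module.End.eigenspace Lp 0).comap blockScalar =
      Submodule.span ℝ {(1 : Fin 7 → ℝ)} := by
    ext m
    rw [Submodule.mem_comap, Module.End.mem_eigenspace_iff, Lp_eq_zero_iff,
      Submodule.mem_span_singleton]
    refine exists_congr fun c => ?_
    rw [eq_comm]
    refine Eq.congr_left ?_
    funext i; simp
  rw [h, finrank_span_singleton one_ne_zero]

theorem exists_ne_zero_sum_eq_zero : ∃ m : Fin 7 → ℝ, m ≠ 0 ∧ ∑ i, m i = 0 := by
  refine ⟨Pi.single 0 1 - Pi.single 1 1, fun h => ?_, by simp⟩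
  have := congrFun h 0
  simp at this

theorem eigenvalues_eq :
    {μ : ℝ | ∃ A ∈ standard.symK, A ≠ 0 ∧ Lp A = μ • A} = {0, 7 / 9} := by
  have hne : ∀ m, m ≠ 0 → blockScalar m ≠ 0 := fun m hm h0 =>
    hm (blockScalar_injective (by rw [h0, map_zero]))
  ext μ
  constructor
  · rintro ⟨A, hA, h0, h⟩
    obtain ⟨m, rfl⟩ := exists_eq_blockScalar hA
    have hm : m ≠ 0 := by rintro rfl; exact h0 (map_zero _)
    exact (eigenvalue_mem hm h).symm
  · rintro (rfl | rfl)
    · exact ⟨_, blockScalar_mem (fun _ => 1), hne _ (fun h => by simpa using congrFun h 0),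
        (Lp_eq_zero_iff _).2 ⟨1, rfl⟩⟩
    · obtain ⟨m, hm, hs⟩ := exists_ne_zero_sum_eq_zero
      exact ⟨_, blockScalar_mem m, hne m hm, (Lp_eq_iff_sum_eq_zero m).2 hs⟩

theorem specTT_eq : standard.specTT = {7 / 9} := by
  ext μ
  constructor
  · rintro ⟨A, hA, h0, h⟩
    rw [isTT_iff] at hA
    obtain ⟨hA, htr⟩ := hA
    rw [lichnerowicz_eq hA] at h
    obtain ⟨m, rfl⟩ := exists_eq_blockScalar hA
    rw [trace_blockScalar] at htr
    have hs : ∑ i, m i = 0 := by linarith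
    rw [(Lp_eq_iff_sum_eq_zero m).2 hs] at h
    exact (smul_left_injective ℝ h0 h).symm
  · rintro rfl
    obtain ⟨m, hm, hs⟩ := exists_ne_zero_sum_eq_zero
    refine ⟨blockScalar m, (isTT_iff _).2 ⟨blockScalar_mem m, ?_⟩,
      fun h0 => hm (blockScalar_injective (by rw [h0, map_zero])), ?_⟩
    · rw [trace_blockScalar, hs, mul_zero]
    · rw [lichnerowicz_eq (blockScalar_mem m), (Lp_eq_iff_sum_eq_zero m).2 hs]

theorem standard_isGStable : standard.IsGStable (1 / 3) :=
  ⟨standard_isEinstein, 7 / 9, by rw [specTT_eq]; exact isLeast_singleton, by norm_num⟩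

/-! ### The invariant metrics -/

/-- The operator representing `Q` with respect to `g_B` lies in `sym(𝔭)^K`. So, by Schur, every
invariant metric is diagonal in the fixed basis `onb`. -/
theorem exists_form_eq_blockScalar {Q : PosForm} (hQ : Q.IsInvariant) :
    ∃ m, ∀ x y, Q.form x y = standard.form (blockScalar m x) y := by
  let A : Module.End ℝ p := standard.sharp.toLinearMap ∘ₗ Q.form
  have hA : ∀ x y, standard.form (A x) y = Q.form x y := fun x y => standard.form_sharp _ _
  have hmem : A ∈ standard.symK := by
    refine ⟨fun x y => ?_, fun u hu => ?_⟩
    · rw [hA, standard.symm, hA, Q.symm]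
    · ext1 x
      refine standard.ext_form fun z => ?_
      change standard.form (chi u (A x)) z = standard.form (A (chi u x)) z
      rw [hA, ← chi_chi_inv hu z, chi_isometry hu, hA, hQ u hu]
  obtain ⟨m, hm⟩ := exists_eq_blockScalar hmem
  exact ⟨m, fun x y => by rw [← hm, hA]⟩

theorem exists_wt_eq (m : Fin 7 → ℝ) (a : PRoot) : ∃ i, wt m a.1 = m i := by
  obtain ⟨i, hi⟩ := exists_mem_delta a.2
  exact ⟨i, wt_of_mem m hi⟩

theorem exists_pRoot_mem_delta (i : Fin 7) : ∃ a : PRoot, a.1 ∈ delta i :=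
  ⟨⟨_, not_isKRoot_of_mem_delta (deltaEquiv i fun _ => true).2⟩, (deltaEquiv i fun _ => true).2⟩

theorem form_blockScalar_self {m : Fin 7 → ℝ} {i} {a : PRoot} (ha : a.1 ∈ delta i) :
    standard.form (blockScalar m (onb a)) (onb a) = m i := by
  rw [form_blockScalar_onb, wt_of_mem m ha, form_onb_onb, if_pos rfl, mul_one]

theorem log_det_blockScalar {m : Fin 7 → ℝ} (hm : ∀ i, 0 < m i) :
    Real.log (LinearMap.det (blockScalar m)) = 16 * ∑ i, Real.log (m i) := by
  classical
  have h : LinearMap.toMatrix onbBasis onbBasis (blockScalar m) =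
      Matrix.diagonal fun a : PRoot => wt m a.1 := by
    ext a b
    rw [LinearMap.toMatrix_apply, onbBasis_repr, onbBasis_apply, form_blockScalar_onb, form_onb_onb,
      Matrix.diagonal_apply]
    simp only [mul_ite, mul_one, mul_zero, eq_comm]
  rw [← LinearMap.det_toMatrix onbBasis, h, Matrix.det_diagonal, Real.log_prod fun a _ => by
    obtain ⟨i, hi⟩ := exists_wt_eq m a
    rw [hi]
    exact (hm i).ne', sum_pRoot (fun a => Real.log (wt m a)), Finset.mul_sum]
  refine Finset.sum_congr rfl fun k _ => ?_
  rw [Finset.sum_congr rfl fun a ha => by rw [wt_of_mem m (by simpa using ha)], Finset.sum_const,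
    card_filter_delta]
  simp

theorem det_eq_one_of_gram_eq {Q : PosForm} {A : Module.End ℝ p}
    (hA : ∀ x y, Q.form x y = standard.form (A x) y) (h : Q.gram = standard.gram) :
    LinearMap.det A = 1 := by
  have h0 : standard.gram ≠ 0 :=
    (LinearMap.BilinForm.nondegenerate_iff_det_ne_zero (finBasis ℝ p)).1 standard.nondegenerate
  have h1 : Q.form = standard.form.compLeft A := by
    ext x y
    exact hA x y
  rw [PosForm.gram, h1, LinearMap.BilinForm.toMatrix_compLeft, Matrix.det_mul, Matrix.det_transpose,
    LinearMap.det_toMatrix] at h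
  exact mul_right_cancel₀ h0 (h.trans (one_mul _).symm)

/-! ### The scalar curvature of the invariant metrics -/

/-- The structure constants `sc` are totally skew, so the three Koszul terms are multiples of the
same number, with weights from the block values. The pairing is with `g_B`, whence the division by
the weight of `c`. -/
theorem nomizu_blockScalar {Q : PosForm} {m : Fin 7 → ℝ} (hm : ∀ i, 0 < m i)
    (hQ : ∀ x y, Q.form x y = standard.form (blockScalar m x) y) (a b c : PRoot) :
    standard.form (Q.nomizu (onb a) (onb b)) (onb c) =
      sc a.1 b.1 c.1 * (wt m c.1 + wt m b.1 - wt m a.1) / (2 * wt m c.1) := by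
  have hq : ∀ (x : p) (a : PRoot), Q.form x (onb a) = wt m a.1 * standard.form x (onb a) := by
    intro x a
    rw [hQ, form_blockScalar_onb]
  obtain ⟨i, hi⟩ := exists_wt_eq m c
  have hc : wt m c.1 ≠ 0 := hi ▸ (hm i).ne'
  have h := Q.form_nomizu (onb a) (onb b) (onb c)
  rw [Q.symm (onb b), Q.symm (onb a), hq, hq, hq, hq, form_adP_onb, form_adP_onb, form_adP_onb,
    sc_skew' c b a, sc_skew c a b, sc_skew' a c b] at h
  rw [eq_div_iff (by positivity)]
  linarith

/-- The summands of the Ricci curvature of a diagonal metric. -/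
noncomputable def ricciTerm (x y z : ℝ) : ℝ :=
  (x + y - z) / (2 * x) - (z + y - x) * (x + z - y) / (4 * x * z)

/-- The trace defining Ricci needs no metric and is taken in the `g_B`-orthonormal basis. `Λ(b)b =
0` removes one term; the two parts of `ricciTerm` come from `Λ([a, b]_𝔭)b` and `Λ(b)Λ(a)b`; the
`𝔨`-part is independent of `m` and contributes `1/6`. -/
theorem ricci_blockScalar {Q : PosForm} {m : Fin 7 → ℝ} (hm : ∀ i, 0 < m i)
    (hQ : ∀ x y, Q.form x y = standard.form (blockScalar m x) y) (b : PRoot) :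
    Q.ricci (onb b) (onb b) = 1 / 6 + ∑ a : PRoot, ∑ c : PRoot,
      sc b.1 a.1 c.1 ^ 2 * ricciTerm (wt m a.1) (wt m b.1) (wt m c.1) := by
  have hpos : ∀ a : PRoot, wt m a.1 ≠ 0 := by
    intro a
    obtain ⟨i, hi⟩ := exists_wt_eq m a
    exact hi ▸ (hm i).ne'
  have hN := nomizu_blockScalar hm hQ
  have h0 : Q.nomizu (onb b) (onb b) = 0 := by
    refine onb_ext fun c => ?_
    rw [hN, ← form_adP_onb, adP_self]
    simp
  have hexp : ∀ (x y : p) (B : p →ₗ[ℝ] p), standard.form (B x) y =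
      ∑ c, standard.form x (onb c) * standard.form (B (onb c)) y := by
    intro x y B
    conv_lhs => rw [← sum_form_smul_onb x]
    simp [map_sum]
  have h : ∀ a, standard.form (Q.curv (onb a) (onb b) (onb b)) (onb a) =
      (∑ c : PRoot, sc b.1 a.1 c.1 ^ 2 * ricciTerm (wt m a.1) (wt m b.1) (wt m c.1)) -
        killingForm ℝ e7 (projK ⁅(onb b : e7), (onb a : e7)⁆)
          (projK ⁅(onb b : e7), (onb a : e7)⁆) := by
    intro a
    have h4 : projK ⁅(onb a : e7), (onb b : e7)⁆ = -projK ⁅(onb b : e7), (onb a : e7)⁆ := by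
      rw [← lie_skew, map_neg]
    have e1 : standard.form (Q.nomizu (onb b) (Q.nomizu (onb a) (onb b))) (onb a) =
        ∑ c : PRoot, sc b.1 a.1 c.1 ^ 2 * ((wt m c.1 + wt m b.1 - wt m a.1) *
          (wt m a.1 + wt m c.1 - wt m b.1) / (4 * wt m a.1 * wt m c.1)) := by
      rw [hexp]
      refine Finset.sum_congr rfl fun c _ => ?_
      rw [hN, hN, sc_skew a b c, sc_skew' b c a]
      field_simp [hpos a, hpos c]
      ring
    have e2 : standard.form (Q.nomizu (adP (onb a) (onb b)) (onb b)) (onb a) =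
        -∑ c : PRoot, sc b.1 a.1 c.1 ^ 2 * ((wt m a.1 + wt m b.1 - wt m c.1) / (2 * wt m a.1)) := by
      refine (hexp _ _ (Q.nomizu.flip (onb b))).trans ?_
      rw [← Finset.sum_neg_distrib]
      refine Finset.sum_congr rfl fun c _ => ?_
      rw [LinearMap.flip_apply, form_adP_onb, hN, sc_skew a b c, sc_skew c b a, sc_skew' b c a]
      ring
    rw [curv_apply, h0, map_zero, zero_sub, map_sub, map_sub, LinearMap.sub_apply,
      LinearMap.sub_apply, map_neg, LinearMap.neg_apply, form_adP_projK, h4, map_neg, map_neg,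
      LinearMap.neg_apply, e1, e2]
    simp only [ricciTerm, mul_sub, Finset.sum_sub_distrib]
    ring
  have hk := kForm_eq (onb b) (onb b)
  rw [kForm, form_onb_onb, if_pos rfl] at hk
  rw [ricci_apply, Finset.sum_congr rfl fun a _ => h a, Finset.sum_sub_distrib]
  linarith

theorem scal_eq_sum_ricci {Q : PosForm} {m : Fin 7 → ℝ} (hm : ∀ i, 0 < m i)
    (hQ : ∀ x y, Q.form x y = standard.form (blockScalar m x) y) :
    Q.scal = ∑ b : PRoot, Q.ricci (onb b) (onb b) / wt m b.1 := by
  rw [PosForm.scal, trace_eq]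
  refine Finset.sum_congr rfl fun b _ => ?_
  obtain ⟨i, hi⟩ := exists_wt_eq m b
  have hb : wt m b.1 ≠ 0 := hi ▸ (hm i).ne'
  rw [eq_div_iff hb, mul_comm, ← form_blockScalar_onb, ← hQ]
  exact Q.form_sharp _ _

/-- Each block has 16 roots, which turns `1/6` into `8/3` and the bracket count `1/9` into `16/9`.
-/
theorem scal_blockScalar {Q : PosForm} {m : Fin 7 → ℝ} (hm : ∀ i, 0 < m i)
    (hQ : ∀ x y, Q.form x y = standard.form (blockScalar m x) y) :
    Q.scal = ∑ i, (8 / 3 / m i + 16 / 9 * ∑ j, ∑ l, if code l = symmDiff (code i) (code j)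
      then ricciTerm (m j) (m i) (m l) / m i else 0) := by
  classical
  rw [scal_eq_sum_ricci hm hQ]
  simp only [ricci_blockScalar hm hQ]
  have h1 : ∀ b : PRoot, (∑ a : PRoot, ∑ c : PRoot,
      sc b.1 a.1 c.1 ^ 2 * ricciTerm (wt m a.1) (wt m b.1) (wt m c.1)) =
        ∑ a : PRoot, ∑ l, ∑ c : Root with c ∈ delta l,
          sc b.1 a.1 c ^ 2 * ricciTerm (wt m a.1) (wt m b.1) (wt m c) := fun b =>
    Finset.sum_congr rfl fun a _ => sum_pRoot fun c =>
      sc b.1 a.1 c ^ 2 * ricciTerm (wt m a.1) (wt m b.1) (wt m c)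
  have h2 : ∀ b : PRoot, (∑ a : PRoot, ∑ l, ∑ c : Root with c ∈ delta l,
          sc b.1 a.1 c ^ 2 * ricciTerm (wt m a.1) (wt m b.1) (wt m c)) =
        ∑ j, ∑ a : Root with a ∈ delta j, ∑ l, ∑ c : Root with c ∈ delta l,
          sc b.1 a c ^ 2 * ricciTerm (wt m a) (wt m b.1) (wt m c) := fun b =>
    sum_pRoot fun a => ∑ l, ∑ c : Root with c ∈ delta l,
          sc b.1 a c ^ 2 * ricciTerm (wt m a) (wt m b.1) (wt m c)
  simp only [h1, h2]
  rw [sum_pRoot fun b => (1 / 6 + ∑ j, ∑ a : Root with a ∈ delta j, ∑ l,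
    ∑ c : Root with c ∈ delta l, sc b a c ^ 2 * ricciTerm (wt m a) (wt m b) (wt m c)) / wt m b]
  refine Finset.sum_congr rfl fun i _ => ?_
  have h3 : ∀ b ∈ delta i, (1 / 6 + ∑ j, ∑ a : Root with a ∈ delta j, ∑ l,
      ∑ c : Root with c ∈ delta l, sc b a c ^ 2 * ricciTerm (wt m a) (wt m b) (wt m c)) / wt m b =
      1 / 6 / m i + 1 / 9 * ∑ j, ∑ l, if code l = symmDiff (code i) (code j)
        then ricciTerm (m j) (m i) (m l) / m i else 0 := by
    intro b hb
    have h4 : ∀ j, (∑ a : Root with a ∈ delta j, ∑ l,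
      ∑ c : Root with c ∈ delta l, sc b a c ^ 2 * ricciTerm (wt m a) (wt m b) (wt m c)) =
        ∑ l, (if code l = symmDiff (code i) (code j) then 1 / 9 else 0) *
          ricciTerm (m j) (m i) (m l) := by
      intro j
      rw [Finset.sum_comm]
      refine Finset.sum_congr rfl fun l _ => ?_
      rw [← sum_sum_sc_sq hb, Finset.sum_mul]
      refine Finset.sum_congr rfl fun a ha => ?_
      rw [Finset.sum_mul]
      refine Finset.sum_congr rfl fun c hc => ?_
      rw [wt_of_mem m (by simpa using ha), wt_of_mem m hb, wt_of_mem m (by simpa using hc)]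
    simp only [h4]
    rw [wt_of_mem m hb, add_div]
    simp only [Finset.sum_div, Finset.mul_sum]
    congr 1
    refine Finset.sum_congr rfl fun j _ => Finset.sum_congr rfl fun l _ => ?_
    split_ifs <;> ring
  rw [Finset.sum_congr rfl fun b hb => h3 b (by simpa using hb), Finset.sum_const, card_filter_delta]
  simp only [nsmul_eq_mul]
  push_cast
  ring

/-! ### The standard metric is a local maximum of the scalar curvature -/

/-- The cubic remainder is at most `(2/9)|t|³ ≤ t²/45`. Having it relative to `t²` lets it be
absorbed into the quadratic form below. -/
theorem abs_exp_sub_le {t : ℝ} (ht : |t| ≤ 1 / 10) :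
    |Real.exp t - (1 + t + t ^ 2 / 2)| ≤ t ^ 2 / 40 := by
  have h := Real.exp_bound (x := t) (by linarith) (n := 3) (by norm_num)
  have h1 : ∑ i ∈ Finset.range 3, t ^ i / (i.factorial : ℝ) = 1 + t + t ^ 2 / 2 := by
    simp [Finset.sum_range_succ, Nat.factorial]
  rw [h1] at h
  refine h.trans ?_
  have h2 : |t| ^ 3 = |t| * t ^ 2 := by rw [pow_succ, sq_abs, mul_comm]
  rw [h2]
  norm_num [Nat.factorial]
  nlinarith [sq_nonneg t, mul_le_mul_of_nonneg_right ht (sq_nonneg t)]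

/-- The index of the summand that contains the brackets of two summands. -/
def third : Fin 7 → Fin 7 → Fin 7 :=
  -- The diagonal entries are placeholders: two equal blocks have no third one, and they are only
  -- used with `i ≠ j`.
  ![![0, 2, 1, 4, 3, 6, 5], ![2, 1, 0, 6, 5, 4, 3], ![1, 0, 2, 5, 6, 3, 4], ![4, 6, 5, 3, 0, 2, 1],
    ![3, 5, 6, 0, 4, 1, 2], ![6, 4, 3, 2, 1, 5, 0], ![5, 3, 4, 1, 2, 0, 6]]

theorem code_eq_symmDiff_iff (i j l : Fin 7) :
    code l = symmDiff (code i) (code j) ↔ i ≠ j ∧ l = third i j := by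
  revert i j l; decide

/-- Written as a combination of monomials in `x`, `y`, `z` and their inverses, so that `m = exp u`
turns every term into an exponential of a linear form. -/
theorem ricciTerm_div {x y z : ℝ} (hx : x ≠ 0) (hy : y ≠ 0) (hz : z ≠ 0) :
    ricciTerm x y z / y = (x⁻¹ + y⁻¹ - z⁻¹) / 2 +
      (x * y⁻¹ * z⁻¹ + y * z⁻¹ * x⁻¹ - 3 * (z * x⁻¹ * y⁻¹)) / 4 := by
  simp only [ricciTerm]
  field_simp
  ring

/-- The contribution of a triple of summands to the scalar curvature. -/
noncomputable def tripleTerm (x y z : ℝ) : ℝ :=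
  x * y⁻¹ * z⁻¹ + y * z⁻¹ * x⁻¹ + z * x⁻¹ * y⁻¹

/-- The scalar curvature as a sum over the lines of the Fano plane. -/
theorem sum_ricciTerm {m : Fin 7 → ℝ} (hm : ∀ i, m i ≠ 0) :
    ∑ i, (8 / 3 / m i + 16 / 9 * ∑ j, ∑ l, if code l = symmDiff (code i) (code j)
      then ricciTerm (m j) (m i) (m l) / m i else 0) = 8 * ∑ i, (m i)⁻¹ -
        8 / 9 * (tripleTerm (m 0) (m 1) (m 2) + tripleTerm (m 0) (m 3) (m 4) +
          tripleTerm (m 0) (m 5) (m 6) + tripleTerm (m 1) (m 3) (m 6) +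
          tripleTerm (m 1) (m 4) (m 5) + tripleTerm (m 2) (m 3) (m 5) +
          tripleTerm (m 2) (m 4) (m 6)) := by
  have h : ∀ i j, (∑ l, if code l = symmDiff (code i) (code j)
      then ricciTerm (m j) (m i) (m l) / m i else 0) = if i ≠ j then
        ricciTerm (m j) (m i) (m (third i j)) / m i else 0 := by
    intro i j
    simp only [code_eq_symmDiff_iff, ite_and]
    split_ifs <;> simp
  have h2 : ∀ i, 8 / 3 / m i = 8 / 3 * (m i)⁻¹ := fun i => div_eq_mul_inv _ _
  -- The six orderings of a line contribute the sum of the three inverses minus half of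
  -- `tripleTerm`. Each index is on three lines, so the inverses get `8/3 + 3 · 16/9 = 8`, and the
  -- triples get `-8/9`.
  simp only [h, h2, Fin.sum_univ_seven, tripleTerm]
  simp [third, ricciTerm_div (hm _) (hm _) (hm _), -one_div]
  ring

/-- The constant term is `56 - (8/9) · 21 = 112/3`, and the linear terms are multiples of `∑ u = 0`.
Every pair of indices is on exactly one line and every index on three, so, using `∑ u = 0`, the
quadratic forms of the lines add up to `10 ∑ u²`. The Taylor bounds then leave `8 · 21/40 - (8/9) ·
(19/40) · 10 = -1/45` as coefficient of `∑ u²`; the error `1/40` is small enough to keep it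
negative. -/
theorem sum_inv_sub_tripleTerm_le {u : Fin 7 → ℝ} (hu : ∀ i, |u i| ≤ 1 / 30) (hs : ∑ i, u i = 0)
    {m : Fin 7 → ℝ} (hm : ∀ i, m i = Real.exp (u i)) :
    8 * ∑ i, (m i)⁻¹ - 8 / 9 * (tripleTerm (m 0) (m 1) (m 2) + tripleTerm (m 0) (m 3) (m 4) +
          tripleTerm (m 0) (m 5) (m 6) + tripleTerm (m 1) (m 3) (m 6) +
          tripleTerm (m 1) (m 4) (m 5) + tripleTerm (m 2) (m 3) (m 5) +
          tripleTerm (m 2) (m 4) (m 6)) ≤ 112 / 3 := by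
  have h1 : ∀ i, (m i)⁻¹ ≤ 1 - u i + 21 / 40 * u i ^ 2 := by
    intro i
    have := (abs_le.1 (abs_exp_sub_le (t := -u i) (by rw [abs_neg]; linarith [hu i]))).2
    rw [hm, ← Real.exp_neg]
    linarith [neg_sq (u i)]
  have h2 : ∀ i j k, 1 + (u i - u j - u k) + 19 / 40 * (u i - u j - u k) ^ 2 ≤
      m i * (m j)⁻¹ * (m k)⁻¹ := by
    intro i j k
    have ht : |u i - u j - u k| ≤ 1 / 10 := by
      have hi := abs_le.1 (hu i)
      have hj := abs_le.1 (hu j)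
      have hk := abs_le.1 (hu k)
      rw [abs_le]
      constructor <;> linarith
    have := (abs_le.1 (abs_exp_sub_le ht)).1
    rw [hm, hm, hm, ← Real.exp_neg, ← Real.exp_neg, ← Real.exp_add, ← Real.exp_add,
      ← sub_eq_add_neg, ← sub_eq_add_neg]
    linarith
  have h3 : ∀ i j k, 3 - (u i + u j + u k) + 19 / 40 * (4 * (u i ^ 2 + u j ^ 2 + u k ^ 2) -
      (u i + u j + u k) ^ 2) ≤ tripleTerm (m i) (m j) (m k) := by
    intro i j k
    rw [tripleTerm]
    nlinarith [h2 i j k, h2 j k i, h2 k i j]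
  have hs2 : (∑ i, u i) ^ 2 = 0 := by rw [hs]; norm_num
  rw [Fin.sum_univ_seven] at hs hs2
  rw [Fin.sum_univ_seven]
  nlinarith [h1 0, h1 1, h1 2, h1 3, h1 4, h1 5, h1 6, h3 0 1 2, h3 0 3 4, h3 0 5 6, h3 1 3 6,
    h3 1 4 5, h3 2 3 5, h3 2 4 6, sq_nonneg (u 0), sq_nonneg (u 1), sq_nonneg (u 2),
    sq_nonneg (u 3), sq_nonneg (u 4), sq_nonneg (u 5), sq_nonneg (u 6)]

theorem scal_standard : standard.scal = 112 / 3 := by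
  have h : ∀ x y, standard.form x y = standard.form (blockScalar 1 x) y := fun x y => by
    rw [blockScalar_one]; rfl
  rw [scal_blockScalar (fun _ => one_pos) h, sum_ricciTerm fun _ => one_ne_zero]
  simp [tripleTerm]
  norm_num

theorem standard_isLocalMaxScal : standard.IsLocalMaxScal := by
  -- `|mᵢ - 1| ≤ 1/60` gives `|log mᵢ| ≤ 1/30`, so a combination of three logarithms stays within
  -- the range `1/10` of the exponential estimate.
  refine ⟨1 / 60, by norm_num, fun Q hQ hclose => ?_⟩
  obtain ⟨m, hm⟩ := exists_form_eq_blockScalar hQ.1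
  have hself : ∀ i, ∃ x, Q.form x x = m i ∧ standard.form x x = 1 := by
    intro i
    obtain ⟨a, ha⟩ := exists_pRoot_mem_delta i
    exact ⟨onb a, by rw [hm, form_blockScalar_self ha], by rw [form_onb_onb, if_pos rfl]⟩
  have hnear : ∀ i, |m i - 1| ≤ 1 / 60 := by
    intro i
    obtain ⟨x, h1, h2⟩ := hself i
    have := hclose x
    rwa [h1, h2, mul_one] at this
  have hpos : ∀ i, 0 < m i := fun i => by linarith [(abs_le.1 (hnear i)).1]
  have hlog : ∀ i, |Real.log (m i)| ≤ 1 / 30 := by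
    intro i
    have h1 := abs_le.1 (hnear i)
    have h2 := Real.log_le_sub_one_of_pos (hpos i)
    have h3 := Real.one_sub_inv_le_log_of_pos (hpos i)
    have h4 : (m i)⁻¹ ≤ 60 / 59 := by
      rw [inv_le_comm₀ (hpos i) (by norm_num)]
      linarith
    rw [abs_le]
    constructor <;> linarith
  -- Equal Gram determinants mean that the operator of `Q` has determinant 1, and this determinant
  -- is the product of the `mᵢ¹⁶`.
  have hsum : ∑ i, Real.log (m i) = 0 := by
    have h := log_det_blockScalar hpos
    rw [det_eq_one_of_gram_eq hm hQ.2, Real.log_one] at h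
    linarith
  rw [scal_blockScalar hpos hm, scal_standard, sum_ricciTerm fun i => (hpos i).ne']
  exact sum_inv_sub_tripleTerm_le hlog hsum fun i => (Real.exp_log (hpos i)).symm

end E7SU2

theorem mainTheorem10 :
    -- the isotropy summands
    ((∀ i, Module.finrank ℝ (E7SU2.summand i) = 16) ∧
      DirectSum.IsInternal E7SU2.summand ∧
      (∀ i j, i ≠ j → ∀ x ∈ E7SU2.summand i, ∀ y ∈ E7SU2.summand j,
        E7SU2.standard.form x y = 0) ∧
      (∀ i, E7SU2.IsoIrreducible (E7SU2.summand i)) ∧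
      (∀ i j, i ≠ j → ¬ E7SU2.IsoEquivalent (E7SU2.summand i) (E7SU2.summand j))) ∧
    -- the structural constants
    (∀ X : Fin 7 → Fin 16 → E7SU2.p,
      (∀ i, E7SU2.IsOrthonormalBasisOf (X i) (E7SU2.summand i)) →
      ∀ i j l, E7SU2.structConst (X i) (X j) (X l) =
        if E7SU2.code l = symmDiff (E7SU2.code i) (E7SU2.code j) then 16 / 9 else 0) ∧
    -- the standard metric is an invariant Einstein metric
    (E7SU2.standard.IsInvariant ∧ E7SU2.standard.IsEinstein (1 / 3)) ∧
    -- the Lichnerowicz Laplacian on invariant tensors is `Lp`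
    (∀ A ∈ E7SU2.standard.symK,
      E7SU2.Lp A ∈ E7SU2.standard.symK ∧ E7SU2.standard.lichnerowicz A = E7SU2.Lp A) ∧
    (∀ A, E7SU2.standard.IsTT A ↔ A ∈ E7SU2.standard.symK ∧ LinearMap.trace ℝ E7SU2.p A = 0) ∧
    -- the spectrum of `Lp`
    (Module.finrank ℝ E7SU2.standard.symK = 7 ∧
      {μ : ℝ | ∃ A ∈ E7SU2.standard.symK, A ≠ 0 ∧ E7SU2.Lp A = μ • A} = {0, 7 / 9} ∧
      Module.finrank ℝ
        ↥(E7SU2.standard.symK ⊓ Module.End.eigenspace E7SU2.Lp (7 / 9)) = 6 ∧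
      Module.finrank ℝ
        ↥(E7SU2.standard.symK ⊓ Module.End.eigenspace E7SU2.Lp 0) = 1) ∧
    -- stability
    (IsLeast E7SU2.standard.specTT (7 / 9) ∧ 2 * (1 / 3 : ℝ) < 7 / 9 ∧
      E7SU2.standard.IsGStable (1 / 3) ∧ E7SU2.standard.IsLocalMaxScal) := by
  refine ⟨⟨E7SU2.finrank_summand, E7SU2.summand_isInternal,
    fun i j hij x hx y hy => E7SU2.summand_orthogonal hij hx hy, E7SU2.isoIrreducible_summand,
    fun i j hij => E7SU2.not_isoEquivalent hij⟩, fun X hX i j l => ?_,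
    ⟨E7SU2.standard_isInvariant, E7SU2.standard_isEinstein⟩,
    fun A hA => ⟨E7SU2.Lp_mem hA, E7SU2.lichnerowicz_eq hA⟩, E7SU2.isTT_iff,
    ⟨E7SU2.finrank_symK, E7SU2.eigenvalues_eq, E7SU2.finrank_eigenspace,
      E7SU2.finrank_eigenspace_zero⟩, ?_, by norm_num, E7SU2.standard_isGStable,
    E7SU2.standard_isLocalMaxScal⟩
  · rw [E7SU2.structConst_eq_sum (hX i) (hX j) (hX l), E7SU2.sum_sum_sum_sc_sq]
  · rw [E7SU2.specTT_eq]
    exact isLeast_singleton
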